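/- Let $\mathbb K=\mathbb R$ or $\mathbb C$, $n\ge 1$, and $\alpha\in\mathbb K$, $\alpha\ne 0$. A twisted ideal $n$-gon is a sequence $\mathbf P=(p_i)_{i\in\mathbb Z}$ of points of $\mathbb P^1(\mathbb K)$ with $p_i\ne p_{i+1}$ and $p_i\neq p_{i+2}$ for all $i$, together with a monodromy $\Phi\in\mathrm{PGL}(2,\mathbb K)$ such that $p_{i+n}=\Phi(p_i)$ for all $i$. Put $[a,b,c,d]=\frac{(a-c)(b-d)}{(a-d)(b-c)}$, and write $\mathbf P\stackrel{\alpha}{\sim}\mathbf Q$ if $\mathbf P$ and $\mathbf Q$ have the same monodromy and $[p_i,p_{i+1},q_i,q_{i+1}]=\alpha$ for all $i$. The group $\mathrm{PGL}(2,\mathbb K)$ acts on twisted $n$-gons (conjugating the monodromy); let $\mathcal T_n$ be the quotient, with the induced relation $\stackrel{\alpha}{\sim}$ (two classes are related if they have related representatives). The $n$-periodic cross-ratios $c_i=[p_i,p_{i+1},p_{i-1},p_{i+2}]$ are coordinates on $\mathcal T_n$: they identify $\mathcal T_n$ with $(\mathbb K^*)^n$. All indices of the $c_i$ are modulo $n$.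 For $\beta\in\mathbb K$ let $\{\cdot,\cdot\}_\beta$ be the bracket with $$\{c_i,c_{i+1}\}_\beta=c_ic_{i+1}(c_i+c_{i+1}-\beta),\qquad \{c_i,c_{i+2}\}_\beta=c_ic_{i+1}c_{i+2},$$ where the brackets of coordinates that are not mentioned are zero or follow by skew-symmetry (if $n\le 4$, so that several of these rules concern the same pair of indices, their contributions are added). Let $c_{[n]}=c_1\cdots c_n$, let $F_k$ be the sum of the products $\prod_{i\in I}c_i$ over all $k$-element subsets $I\subset\mathbb Z/n$ containing no two cyclically consecutive indices ($i\in I\Rightarrow i+1\notin I$), and let $$E_\alpha=\frac1{c_{[n]}}\Big(\sum_{k=0}^{\lfloor n/2\rfloor}(-1)^kF_k\alpha^{-k}\Big)^2,\qquad \frac{c_{even}}{c_{odd}}=\frac{c_2c_4\cdots c_n}{c_1c_3\cdots c_{n-1}}\quad(n\text{ even}).$$ "Generic" means: on the complement in $(\mathbb K^*)^n$ of the zero set of some non-zero polynomial. Functions are called independent if their differentials are linearly independent at generic points. Then the relation $\stackrel{\alpha}{\sim}$ on $\mathcal T_n$ is completely integrable in the following sense. 1. All the brackets $\{\cdot,\cdot\}_\beta$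 are Poisson, and $\{\cdot,\cdot\}_\alpha$ is invariant under $\stackrel{\alpha}{\sim}$: if $c$ is generic and $c\stackrel{\alpha}{\sim}d$, then there is a local $C^1$ branch of the relation through $(c,d)$ (a $C^1$ map $T$ on an open neighbourhood of $c$ with $T(c)=d$ and $c'\stackrel{\alpha}{\sim}T(c')$ for all $c'$), and every $C^1$ branch of the relation on an open set is a Poisson map. The functions $c_{[n]},F_1,\dots,F_{\lfloor n/2\rfloor}$ are independent and invariant under $\stackrel{\alpha}{\sim}$. The functions $F_k^2/c_{[n]}$, $0\le k\le\lfloor n/2\rfloor$, pairwise commute with respect to $\{\cdot,\cdot\}_\alpha$. 2. If $n$ is odd, then $\{\cdot,\cdot\}_\alpha$ has corank $1$ at generic points, $E_\alpha$ is a Casimir function, and $E_\alpha$ and $F_k^2/c_{[n]}$, $k=1,\dots,\frac{n-1}2$, are independent. 3. If $n$ is even, then $\{\cdot,\cdot\}_\alpha$ has corank $2$ at generic points, $E_\alpha$ and $c_{even}/c_{odd}$ are Casimir functions, and $E_\alpha$, $c_{even}/c_{odd}$ and $F_k^2/c_{[n]}$, $k=1,\dots,\frac{n-2}2$, are independent.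 4. The space of the Hamiltonian vector fields of the integrals does not depend on the choice of the bracket in the family: for all $\beta,\gamma\in\mathbb K$, (a) at every point of $(\mathbb K^*)^n$, the Hamiltonian vectors of $c_{[n]},F_1,\dots,F_{\lfloor n/2\rfloor}$ with respect to $\{\cdot,\cdot\}_\beta$ and with respect to $\{\cdot,\cdot\}_\gamma$ span the same subspace; and (b) if $U\subset(\mathbb K^*)^n$ is open and $s$ is a differentiable function on $U$ with $s^2=\varepsilon c_{[n]}$ for a constant $\varepsilon\ne0$, then the Hamiltonian vector fields on $U$ of the functions $F_k/s$, $0\le k\le\lfloor n/2\rfloor$, with respect to $\{\cdot,\cdot\}_\beta$ and with respect to $\{\cdot,\cdot\}_\gamma$ have the same linear span over $\mathbb K$ in the space of vector fields on $U$. -/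

import Mathlib

open scoped LinearAlgebra.Projectivization MatrixGroups

noncomputable section

namespace TwistedIdeal

/-! ### Twisted ideal polygons -/

section Polygons

variable {K : Type*} [Field K]

/-- The determinant of two homogeneous coordinate vectors of points of the projective line;
for `p = (x : 1)` and `q = (y : 1)` it is, up to the scaling of the vectors, `x - y`. -/
def wedge (p q : ℙ K (Fin 2 → K)) : K :=
  p.rep 0 * q.rep 1 - p.rep 1 * q.rep 0

/-- The cross-ratio `[a, b, c, d] = ((a - c) (b - d)) / ((a - d) (b - c))` of points of the
projective line, in homogeneous coordinates. If the denominator vanishes the value is `0`. -/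
def crossRatio (a b c d : ℙ K (Fin 2 → K)) : K :=
  (wedge a c * wedge b d) / (wedge a d * wedge b c)

theorem exists_wedge_smul (g : GL (Fin 2) K) : ∃ t : ℙ K (Fin 2 → K) → K, (∀ p, t p ≠ 0) ∧
    ∀ p q, wedge ((Matrix.ProjGenLinGroup.mk g : PGL(2, K)) • p)
      ((Matrix.ProjGenLinGroup.mk g : PGL(2, K)) • q) =
        t p * t q * ((g : Matrix (Fin 2) (Fin 2) K).det * wedge p q) := by
  have key : ∀ p : ℙ K (Fin 2 → K), ∃ t : K, t ≠ 0 ∧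
      ((Matrix.ProjGenLinGroup.mk g : PGL(2, K)) • p).rep = t • (g • p.rep) := by
    intro p
    have h1 : (Matrix.ProjGenLinGroup.mk g : PGL(2, K)) • p =
        Projectivization.mk K (g • p.rep) ((smul_ne_zero_iff_ne g).2 p.rep_nonzero) := by
      conv_lhs => rw [← p.mk_rep]
      rfl
    obtain ⟨a, ha⟩ := Projectivization.exists_smul_eq_mk_rep K (g • p.rep)
      ((smul_ne_zero_iff_ne g).2 p.rep_nonzero)
    refine ⟨(a : K), a.ne_zero, ?_⟩
    rw [h1, ← ha]
    rfl
  choose t ht0 ht using key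
  refine ⟨t, ht0, fun p q => ?_⟩
  unfold wedge
  rw [ht p, ht q, Matrix.det_fin_two]
  simp only [Matrix.GeneralLinearGroup.fin_two_smul, Pi.smul_apply, smul_eq_mul,
    Matrix.cons_val_zero, Matrix.cons_val_one]
  ring

theorem crossRatio_smul (Ψ : PGL(2, K)) (a b c d : ℙ K (Fin 2 → K)) :
    crossRatio (Ψ • a) (Ψ • b) (Ψ • c) (Ψ • d) = crossRatio a b c d := by
  obtain ⟨g, rfl⟩ := Matrix.ProjGenLinGroup.mk_surjective Ψ
  obtain ⟨t, ht, h⟩ := exists_wedge_smul g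
  have hg : (g : Matrix (Fin 2) (Fin 2) K).det ≠ 0 := g.det_ne_zero
  unfold crossRatio
  simp only [h]
  have hs : t a * t b * t c * t d * (g : Matrix (Fin 2) (Fin 2) K).det ^ 2 ≠ 0 := by
    have := ht a; have := ht b; have := ht c; have := ht d
    positivity
  rw [← mul_div_mul_left (wedge a c * wedge b d) (wedge a d * wedge b c) hs]
  congr 1 <;> ring

variable (K) in
/-- A (non-degenerate) twisted ideal `n`-gon: a bi-infinite sequence of points of the projective
line with a monodromy in `PGL(2, K)`. -/
@[ext]
structure TwistedPolygon (n : ℕ) where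
  vertex : ℤ → ℙ K (Fin 2 → K)
  monodromy : PGL(2, K)
  vertex_add : ∀ i, vertex (i + n) = monodromy • vertex i
  vertex_ne_one : ∀ i, vertex i ≠ vertex (i + 1)
  vertex_ne_two : ∀ i, vertex i ≠ vertex (i + 2)

variable {n : ℕ}

/-- The diagonal action of `PGL(2, K)` on twisted polygons. -/
instance : MulAction PGL(2, K) (TwistedPolygon K n) where
  smul Ψ P :=
    { vertex := fun i => Ψ • P.vertex i
      monodromy := Ψ * P.monodromy * Ψ⁻¹
      vertex_add := fun i => by simp [P.vertex_add, mul_smul]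
      vertex_ne_one := fun i h => P.vertex_ne_one i (MulAction.injective Ψ h)
      vertex_ne_two := fun i h => P.vertex_ne_two i (MulAction.injective Ψ h) }
  one_smul P := by
    refine TwistedPolygon.ext (funext fun i => one_smul _ _) ?_
    change 1 * P.monodromy * 1⁻¹ = P.monodromy
    simp
  mul_smul Ψ Θ P := by
    refine TwistedPolygon.ext (funext fun i => mul_smul _ _ _) ?_
    change Ψ * Θ * P.monodromy * (Ψ * Θ)⁻¹ = Ψ * (Θ * P.monodromy * Θ⁻¹) * Ψ⁻¹
    group

/-- The relation `P ∼ Q` with constant `α` on twisted polygons. -/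
def TwistedPolygon.Related (α : K) (P Q : TwistedPolygon K n) : Prop :=
  P.monodromy = Q.monodromy ∧
    ∀ i, crossRatio (P.vertex i) (P.vertex (i + 1)) (Q.vertex i) (Q.vertex (i + 1)) = α

/-- The numbers `c_i = [p_i, p_{i+1}, p_{i-1}, p_{i+2}]`, with the (`n`-periodic) index
taken in `ZMod n`. -/
def TwistedPolygon.coord (P : TwistedPolygon K n) (i : ZMod n) : K :=
  crossRatio (P.vertex i.val) (P.vertex (i.val + 1)) (P.vertex (i.val - 1)) (P.vertex (i.val + 2))

variable (K n) in
/-- The moduli space of twisted ideal `n`-gons. -/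
abbrev Moduli : Type _ := MulAction.orbitRel.Quotient PGL(2, K) (TwistedPolygon K n)

/-- The relation with constant `α` on the moduli space. -/
def Moduli.Related (α : K) (P Q : Moduli K n) : Prop :=
  ∃ P' Q' : TwistedPolygon K n,
    Quotient.mk _ P' = P ∧ Quotient.mk _ Q' = Q ∧ P'.Related α Q'

/-- The cross-ratio coordinates on the moduli space. -/
def Moduli.coord (P : Moduli K n) : ZMod n → K :=
  Quotient.lift TwistedPolygon.coord (by
    rintro P Q ⟨Ψ, rfl⟩
    funext i
    exact crossRatio_smul Ψ _ _ _ _) P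

/-- The relation with constant `α` on the moduli space, read in the coordinates. -/
def CoordRelated (α : K) (c d : ZMod n → K) : Prop :=
  ∃ P Q : Moduli K n, P.Related α Q ∧ P.coord = c ∧ Q.coord = d

end Polygons

/-! ### Functions and brackets in the coordinates -/

variable {K : Type*} [RCLike K] {n : ℕ} [NeZero n]

variable (K n) in
/-- The points all of whose coordinates are non-zero. -/
def torus : Set (ZMod n → K) := {c | ∀ i, c i ≠ 0}

/-- A property of points of the torus holds generically: it holds on the complement of the zero set
of a non-zero polynomial. -/
def Generically (p : (ZMod n → K) → Prop) : Prop :=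
  ∃ g : MvPolynomial (ZMod n) K, g ≠ 0 ∧ ∀ c ∈ torus K n, MvPolynomial.eval c g ≠ 0 → p c

/-- The partial derivative with respect to `c_j`. -/
def pd (j : ZMod n) (f : (ZMod n → K) → K) (c : ZMod n → K) : K :=
  fderiv K f c (Pi.single j 1)

/-- The bracket of two functions for the bivector field with the components `{c_i, c_j} = J c i j`. -/
def bracket (J : (ZMod n → K) → Matrix (ZMod n) (ZMod n) K) (f g : (ZMod n → K) → K)
    (c : ZMod n → K) : K :=
  ∑ i, ∑ j, J c i j * pd i f c * pd j g c

/-- The Hamiltonian vector field `{ · , f}`: its `i`-th component is `{c_i, f}`. -/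
def hamiltonian (J : (ZMod n → K) → Matrix (ZMod n) (ZMod n) K) (f : (ZMod n → K) → K)
    (c : ZMod n → K) : ZMod n → K :=
  fun i => ∑ j, J c i j * pd j f c

/-- `J` is a Poisson bivector field on the torus: it is skew-symmetric and
satisfies the Jacobi identity. -/
structure IsPoisson (J : (ZMod n → K) → Matrix (ZMod n) (ZMod n) K) : Prop where
  skew : ∀ c ∈ torus K n, ∀ i j, J c i j = -J c j i
  jacobi : ∀ c ∈ torus K n, ∀ i j k,
    ∑ l, (J c i l * pd l (fun x => J x j k) c + J c j l * pd l (fun x => J x k i) c +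
      J c k l * pd l (fun x => J x i j) c) = 0

/-- The bracket with `{c_i, c_{i+1}} = c_i c_{i+1} (c_i + c_{i+1} - α)`,
`{c_i, c_{i+2}} = c_i c_{i+1} c_{i+2}`, the other brackets being zero or following by
skew-symmetry. If `n ≤ 4` several of these rules may concern the same pair of indices; their
contributions are then added up. -/
def poisson (α : K) (c : ZMod n → K) : Matrix (ZMod n) (ZMod n) K := fun i j =>
  (if j = i + 1 then c i * c j * (c i + c j - α) else 0)
    - (if i = j + 1 then c i * c j * (c i + c j - α) else 0)
    + (if j = i + 2 then c i * c (i + 1) * c j else 0)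
    - (if i = j + 2 then c j * c (j + 1) * c i else 0)

/-- `f` is a Casimir function of `J` on the torus. -/
def IsCasimir (J : (ZMod n → K) → Matrix (ZMod n) (ZMod n) K) (f : (ZMod n → K) → K) : Prop :=
  ∀ g : (ZMod n → K) → K, ∀ c ∈ torus K n, bracket J f g c = 0

/-- The product `c_{[n]}` of all the coordinates. -/
def prodAll (c : ZMod n → K) : K := ∏ i, c i

open Classical in
/-- `F_k`: the sum of the products `c_I` over the cyclically sparse sets `I` with `k` elements. -/
def F (k : ℕ) (c : ZMod n → K) : K :=
  ∑ I ∈ (Finset.univ : Finset (Finset (ZMod n))).filter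
    (fun I => I.card = k ∧ ∀ i ∈ I, i + 1 ∉ I), ∏ i ∈ I, c i

/-- `F_k ^ 2 / c_{[n]}`. -/
def normF (k : ℕ) (c : ZMod n → K) : K := F k c ^ 2 / prodAll c

/-- `E_α`. -/
def casimirE (α : K) (c : ZMod n → K) : K :=
  (∑ k ∈ Finset.range (n / 2 + 1), (-1) ^ k * F k c * (α⁻¹) ^ k) ^ 2 / prodAll c

/-- `c_even / c_odd`, for `n` even. -/
def evenOdd (c : ZMod n → K) : K :=
  (∏ i with Even i.val, c i) / (∏ i with Odd i.val, c i)

variable (K n) in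
/-- The integrals `c_{[n]}, F_1, …, F_{⌊n/2⌋}`. -/
def integrals : Fin (n / 2 + 1) → (ZMod n → K) → K :=
  Fin.cons prodAll fun k : Fin (n / 2) => F (k + 1)

/-- The differentials of the functions are linearly independent at generic points. -/
def Independent {m : ℕ} (f : Fin m → (ZMod n → K) → K) : Prop :=
  Generically fun c => LinearIndependent K fun k => fderiv K (f k) c

/-! ### Invariance of a bracket under the relation -/

/-- A single-valued continuously differentiable local branch, on the open set `U`, of the
(multivalued) relation with constant `α`. -/
structure IsBranch (α : K) (U : Set (ZMod n → K)) (T : (ZMod n → K) → ZMod n → K) : Prop where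
  isOpen : IsOpen U
  contDiffOn : ContDiffOn K 1 T U
  related : ∀ c ∈ U, CoordRelated α c (T c)

/-- The bracket `J` is invariant under the relation with constant `α`: over generic points the
relation consists of local branches, and all local branches are Poisson maps. -/
structure IsInvariant (α : K) (J : (ZMod n → K) → Matrix (ZMod n) (ZMod n) K) : Prop where
  exists_branch : Generically fun c : ZMod n → K => ∀ d, CoordRelated α c d →
    ∃ U T, IsBranch α U T ∧ c ∈ U ∧ T c = d
  isPoissonMap : ∀ U T, IsBranch α U T → ∀ c ∈ U, ∀ f g : (ZMod n → K) → K,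
    DifferentiableAt K f (T c) → DifferentiableAt K g (T c) →
      bracket J (f ∘ T) (g ∘ T) c = bracket J f g (T c)

end TwistedIdeal

end

noncomputable section

namespace TwistedIdeal

/-! ### Wedges, the Plücker relation and cross-ratios -/

section Geometry

variable {K : Type*} [Field K]

/-! The relation is governed by one parametrization of related pairs. For P ∼ Q put x_i = [p_{i+1},
p_i, q_i, p_{i-1}]. Then P has the cross-ratios c_i = α x_i (1 - x_{i+1}) and Q has d_i = α x_{i+1}
(1 - x_i) (`TwistedPolygon.Related.exists_param`). Conversely, if α ≠ 1, every periodic x that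
avoids 0 and 1 occurs (`coordRelated_miura`); this uses lifts of polygons to the plane with V_{i+2}
= V_{i+1} - c_i V_i, which also show that the c_i are coordinates. So the relation becomes the
correspondence between `miura α x` and `miuraDual α x`.

Invariance of the bracket: the log-canonical bracket {x_i, x_{i+1}} = -α x_i (1 - x_i) x_{i+1} (1 -
x_{i+1}) is carried to the bracket with parameter α by both maps (`miuraDeriv_paramSharp`,
`miuraDualDeriv_paramSharp`). Where a discriminant is non-zero, `miura` is a local diffeomorphism
with at most two preimages in the regular parameters, so on a dense set a C^1 branch is locally
`miuraDual` composed with a local inverse of `miura`. Continuity of the derivative does the rest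
(`poissonAt_of_isBranch`).

Invariance of the F_k: their generating function is the trace of a product of 2×2 transfer matrices,
and a periodic gauge transformation turns the product for c into the one for d
(`sumSparse_miura_eq_dual`).

Commutation, Casimirs and spans rest on one Lenard chain. In logarithmic coordinates the bracket
with parameter β is Q - βS, where Q is linear in c and (S v)_i = v_{i+1} - v_{i-1}. Up to a scalar,
F_k^2 / c_{[n]} has the logarithmic gradient v_k = `lenardVec k`, and Q v_k = -S v_{k+1}
(`quadPart_lenardVec`), with S v_0 = 0 and v_k = 0 for k > n/2. Skew-symmetry of Q and S makes all
pairings of v_k with S v_l vanish. The sum of (-1/α)^k v_k telescopes into the kernel of Q - αS,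
which gives E_α. The Hamiltonian vectors for any β are triangular combinations of the S v_k.

Generic statements follow from a single point at which a polynomial does not vanish. Independence is
checked at a point with sparse support, where the F_k become elementary symmetric functions. The
upper bound on the corank comes from c = 0, where Q disappears and the kernel of S is explicit; the
Casimirs give the lower bound. -/

def det2 (u v : Fin 2 → K) : K := u 0 * v 1 - u 1 * v 0

theorem wedge_eq_det2 (p q : ℙ K (Fin 2 → K)) : wedge p q = det2 p.rep q.rep := rfl

theorem det2_smul (s t : K) (u v : Fin 2 → K) : det2 (s • u) (t • v) = s * t * det2 u v := by
  simp only [det2, Pi.smul_apply, smul_eq_mul]; ring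

theorem ne_zero_of_det2_left {u v : Fin 2 → K} (h : det2 u v ≠ 0) : u ≠ 0 := by
  rintro rfl; simp [det2] at h

theorem det2_swap (u v : Fin 2 → K) : det2 u v = -det2 v u := by
  simp only [det2]; ring

theorem mk_eq_mk_iff_det2 {u v : Fin 2 → K} (hu : u ≠ 0) (hv : v ≠ 0) :
    Projectivization.mk K u hu = Projectivization.mk K v hv ↔ det2 u v = 0 := by
  rw [Projectivization.mk_eq_mk_iff']
  constructor
  · rintro ⟨a, rfl⟩
    simp only [det2, Pi.smul_apply, smul_eq_mul]; ring
  · intro h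
    unfold det2 at h
    by_cases h0 : v 0 = 0
    · have h1 : v 1 ≠ 0 := fun h1 => hv (by ext i; fin_cases i <;> simp [h0, h1])
      refine ⟨u 1 / v 1, ?_⟩
      rw [h0, mul_zero, sub_zero] at h
      have hu0 := (mul_eq_zero.1 h).resolve_right h1
      ext i; fin_cases i <;> simp [h0, h1, hu0]
    · refine ⟨u 0 / v 0, ?_⟩
      ext i; fin_cases i
      · simp [h0]
      · simp only [Fin.mk_one, Pi.smul_apply, smul_eq_mul]
        field_simp
        linear_combination h

theorem wedge_eq_zero_iff {p q : ℙ K (Fin 2 → K)} : wedge p q = 0 ↔ p = q := by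
  rw [wedge_eq_det2, ← mk_eq_mk_iff_det2 p.rep_nonzero q.rep_nonzero, p.mk_rep, q.mk_rep]

theorem wedge_ne_zero {p q : ℙ K (Fin 2 → K)} (h : p ≠ q) : wedge p q ≠ 0 :=
  fun h' => h (wedge_eq_zero_iff.1 h')

theorem wedge_swap (p q : ℙ K (Fin 2 → K)) : wedge p q = -wedge q p := det2_swap _ _

/-- The source of the additive cross-ratio identities below. -/
theorem wedge_plucker (a b c d : ℙ K (Fin 2 → K)) :
    wedge a c * wedge b d - wedge a d * wedge b c = wedge a b * wedge c d := by
  simp only [wedge]; ring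

theorem crossRatio_mk {a b c d : Fin 2 → K} (ha : a ≠ 0) (hb : b ≠ 0) (hc : c ≠ 0) (hd : d ≠ 0) :
    crossRatio (Projectivization.mk K a ha) (Projectivization.mk K b hb)
      (Projectivization.mk K c hc) (Projectivization.mk K d hd) =
      (det2 a c * det2 b d) / (det2 a d * det2 b c) := by
  obtain ⟨s, hs⟩ := Projectivization.exists_smul_eq_mk_rep K a ha
  obtain ⟨t, ht⟩ := Projectivization.exists_smul_eq_mk_rep K b hb
  obtain ⟨u, hu⟩ := Projectivization.exists_smul_eq_mk_rep K c hc
  obtain ⟨v, hv⟩ := Projectivization.exists_smul_eq_mk_rep K d hd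
  simp only [crossRatio, wedge_eq_det2, ← hs, ← ht, ← hu, ← hv, Units.smul_def, det2_smul]
  have := s.ne_zero; have := t.ne_zero; have := u.ne_zero; have := v.ne_zero
  rw [← mul_div_mul_left (det2 a c * det2 b d) (det2 a d * det2 b c)
    (show (s * t * u * v : K) ≠ 0 by positivity)]
  congr 1 <;> ring

/-- A non-zero value rules out the default 0 of a vanishing denominator. After clearing
denominators, the Plücker relation leaves `wedge a b * wedge d d' = 0`. -/
theorem eq_of_crossRatio_eq {a b c d d' : ℙ K (Fin 2 → K)} (hab : a ≠ b)
    (h0 : crossRatio a b c d ≠ 0) (h : crossRatio a b c d = crossRatio a b c d') : d = d' := by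
  have h0' : crossRatio a b c d' ≠ 0 := h ▸ h0
  unfold crossRatio at h h0 h0'
  rw [div_ne_zero_iff] at h0 h0'
  obtain ⟨h1, h2⟩ := h0
  obtain ⟨h3, h4⟩ := h0'
  rw [div_eq_div_iff h2 h4] at h
  have h5 := left_ne_zero_of_mul h1
  have h6 := right_ne_zero_of_mul h2
  refine wedge_eq_zero_iff.1 ((mul_eq_zero.1 ?_).resolve_left (wedge_ne_zero hab))
  have key : wedge b d * wedge a d' = wedge b d' * wedge a d := by
    apply mul_left_cancel₀ (mul_ne_zero h5 h6)
    linear_combination h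
  have := wedge_plucker a b d d'
  linear_combination -key - this

theorem crossRatio_flip (a b c d : ℙ K (Fin 2 → K)) :
    crossRatio a b c d = crossRatio b a d c := by
  unfold crossRatio
  congr 1 <;> ring

theorem crossRatio_symm (a b c d : ℙ K (Fin 2 → K)) :
    crossRatio a b c d = crossRatio c d a b := by
  unfold crossRatio
  rw [wedge_swap c a, wedge_swap d b, wedge_swap c b, wedge_swap d a]
  congr 1 <;> ring

theorem one_sub_crossRatio {a b c d : ℙ K (Fin 2 → K)} (had : a ≠ d) (hbc : b ≠ c) :
    1 - crossRatio a b c d = -(wedge a b * wedge c d) / (wedge a d * wedge b c) := by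
  have := wedge_ne_zero had
  have := wedge_ne_zero hbc
  have := wedge_plucker a b c d
  unfold crossRatio
  field_simp
  linear_combination -this

end Geometry

/-! ### Sharp 3-transitivity of PGL(2) on the projective line -/

section Frames

variable {K : Type*} [Field K]

theorem mk_smul_mk (g : GL (Fin 2) K) {v : Fin 2 → K} (hv : v ≠ 0) :
    (Matrix.ProjGenLinGroup.mk g : PGL(2, K)) • Projectivization.mk K v hv =
      Projectivization.mk K (g • v) ((smul_ne_zero_iff_ne g).2 hv) := rfl

theorem det2_gl_smul (g : GL (Fin 2) K) (u v : Fin 2 → K) :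
    det2 (g • u) (g • v) = (g : Matrix (Fin 2) (Fin 2) K).det * det2 u v := by
  simp only [det2, Matrix.GeneralLinearGroup.fin_two_smul, Matrix.det_fin_two,
    Matrix.cons_val_zero, Matrix.cons_val_one]
  ring

theorem vec_one_zero_ne : (![1, 0] : Fin 2 → K) ≠ 0 := fun h => by simpa using congrFun h 0

theorem vec_zero_one_ne : (![0, 1] : Fin 2 → K) ≠ 0 := fun h => by simpa using congrFun h 1

theorem vec_one_one_ne : (![1, 1] : Fin 2 → K) ≠ 0 := fun h => by simpa using congrFun h 0

/-- Three distinct points of the projective line are the image of the standard frame. -/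
theorem exists_smul_frame {a b c : ℙ K (Fin 2 → K)} (hab : a ≠ b) (hbc : b ≠ c) (hac : a ≠ c) :
    ∃ Ψ : PGL(2, K), Ψ • Projectivization.mk K (![1, 0] : Fin 2 → K) vec_one_zero_ne = a ∧
      Ψ • Projectivization.mk K (![0, 1] : Fin 2 → K) vec_zero_one_ne = b ∧
      Ψ • Projectivization.mk K (![1, 1] : Fin 2 → K) vec_one_one_ne = c := by
  have h1 := wedge_ne_zero hab
  have h2 := wedge_ne_zero hbc
  have h3 := wedge_ne_zero hac
  let M : Matrix (Fin 2) (Fin 2) K :=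
    !![wedge b c * a.rep 0, -wedge a c * b.rep 0; wedge b c * a.rep 1, -wedge a c * b.rep 1]
  have hM : M.det ≠ 0 := by
    have : M.det = -(wedge b c * wedge a c * wedge a b) := by
      simp only [M, Matrix.det_fin_two_of]
      simp only [wedge]; ring
    rw [this]
    exact neg_ne_zero.2 (mul_ne_zero (mul_ne_zero h2 h3) h1)
  refine ⟨.mk (Matrix.GeneralLinearGroup.mkOfDetNeZero M hM), ?_, ?_, ?_⟩
  · rw [mk_smul_mk]
    conv_rhs => rw [← a.mk_rep]
    rw [mk_eq_mk_iff_det2]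
    simp [det2, Matrix.GeneralLinearGroup.fin_two_smul, Matrix.GeneralLinearGroup.mkOfDetNeZero, M]
    ring
  · rw [mk_smul_mk]
    conv_rhs => rw [← b.mk_rep]
    rw [mk_eq_mk_iff_det2]
    simp [det2, Matrix.GeneralLinearGroup.fin_two_smul, Matrix.GeneralLinearGroup.mkOfDetNeZero, M]
    ring
  · rw [mk_smul_mk]
    conv_rhs => rw [← c.mk_rep]
    rw [mk_eq_mk_iff_det2]
    simp [det2, Matrix.GeneralLinearGroup.fin_two_smul, Matrix.GeneralLinearGroup.mkOfDetNeZero, M,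
      wedge]
    ring

/-- A projective transformation that fixes the standard frame is the identity. -/
theorem eq_one_of_fix_frame {Ψ : PGL(2, K)}
    (h1 : Ψ • Projectivization.mk K (![1, 0] : Fin 2 → K) vec_one_zero_ne =
      Projectivization.mk K (![1, 0] : Fin 2 → K) vec_one_zero_ne)
    (h2 : Ψ • Projectivization.mk K (![0, 1] : Fin 2 → K) vec_zero_one_ne =
      Projectivization.mk K (![0, 1] : Fin 2 → K) vec_zero_one_ne)
    (h3 : Ψ • Projectivization.mk K (![1, 1] : Fin 2 → K) vec_one_one_ne =
      Projectivization.mk K (![1, 1] : Fin 2 → K) vec_one_one_ne) :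
    Ψ = 1 := by
  obtain ⟨g, rfl⟩ := Matrix.ProjGenLinGroup.mk_surjective Ψ
  rw [mk_smul_mk, mk_eq_mk_iff_det2] at h1 h2 h3
  simp only [det2, Matrix.GeneralLinearGroup.fin_two_smul, Matrix.cons_val_zero,
    Matrix.cons_val_one, mul_one, mul_zero, add_zero, zero_add, sub_zero, zero_sub, neg_eq_zero]
    at h1 h2 h3
  have hd : (g 0 0 : K) ≠ 0 := by
    intro h
    have := g.det_ne_zero
    rw [Matrix.det_fin_two] at this
    simp [h, h2] at this
  have : g = Matrix.GeneralLinearGroup.scalar (Fin 2) (Units.mk0 _ hd) := by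
    ext i j
    fin_cases i <;> fin_cases j
    · simp
    · simpa using h2
    · simpa using h1
    · simp
      linear_combination -h3 + h2 - h1
  rw [this, Matrix.ProjGenLinGroup.mk_scalar]

/-- A projective transformation is determined by its values at three distinct points. -/
theorem eq_of_smul_eq {Ψ Θ : PGL(2, K)} {a b c : ℙ K (Fin 2 → K)}
    (hab : a ≠ b) (hbc : b ≠ c) (hac : a ≠ c)
    (h1 : Ψ • a = Θ • a) (h2 : Ψ • b = Θ • b) (h3 : Ψ • c = Θ • c) : Ψ = Θ := by
  obtain ⟨g, rfl, rfl, rfl⟩ := exists_smul_frame hab hbc hac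
  have : (Θ * g)⁻¹ * (Ψ * g) = 1 := by
    apply eq_one_of_fix_frame <;> simp only [mul_smul, inv_smul_eq_iff, *]
  have := inv_mul_eq_one.1 this
  exact (mul_right_cancel this).symm

end Frames

/-! ### Injectivity of the cross-ratio coordinates -/

section Coordinates

variable {K : Type*} [Field K] {n : ℕ}

/-- `coord` for all integer indices. -/
theorem TwistedPolygon.coord_intCast [NeZero n] (P : TwistedPolygon K n) (i : ℤ) :
    P.coord (i : ZMod n) = crossRatio (P.vertex i) (P.vertex (i + 1)) (P.vertex (i - 1))
      (P.vertex (i + 2)) := by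
  have key : ∀ (j : ℤ) (k : ℕ), crossRatio (P.vertex (j + k * n)) (P.vertex (j + k * n + 1))
      (P.vertex (j + k * n - 1)) (P.vertex (j + k * n + 2)) =
      crossRatio (P.vertex j) (P.vertex (j + 1)) (P.vertex (j - 1)) (P.vertex (j + 2)) := by
    intro j k
    induction k with
    | zero => simp
    | succ k ih =>
      rw [← ih]
      conv_rhs => rw [← crossRatio_smul P.monodromy]
      simp only [← P.vertex_add]
      push_cast
      congr 2 <;> ring
  unfold TwistedPolygon.coord
  have hv : (((i : ZMod n).val : ℕ) : ℤ) = i % n := ZMod.val_intCast i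
  rw [hv]
  rcases le_total 0 (i / n) with h | h
  · obtain ⟨k, hk⟩ := Int.eq_ofNat_of_zero_le h
    rw [← key (i % n) k, ← hk, mul_comm, Int.emod_add_mul_ediv]
  · obtain ⟨k, hk⟩ := Int.eq_ofNat_of_zero_le (neg_nonneg.2 h)
    rw [← key i k, ← hk]
    have : i % n = i + -(i / n) * n := by
      have := Int.emod_add_mul_ediv i n
      linarith
    rw [this]

theorem TwistedPolygon.coord_ne_zero (P : TwistedPolygon K n) (i : ZMod n) : P.coord i ≠ 0 := by
  unfold TwistedPolygon.coord crossRatio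
  have h1 := P.vertex_ne_one (i.val - 1)
  have h2 := P.vertex_ne_two (i.val - 1)
  rw [show (i.val : ℤ) - 1 + 1 = i.val by ring] at h1
  rw [show (i.val : ℤ) - 1 + 2 = i.val + 1 by ring] at h2
  have h3 := P.vertex_ne_one (i.val + 1)
  rw [show (i.val : ℤ) + 1 + 1 = i.val + 2 by ring] at h3
  exact div_ne_zero (mul_ne_zero (wedge_ne_zero h1.symm) (wedge_ne_zero h3))
    (mul_ne_zero (wedge_ne_zero (P.vertex_ne_two _)) (wedge_ne_zero h2.symm))

/-- The number c_i determines p_{i+2} from the three vertices before it and p_{i-1} from the three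
after it, so the vertices agree by induction in both directions. Three consecutive vertices are
distinct and therefore fix the monodromy. -/
theorem TwistedPolygon.ext_of_coord [NeZero n] {P Q : TwistedPolygon K n} (h : P.coord = Q.coord)
    (h0 : P.vertex 0 = Q.vertex 0) (h1 : P.vertex 1 = Q.vertex 1) (h2 : P.vertex 2 = Q.vertex 2) :
    P = Q := by
  have hc : ∀ i : ℤ, crossRatio (P.vertex i) (P.vertex (i + 1)) (P.vertex (i - 1))
      (P.vertex (i + 2)) = crossRatio (Q.vertex i) (Q.vertex (i + 1)) (Q.vertex (i - 1))
      (Q.vertex (i + 2)) := by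
    intro i
    rw [← P.coord_intCast, ← Q.coord_intCast, h]
  have hne : ∀ i : ℤ, crossRatio (P.vertex i) (P.vertex (i + 1)) (P.vertex (i - 1))
      (P.vertex (i + 2)) ≠ 0 := fun i => by
    rw [← P.coord_intCast]; exact P.coord_ne_zero _
  have hv : ∀ i : ℤ, P.vertex i = Q.vertex i ∧ P.vertex (i + 1) = Q.vertex (i + 1) ∧
      P.vertex (i + 2) = Q.vertex (i + 2) := by
    intro i
    induction i with
    | zero => exact ⟨h0, h1, h2⟩
    | succ i ih =>
      obtain ⟨e0, e1, e2⟩ := ih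
      have a := hc (i + 1)
      have b := hne (i + 1)
      rw [show (i : ℤ) + 1 - 1 = i by ring, show (i : ℤ) + 1 + 1 = i + 2 by ring] at a b
      rw [show (i : ℤ) + 1 + 1 = i + 2 by ring]
      refine ⟨e1, e2, ?_⟩
      rw [← e0, ← e1, ← e2] at a
      refine eq_of_crossRatio_eq ?_ b a
      have := P.vertex_ne_one (i + 1)
      rwa [show (i : ℤ) + 1 + 1 = i + 2 by ring] at this
    | pred i ih =>
      obtain ⟨e0, e1, e2⟩ := ih
      have a := hc (-i)
      have b := hne (-i)
      rw [show (-i : ℤ) - 1 + 1 = -i by ring, show (-i : ℤ) - 1 + 2 = -i + 1 by ring]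
      refine ⟨?_, e0, e1⟩
      rw [← e0, ← e1, ← e2] at a
      -- The flip puts p_{i-1} into the last slot, the one treated by `eq_of_crossRatio_eq`.
      rw [crossRatio_flip] at a b
      rw [crossRatio_flip (P.vertex (-i)) _ (Q.vertex (-i - 1))] at a
      exact eq_of_crossRatio_eq (P.vertex_ne_one (-i)).symm b a
  refine TwistedPolygon.ext (funext fun i => (hv i).1) ?_
  refine eq_of_smul_eq (P.vertex_ne_one 0) (P.vertex_ne_one 1) (P.vertex_ne_two 0) ?_ ?_ ?_ <;>
  · rw [← P.vertex_add, (hv _).1, Q.vertex_add, (hv _).1]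

theorem Moduli.coord_mk (P : TwistedPolygon K n) :
    Moduli.coord (Quotient.mk _ P : Moduli K n) = P.coord := rfl

theorem TwistedPolygon.smul_vertex (Ψ : PGL(2, K)) (P : TwistedPolygon K n) (i : ℤ) :
    (Ψ • P).vertex i = Ψ • P.vertex i := rfl

theorem TwistedPolygon.coord_smul (Ψ : PGL(2, K)) (P : TwistedPolygon K n) :
    (Ψ • P).coord = P.coord := funext fun _ => crossRatio_smul Ψ _ _ _ _

/-- Both polygons are compared through the projective maps that carry the standard frame to their
vertices 0, 1, 2. -/
theorem Moduli.coord_injective [NeZero n] :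
    Function.Injective (Moduli.coord : Moduli K n → ZMod n → K) := by
  intro P Q
  induction P using Quotient.inductionOn with | h P => ?_
  induction Q using Quotient.inductionOn with | h Q => ?_
  intro h
  rw [Moduli.coord_mk, Moduli.coord_mk] at h
  obtain ⟨g, g0, g1, g2⟩ := exists_smul_frame (P.vertex_ne_one 0) (P.vertex_ne_one 1)
    (P.vertex_ne_two 0)
  obtain ⟨k, k0, k1, k2⟩ := exists_smul_frame (Q.vertex_ne_one 0) (Q.vertex_ne_one 1)
    (Q.vertex_ne_two 0)
  refine Quotient.sound ⟨g * k⁻¹, ?_⟩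
  change (g * k⁻¹) • Q = P
  refine TwistedPolygon.ext_of_coord (by rw [TwistedPolygon.coord_smul, h]) ?_ ?_ ?_ <;>
  · simp only [TwistedPolygon.smul_vertex, mul_smul]
    norm_num at g0 g1 g2 k0 k1 k2
    simp [← g0, ← g1, ← g2, ← k0, ← k1, ← k2]

end Coordinates

/-! ### Lifts to the plane and the range of the coordinates -/

section Lifts

variable {K : Type*} [Field K] {n : ℕ}

/-- The twisted polygon with a given lift to the plane. -/
def TwistedPolygon.ofLift (V : ℤ → Fin 2 → K) (g : GL (Fin 2) K)
    (hV : ∀ i, V (i + n) = g • V i) (h1 : ∀ i, det2 (V i) (V (i + 1)) ≠ 0)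
    (h2 : ∀ i, det2 (V i) (V (i + 2)) ≠ 0) : TwistedPolygon K n where
  vertex i := Projectivization.mk K (V i) (ne_zero_of_det2_left (h1 i))
  monodromy := .mk g
  vertex_add i := by simp only [mk_smul_mk, hV]
  vertex_ne_one i h := h1 i ((mk_eq_mk_iff_det2 _ _).1 h)
  vertex_ne_two i h := h2 i ((mk_eq_mk_iff_det2 _ _).1 h)

/-- The solution of `V (k + 2) = V (k + 1) - c k • V k` with standard initial values. -/
def fundSeq (c : ℕ → K) : ℕ → Fin 2 → K
  | 0 => ![1, 0]
  | 1 => ![0, 1]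
  | k + 2 => fundSeq c (k + 1) - c k • fundSeq c k

theorem det2_sub_smul_right (u v : Fin 2 → K) (s : K) :
    det2 u (u - s • v) = s * det2 v u := by
  simp only [det2, Pi.sub_apply, Pi.smul_apply, smul_eq_mul]; ring

theorem det2_sub_smul_right' (u v : Fin 2 → K) (s : K) :
    det2 v (u - s • v) = det2 v u := by
  simp only [det2, Pi.sub_apply, Pi.smul_apply, smul_eq_mul]; ring

theorem det2_fundSeq {c : ℕ → K} (hc : ∀ k, c k ≠ 0) (k : ℕ) :
    det2 (fundSeq c k) (fundSeq c (k + 1)) ≠ 0 := by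
  induction k with
  | zero => simp [fundSeq, det2]
  | succ k ih =>
    rw [fundSeq, det2_sub_smul_right]
    exact mul_ne_zero (hc k) ih

theorem gl_smul_sub (g : GL (Fin 2) K) (u v : Fin 2 → K) (s : K) :
    g • (u - s • v) = g • u - s • g • v := by
  rw [smul_sub, smul_comm]

/-- The matrix with columns V_n, V_{n+1} takes the two initial vectors to their shifts; as c is
periodic, both sequences obey the same recursion. -/
theorem exists_fundSeq_add {c : ℕ → K} (hc : ∀ k, c k ≠ 0) (hn : ∀ k, c (k + n) = c k) :
    ∃ g : GL (Fin 2) K, ∀ k, fundSeq c (k + n) = g • fundSeq c k := by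
  let M : Matrix (Fin 2) (Fin 2) K :=
    !![fundSeq c n 0, fundSeq c (n + 1) 0; fundSeq c n 1, fundSeq c (n + 1) 1]
  have hM : M.det ≠ 0 := by
    have := det2_fundSeq hc n
    unfold det2 at this
    simp only [M, Matrix.det_fin_two_of]
    intro h; apply this; linear_combination h
  refine ⟨Matrix.GeneralLinearGroup.mkOfDetNeZero M hM, fun k => ?_⟩
  have key : fundSeq c (k + n) = Matrix.GeneralLinearGroup.mkOfDetNeZero M hM • fundSeq c k ∧
      fundSeq c (k + 1 + n) =
        Matrix.GeneralLinearGroup.mkOfDetNeZero M hM • fundSeq c (k + 1) := by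
    induction k with
    | zero =>
      constructor
      · ext i; fin_cases i <;>
        simp [fundSeq, Matrix.GeneralLinearGroup.fin_two_smul,
          Matrix.GeneralLinearGroup.mkOfDetNeZero, M]
      · rw [zero_add, add_comm 1 n]
        ext i; fin_cases i <;>
        simp [fundSeq, Matrix.GeneralLinearGroup.fin_two_smul,
          Matrix.GeneralLinearGroup.mkOfDetNeZero, M]
    | succ k ih =>
      refine ⟨ih.2, ?_⟩
      rw [show k + 1 + 1 + n = k + n + 2 by ring, fundSeq, show k + n + 1 = k + 1 + n by ring,
        ih.1, ih.2, hn, ← gl_smul_sub, fundSeq]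
  exact key.1

theorem exists_lift [NeZero n] {c : ZMod n → K} (hc : ∀ i, c i ≠ 0) :
    ∃ (V : ℤ → Fin 2 → K) (g : GL (Fin 2) K), (∀ i, V (i + n) = g • V i) ∧
      (∀ i : ℤ, V (i + 2) = V (i + 1) - c i • V i) ∧ ∀ i, det2 (V i) (V (i + 1)) ≠ 0 := by
  let b : ℕ → K := fun k => c k
  have hb : ∀ k, b k ≠ 0 := fun k => hc _
  obtain ⟨g, hg⟩ := exists_fundSeq_add (n := n) hb (fun k => by simp [b])
  have hg' : ∀ a k : ℕ, fundSeq b (a + k * n) = g ^ k • fundSeq b a := by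
    intro a k
    induction k with
    | zero => simp
    | succ k ih =>
      rw [show a + (k + 1) * n = a + k * n + n by ring, hg, ih, pow_succ', mul_smul]
  have hn : 1 ≤ n := NeZero.one_le
  -- Negative indices are reached by going |i| periods forward and undoing them with g. By `hV`, any
  -- number of periods that leads to a natural index gives the same vector.
  let V : ℤ → Fin 2 → K := fun i => (g ^ i.natAbs)⁻¹ • fundSeq b (i + i.natAbs * n).toNat
  have hV : ∀ (i : ℤ) (t a : ℕ), (a : ℤ) = i + t * n → V i = (g ^ t)⁻¹ • fundSeq b a := by
    have step : ∀ (i : ℤ) (t a k a' : ℕ), (a : ℤ) = i + t * n → (a' : ℤ) = i + (t + k : ℕ) * n →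
        (g ^ (t + k))⁻¹ • fundSeq b a' = (g ^ t)⁻¹ • fundSeq b a := by
      intro i t a k a' h h'
      have : a' = a + k * n := by
        zify; rw [h, h']; push_cast; ring
      rw [this, hg', inv_smul_eq_iff, pow_add, (Commute.pow_pow_self g t k).eq, mul_smul,
        smul_inv_smul]
    intro i t a h
    have h0 : (((i + i.natAbs * n).toNat : ℕ) : ℤ) = i + i.natAbs * n := by
      apply Int.toNat_of_nonneg
      have : (i.natAbs : ℤ) ≤ i.natAbs * n := le_mul_of_one_le_right (by positivity)
        (by exact_mod_cast hn)
      omega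
    rcases le_total t i.natAbs with h1 | h1 <;> obtain ⟨k, hk⟩ := Nat.exists_eq_add_of_le h1
    · change (g ^ i.natAbs)⁻¹ • fundSeq b (i + i.natAbs * n).toNat = _
      have := step i t a k _ h (by rw [← hk]; exact h0)
      rwa [← hk] at this
    · have := step i i.natAbs _ k a h0 (by rw [← hk]; exact h)
      rw [← hk] at this
      exact this.symm
  have hex : ∀ i : ℤ, ∃ t a : ℕ, (a : ℤ) = i + t * n := by
    intro i
    refine ⟨i.natAbs, (i + i.natAbs * n).toNat, Int.toNat_of_nonneg ?_⟩
    have : (i.natAbs : ℤ) ≤ i.natAbs * n := le_mul_of_one_le_right (by positivity)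
      (by exact_mod_cast hn)
    omega
  refine ⟨V, g, fun i => ?_, fun i => ?_, fun i => ?_⟩ <;> obtain ⟨t, a, h⟩ := hex i
  · rw [hV i t a h, hV (i + n) t (a + n) (by push_cast; rw [h]; ring), hg, smul_smul, smul_smul,
      ((Commute.refl g).pow_right t).inv_right.eq]
  · rw [hV i t a h, hV (i + 1) t (a + 1) (by push_cast; rw [h]; ring),
      hV (i + 2) t (a + 2) (by push_cast; rw [h]; ring), fundSeq, gl_smul_sub]
    have : b a = c i := by
      change c ((a : ℕ) : ZMod n) = c i
      congr 1
      have := congrArg (Int.cast : ℤ → ZMod n) h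
      push_cast at this
      simpa using this
    rw [this]
  · rw [hV i t a h, hV (i + 1) t (a + 1) (by push_cast; rw [h]; ring), det2_gl_smul]
    exact mul_ne_zero (Matrix.GeneralLinearGroup.det_ne_zero _) (det2_fundSeq hb a)

/-- The recursion gives det(V_i, V_{i+2}) = det(V_i, V_{i+1}) and det(V_{i+1}, V_{i+2}) = c_i
det(V_i, V_{i+1}), so everything in the cross-ratio cancels except c_i. -/
theorem TwistedPolygon.coord_ofLift [NeZero n] {V : ℤ → Fin 2 → K} {g : GL (Fin 2) K}
    (hV : ∀ i, V (i + n) = g • V i) (h1 : ∀ i, det2 (V i) (V (i + 1)) ≠ 0)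
    (h2 : ∀ i, det2 (V i) (V (i + 2)) ≠ 0) {c : ZMod n → K}
    (hc : ∀ i : ℤ, V (i + 2) = V (i + 1) - c i • V i) :
    (TwistedPolygon.ofLift V g hV h1 h2).coord = c := by
  funext i
  obtain ⟨i, rfl⟩ := ZMod.intCast_surjective i
  rw [TwistedPolygon.coord_intCast]
  simp only [TwistedPolygon.ofLift]
  rw [crossRatio_mk]
  have e := hc (i - 1)
  have e1 := h1 (i - 1)
  have e2 := h2 (i - 1)
  rw [show i - 1 + 2 = i + 1 by ring, show i - 1 + 1 = i by ring] at *
  rw [hc i, det2_sub_smul_right, det2_sub_smul_right', det2_swap (V (i + 1)) (V (i - 1)),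
    det2_swap (V i) (V (i - 1)), e, det2_sub_smul_right']
  have := h1 i
  rw [e] at this
  field_simp

theorem Moduli.range_coord [NeZero n] :
    Set.range (Moduli.coord : Moduli K n → ZMod n → K) = {c | ∀ i, c i ≠ 0} := by
  ext c
  constructor
  · rintro ⟨P, rfl⟩
    induction P using Quotient.inductionOn with | h P => ?_
    exact P.coord_ne_zero
  · intro hc
    obtain ⟨V, g, hg, hr, h1⟩ := exists_lift hc
    have h2 : ∀ i, det2 (V i) (V (i + 2)) ≠ 0 := fun i => by
      rw [hr, det2_sub_smul_right']; exact h1 i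
    exact ⟨Quotient.mk _ (TwistedPolygon.ofLift V g hg h1 h2),
      TwistedPolygon.coord_ofLift hg h1 h2 hr⟩

end Lifts

/-! ### The parametrization of related pairs -/

section Miura

variable {K : Type*} [Field K] {n : ℕ}

/-- The Miura-type parametrization of the cross-ratios of a polygon `P` by the cross-ratios
of a pair `P ∼ Q`. -/
def miura (α : K) (x : ZMod n → K) (i : ZMod n) : K := α * x i * (1 - x (i + 1))

/-- The cross-ratios of the polygon `Q` in a pair `P ∼ Q`. -/
def miuraDual (α : K) (x : ZMod n → K) (i : ZMod n) : K := α * x (i + 1) * (1 - x i)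

theorem ne_of_crossRatio_ne_zero {a b c d : ℙ K (Fin 2 → K)} (h : crossRatio a b c d ≠ 0) :
    a ≠ c ∧ b ≠ d ∧ a ≠ d ∧ b ≠ c := by
  unfold crossRatio at h
  simp only [ne_eq, div_eq_zero_iff, mul_eq_zero, wedge_eq_zero_iff, not_or] at h
  tauto

/-- The parameter of a pair `P ∼ Q` at the index `i`. -/
def pairParam (P Q : ℤ → ℙ K (Fin 2 → K)) (i : ℤ) : K :=
  crossRatio (P (i + 1)) (P i) (Q i) (P (i - 1))

/-- Here a, p, b, b' are consecutive vertices of P, and q, q' are the partners of p, b. By the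
Plücker relation 1 minus a cross-ratio is a quotient of wedges, so both sides are monomials in
wedges. -/
theorem miura_identity {α : K} (hα : α ≠ 0) {a p b b' q q' : ℙ K (Fin 2 → K)}
    (hpb' : p ≠ b') (hb : a ≠ b)
    (h : crossRatio p b q q' = α) :
    crossRatio p b a b' = α * crossRatio b p q a * (1 - crossRatio b' b q' p) := by
  obtain ⟨h1, h2, h3, h4⟩ := ne_of_crossRatio_ne_zero (h ▸ hα)
  rw [one_sub_crossRatio hpb'.symm h2, ← h]
  unfold crossRatio
  have e1 := wedge_ne_zero h1
  have e2 := wedge_ne_zero h2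
  have e3 := wedge_ne_zero h3
  have e4 := wedge_ne_zero h4
  have e5 := wedge_ne_zero hb.symm
  have e6 := wedge_ne_zero hpb'
  rw [wedge_swap q' p, wedge_swap b' p, wedge_swap b' b]
  field_simp

/-- Exchanging the two polygons of a related pair replaces x_i by 1 - x_i. Here a, p, b are
consecutive on P and a', q, b' are their partners on Q. -/
theorem one_sub_crossRatio_eq {α : K} (hα : α ≠ 0)
    {a p b a' q b' : ℙ K (Fin 2 → K)} (hab : a ≠ b) (hab' : a' ≠ b')
    (h : crossRatio p b q b' = α) (h' : crossRatio a p a' q = α) :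
    crossRatio b' q p a' = 1 - crossRatio b p q a := by
  obtain ⟨h1, h2, h3, h4⟩ := ne_of_crossRatio_ne_zero (h ▸ hα)
  obtain ⟨k1, k2, k3, k4⟩ := ne_of_crossRatio_ne_zero (h' ▸ hα)
  rw [one_sub_crossRatio hab.symm h1]
  unfold crossRatio at h h' ⊢
  rw [div_eq_iff (mul_ne_zero (wedge_ne_zero h3) (wedge_ne_zero h4))] at h
  rw [div_eq_iff (mul_ne_zero (wedge_ne_zero k3) (wedge_ne_zero k4))] at h'
  rw [div_eq_div_iff (mul_ne_zero (wedge_ne_zero hab'.symm) (wedge_ne_zero h1.symm))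
    (mul_ne_zero (wedge_ne_zero hab.symm) (wedge_ne_zero h1))]
  have e1 := wedge_plucker b b' p q
  have e2 := wedge_plucker a a' p q
  have e3 := wedge_plucker b a p q
  have e4 := wedge_plucker b' a' p q
  rw [wedge_swap p b'] at h
  rw [wedge_swap p a'] at h'
  rw [wedge_swap q a', wedge_swap q a, wedge_swap q p]
  linear_combination (wedge b' p * wedge a' q) * e3 - (wedge b p * wedge a q) * e4 -
    (wedge a q * wedge a' p) * (e1 + h) + (wedge b q * wedge b' p) * (e2 + h')

/-- A pair of related polygons comes from a periodic sequence of parameters. -/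
theorem TwistedPolygon.Related.exists_param [NeZero n] {α : K} (hα : α ≠ 0)
    {P Q : TwistedPolygon K n} (h : P.Related α Q) :
    ∃ x : ZMod n → K, (∀ i, x i ≠ 0) ∧ (∀ i, x i ≠ 1) ∧
      (∀ i : ℤ, x i = pairParam P.vertex Q.vertex i) ∧
      P.coord = miura α x ∧ Q.coord = miuraDual α x := by
  obtain ⟨hm, hr⟩ := h
  have hP2 : ∀ i, P.vertex (i - 1) ≠ P.vertex (i + 1) := fun i => by
    have := P.vertex_ne_two (i - 1)
    rwa [show i - 1 + 2 = i + 1 by ring] at this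
  have hQ2 : ∀ i, Q.vertex (i - 1) ≠ Q.vertex (i + 1) := fun i => by
    have := Q.vertex_ne_two (i - 1)
    rwa [show i - 1 + 2 = i + 1 by ring] at this
  have hr' : ∀ i, crossRatio (P.vertex (i - 1)) (P.vertex i) (Q.vertex (i - 1)) (Q.vertex i) = α :=
    fun i => by simpa using hr (i - 1)
  have hper : Function.Periodic (pairParam P.vertex Q.vertex) (n : ℤ) := by
    intro i
    unfold pairParam
    rw [show i + n + 1 = i + 1 + n by ring, show i + n - 1 = i - 1 + n by ring]
    simp only [P.vertex_add, Q.vertex_add, ← hm, crossRatio_smul]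
  let x : ZMod n → K := fun i => pairParam P.vertex Q.vertex (i.val : ℤ)
  have hx : ∀ i : ℤ, x i = pairParam P.vertex Q.vertex i := by
    intro i
    change pairParam P.vertex Q.vertex (((i : ZMod n).val : ℕ) : ℤ) = _
    rw [ZMod.val_intCast, Int.emod_def, mul_comm, ← smul_eq_mul, hper.sub_zsmul_eq]
  have hPc : P.coord = miura α x := by
    funext i
    obtain ⟨i, rfl⟩ := ZMod.intCast_surjective i
    have := hx (i + 1)
    push_cast at this
    rw [P.coord_intCast, miura, hx, this]
    have h := miura_identity hα (P.vertex_ne_two i) (hP2 i) (hr i)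
    unfold pairParam
    rw [show i + 1 + 1 = i + 2 by ring, show i + 1 - 1 = i by ring]
    exact h
  have hQc : Q.coord = miuraDual α x := by
    funext i
    obtain ⟨i, rfl⟩ := ZMod.intCast_surjective i
    have := hx (i + 1)
    push_cast at this
    rw [Q.coord_intCast, miuraDual, hx, this]
    have h := miura_identity hα (Q.vertex_ne_two i) (hQ2 i)
      ((crossRatio_symm _ _ _ _).trans (hr i))
    rw [h, one_sub_crossRatio_eq hα (hP2 i) (hQ2 i) (hr i) (hr' i)]
    have h3 := one_sub_crossRatio_eq hα (hP2 (i + 1)) (hQ2 (i + 1)) (hr (i + 1)) (hr' (i + 1))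
    unfold pairParam
    rw [show i + 1 + 1 = i + 2 by ring, show i + 1 - 1 = i by ring] at *
    rw [h3]
    ring
  refine ⟨x, fun i h0 => ?_, fun i h1 => ?_, hx, hPc, hQc⟩
  · exact P.coord_ne_zero i (by rw [hPc, miura, h0]; ring)
  · exact Q.coord_ne_zero i (by rw [hQc, miuraDual, h1]; ring)

/-- The value 1 would make an edge of P or of Q degenerate, by `one_sub_crossRatio`. -/
theorem TwistedPolygon.Related.ne_one {α : K}
    {P Q : TwistedPolygon K n} (h : P.Related α Q) : α ≠ 1 := by
  rintro rfl
  have h0 := h.2 0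
  obtain ⟨h1, h2, h3, h4⟩ := ne_of_crossRatio_ne_zero (h0.symm ▸ one_ne_zero)
  have := one_sub_crossRatio h3 h4
  rw [h0, sub_self, eq_comm, div_eq_zero_iff, neg_eq_zero, mul_eq_zero, mul_eq_zero,
    wedge_eq_zero_iff, wedge_eq_zero_iff, wedge_eq_zero_iff, wedge_eq_zero_iff] at this
  have a := P.vertex_ne_one 0
  have b := Q.vertex_ne_one 0
  tauto

theorem coordRelated_miura [NeZero n] {α : K} (hα : α ≠ 0) (hα1 : α ≠ 1) {x : ZMod n → K}
    (h0 : ∀ i, x i ≠ 0) (h1 : ∀ i, x i ≠ 1) :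
    CoordRelated α (miura α x) (miuraDual α x) := by
  have h1' : ∀ i, 1 - x i ≠ 0 := fun i => sub_ne_zero.2 (h1 i).symm
  have hc : ∀ i, miura α x i ≠ 0 := fun i => mul_ne_zero (mul_ne_zero hα (h0 _)) (h1' _)
  obtain ⟨V, g, hg, hr, hV⟩ := exists_lift hc
  have hV2 : ∀ i, det2 (V i) (V (i + 2)) ≠ 0 := fun i => by
    rw [hr, det2_sub_smul_right']; exact hV i
  -- A lift of q_i, chosen so that [p_{i+1}, p_i, q_i, p_{i-1}] = x_i. The second expression for W
  -- in `hW1` shows where α enters and why α ≠ 1 makes Q non-degenerate.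
  let W : ℤ → Fin 2 → K := fun i => V (i + 1) - x i • V i
  have hW1 : ∀ i : ℤ, W (i + 1) = (1 - x (i + 1)) • (V (i + 1) - (α * x i) • V i) := by
    intro i
    simp only [W]
    rw [show i + 1 + 1 = i + 2 by ring, hr]
    ext j
    simp only [miura, Pi.sub_apply, Pi.smul_apply, smul_eq_mul]
    push_cast
    ring
  have hgW : ∀ i, W (i + n) = g • W i := by
    intro i
    simp only [W]
    rw [show i + n + 1 = i + 1 + n by ring, hg, hg, gl_smul_sub]
    simp
  have hWW : ∀ i : ℤ, det2 (W i) (W (i + 1)) =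
      (1 - x (i + 1)) * (α - 1) * x i * det2 (V i) (V (i + 1)) := by
    intro i
    rw [hW1]
    simp only [W, det2, Pi.sub_apply, Pi.smul_apply, smul_eq_mul]
    ring
  have hα1' : α - 1 ≠ 0 := sub_ne_zero.2 hα1
  have hWne : ∀ i, det2 (W i) (W (i + 1)) ≠ 0 := fun i => by
    rw [hWW]
    exact mul_ne_zero (mul_ne_zero (mul_ne_zero (h1' _) hα1') (h0 _)) (hV i)
  have hWne2 : ∀ i, det2 (W i) (W (i + 2)) ≠ 0 := fun i => by
    have a : W (i + 2) = (1 - x (i + 2)) • ((1 - α * x (i + 1)) • V (i + 1) -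
        (α * x i * (1 - x (i + 1))) • V i) := by
      have := hW1 (i + 1)
      rw [show i + 1 + 1 = i + 2 by ring, hr] at this
      rw [this]
      ext j
      simp only [miura, Pi.sub_apply, Pi.smul_apply, smul_eq_mul]
      push_cast
      rw [show (i + 1 + 1 : ZMod n) = i + 2 by ring]
      ring
    have b : det2 (W i) (W (i + 2)) =
        (1 - x (i + 2)) * ((α - 1) * x i) * det2 (V i) (V (i + 1)) := by
      rw [a]
      simp only [W, det2, Pi.sub_apply, Pi.smul_apply, smul_eq_mul]
      ring
    rw [b]
    exact mul_ne_zero (mul_ne_zero (h1' _) (mul_ne_zero hα1' (h0 _))) (hV i)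
  let P : TwistedPolygon K n := TwistedPolygon.ofLift V g hg hV hV2
  let Q : TwistedPolygon K n := TwistedPolygon.ofLift W g hgW hWne hWne2
  have hVW : ∀ i : ℤ, det2 (V i) (W i) = det2 (V i) (V (i + 1)) := fun i =>
    det2_sub_smul_right' _ _ _
  have hrel : P.Related α Q := by
    refine ⟨rfl, fun i => ?_⟩
    simp only [P, Q, TwistedPolygon.ofLift]
    rw [crossRatio_mk, hVW, hVW, hW1, show i + 1 + 1 = i + 2 by ring, hr, det2_sub_smul_right]
    have e1 : det2 (V i) ((1 - x (i + 1)) • (V (i + 1) - (α * x i) • V i)) =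
        (1 - x (i + 1)) * det2 (V i) (V (i + 1)) := by
      simp only [det2, Pi.sub_apply, Pi.smul_apply, smul_eq_mul]
      ring
    have e2 : det2 (V (i + 1)) (W i) = x i * det2 (V i) (V (i + 1)) := by
      simp only [W, det2, Pi.sub_apply, Pi.smul_apply, smul_eq_mul]
      ring
    rw [e1, e2, miura]
    have := hV i
    have := h0 i
    have := h1' (i + 1)
    field_simp
  have hPc : P.coord = miura α x := TwistedPolygon.coord_ofLift hg hV hV2 hr
  -- The coordinates of Q need no computation: the pair has some parameter y that yields them, and y
  -- is then identified with x.
  obtain ⟨y, -, -, hy, -, hQ⟩ := hrel.exists_param hα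
  have hyx : y = x := by
    funext i
    obtain ⟨i, rfl⟩ := ZMod.intCast_surjective i
    rw [hy, pairParam]
    simp only [P, Q, TwistedPolygon.ofLift]
    rw [crossRatio_mk]
    have e := hr (i - 1)
    rw [show i - 1 + 2 = i + 1 by ring, show i - 1 + 1 = i by ring] at e
    have e2 : det2 (V (i + 1)) (W i) = x i * det2 (V i) (V (i + 1)) := by
      simp only [W, det2, Pi.sub_apply, Pi.smul_apply, smul_eq_mul]
      ring
    have e3 : det2 (V (i + 1)) (V (i - 1)) = det2 (V i) (V (i - 1)) := by
      rw [e]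
      simp only [det2, Pi.sub_apply, Pi.smul_apply, smul_eq_mul]
      ring
    have e4 := hV (i - 1)
    rw [show i - 1 + 1 = i by ring, det2_swap, neg_ne_zero] at e4
    rw [e2, e3, hVW]
    have := hV i
    field_simp
  rw [hyx] at hQ
  exact ⟨Quotient.mk _ P, Quotient.mk _ Q, ⟨P, Q, rfl, rfl, hrel⟩, hPc, hQ⟩

theorem CoordRelated.exists_param [NeZero n] {α : K} (hα : α ≠ 0) {c d : ZMod n → K}
    (h : CoordRelated α c d) : α ≠ 1 ∧
    ∃ x : ZMod n → K, (∀ i, x i ≠ 0) ∧ (∀ i, x i ≠ 1) ∧ miura α x = c ∧ miuraDual α x = d := by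
  obtain ⟨_, _, ⟨P, Q, rfl, rfl, h⟩, rfl, rfl⟩ := h
  obtain ⟨x, h0, h1, -, hP, hQ⟩ := h.exists_param hα
  exact ⟨h.ne_one, x, h0, h1, hP.symm, hQ.symm⟩

end Miura

/-! ### Sums over sparse sets and the Lenard recursion -/

section Sparse

theorem one_ne_zero_of_two_le {n : ℕ} (hn : 2 ≤ n) : (1 : ZMod n) ≠ 0 := by
  have : Fact (1 < n) := ⟨hn⟩
  exact one_ne_zero

theorem two_ne_zero_of_three_le {n : ℕ} (hn : 3 ≤ n) : (2 : ZMod n) ≠ 0 := by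
  intro h
  have : ((2 : ℕ) : ZMod n) = 0 := by exact_mod_cast h
  rw [ZMod.natCast_eq_zero_iff] at this
  exact absurd (Nat.le_of_dvd two_pos this) (by omega)

variable {R : Type*} [CommRing R] {n : ℕ} [NeZero n]

open Classical in
variable (n) in
/-- The cyclically sparse sets with `k` elements. -/
def sparseSets (k : ℕ) : Finset (Finset (ZMod n)) :=
  (Finset.univ : Finset (Finset (ZMod n))).filter (fun I => I.card = k ∧ ∀ i ∈ I, i + 1 ∉ I)

theorem mem_sparseSets {k : ℕ} {I : Finset (ZMod n)} :
    I ∈ sparseSets n k ↔ I.card = k ∧ ∀ i ∈ I, i + 1 ∉ I := by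
  simp [sparseSets]

open Classical in
/-- The sum of the products over the sparse sets that contain `j`. -/
def sumWith (k : ℕ) (c : ZMod n → R) (j : ZMod n) : R :=
  ∑ I ∈ sparseSets n k, if j ∈ I then ∏ i ∈ I, c i else 0

-- Removing j from a sparse set leaves a sparse set that avoids j and both of its neighbours.
open Classical in
theorem sumWith_succ (hn : 2 ≤ n) (k : ℕ) (c : ZMod n → R) (j : ZMod n) :
    sumWith (k + 1) c j = c j * ∑ I ∈ sparseSets n k,
      if j ∉ I ∧ j - 1 ∉ I ∧ j + 1 ∉ I then ∏ i ∈ I, c i else 0 := by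
  have h1 := one_ne_zero_of_two_le hn
  unfold sumWith
  rw [← Finset.sum_filter, ← Finset.sum_filter, Finset.mul_sum]
  refine Finset.sum_nbij' (fun I => I.erase j) (fun I => insert j I) ?_ ?_ ?_ ?_ ?_
  · intro I hI
    simp only [Finset.mem_filter, mem_sparseSets] at hI ⊢
    obtain ⟨⟨hc, hs⟩, hj⟩ := hI
    refine ⟨⟨by rw [Finset.card_erase_of_mem hj, hc]; rfl, fun i hi h => ?_⟩, by simp, ?_, ?_⟩
    · exact hs i (Finset.mem_of_mem_erase hi) (Finset.mem_of_mem_erase h)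
    · intro h
      have := hs _ (Finset.mem_of_mem_erase h)
      simp [hj] at this
    · exact fun h => hs _ hj (Finset.mem_of_mem_erase h)
  · intro I hI
    simp only [Finset.mem_filter, mem_sparseSets] at hI ⊢
    obtain ⟨⟨hc, hs⟩, hj, hj1, hj2⟩ := hI
    refine ⟨⟨by rw [Finset.card_insert_of_notMem hj, hc], fun i hi h => ?_⟩, by simp⟩
    rw [Finset.mem_insert] at hi h
    rcases hi with rfl | hi
    · rcases h with h | h
      · exact h1 (by simpa using h)
      · exact hj2 h
    · rcases h with h | h
      · exact hj1 (by rw [← h]; simpa using hi)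
      · exact hs _ hi h
  · intro I hI
    simp only [Finset.mem_filter] at hI
    exact Finset.insert_erase hI.2
  · intro I hI
    simp only [Finset.mem_filter] at hI
    exact Finset.erase_insert hI.2.1
  · intro I hI
    simp only [Finset.mem_filter] at hI
    exact (Finset.mul_prod_erase I c hI.2).symm

-- The bijection moves the element i of I to i + 1. The conditions on i + 2 and i - 1 keep the sets
-- sparse in the two directions.
open Classical in
theorem sum_sparse_swap (hn : 3 ≤ n) (k : ℕ) (c : ZMod n → R) (i : ZMod n) :
    c (i + 1) * ∑ I ∈ sparseSets n k, (if i ∈ I ∧ i + 2 ∉ I then ∏ l ∈ I, c l else 0) =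
      c i * ∑ I ∈ sparseSets n k, if i + 1 ∈ I ∧ i - 1 ∉ I then ∏ l ∈ I, c l else 0 := by
  have h1 := one_ne_zero_of_two_le (show 2 ≤ n by omega)
  have h2 := two_ne_zero_of_three_le hn
  have e1 : i + 1 ≠ i := fun h => h1 (by simpa using h)
  have e2 : i - 1 ≠ i + 1 := fun h => h2 (by linear_combination -h)
  have e3 : i + 2 ≠ i := fun h => h2 (by simpa using h)
  have e4 : i + 2 ≠ i + 1 := fun h => h1 (by linear_combination h)
  have e5 : i - 1 ≠ i := fun h => h1 (by linear_combination -h)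
  rw [← Finset.sum_filter, ← Finset.sum_filter, Finset.mul_sum, Finset.mul_sum]
  refine Finset.sum_nbij' (fun I => insert (i + 1) (I.erase i))
    (fun I => insert i (I.erase (i + 1))) ?_ ?_ ?_ ?_ ?_
  · intro I hI
    simp only [Finset.mem_filter, mem_sparseSets] at hI ⊢
    obtain ⟨⟨hc, hs⟩, hi, hi2⟩ := hI
    have hi1 : i + 1 ∉ I := hs i hi
    refine ⟨⟨?_, fun j hj h => ?_⟩, by simp, ?_⟩
    · rw [Finset.card_insert_of_notMem (by simp [hi1]), Finset.card_erase_add_one hi, hc]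
    · simp only [Finset.mem_insert, Finset.mem_erase] at hj h
      rcases hj with rfl | ⟨hj, hj'⟩
      · rw [show i + 1 + 1 = i + 2 by ring] at h
        tauto
      · rcases h with h | h
        · exact hj (by simpa using h)
        · exact hs _ hj' h.2
    · simp only [Finset.mem_insert, Finset.mem_erase, not_or, not_and]
      refine ⟨e2, fun _ h => ?_⟩
      have := hs _ h
      simp [hi] at this
  · intro I hI
    simp only [Finset.mem_filter, mem_sparseSets] at hI ⊢
    obtain ⟨⟨hc, hs⟩, hi, hi2⟩ := hI
    have hi1 : i ∉ I := fun h => hs i h hi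
    have hi3 : i + 2 ∉ I := by
      have := hs _ hi
      rwa [show i + 1 + 1 = i + 2 by ring] at this
    refine ⟨⟨?_, fun j hj h => ?_⟩, by simp, ?_⟩
    · rw [Finset.card_insert_of_notMem (by simp [hi1]), Finset.card_erase_add_one hi, hc]
    · simp only [Finset.mem_insert, Finset.mem_erase] at hj h
      rcases hj with rfl | ⟨hj, hj'⟩
      · tauto
      · rcases h with h | h
        · exact hi2 (by rw [← h]; simpa using hj')
        · exact hs _ hj' h.2
    · simp only [Finset.mem_insert, Finset.mem_erase, not_or, not_and]
      exact ⟨e3, fun _ => hi3⟩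
  · intro I hI
    simp only [Finset.mem_filter, mem_sparseSets] at hI
    have hi1 : i + 1 ∉ I := hI.1.2 i hI.2.1
    rw [Finset.erase_insert (by simp [hi1]), Finset.insert_erase hI.2.1]
  · intro I hI
    simp only [Finset.mem_filter, mem_sparseSets] at hI
    have hi1 : i ∉ I := fun h => hI.1.2 i h hI.2.1
    rw [Finset.erase_insert (by simp [hi1]), Finset.insert_erase hI.2.1]
  · intro I hI
    simp only [Finset.mem_filter, mem_sparseSets] at hI
    have hi1 : i + 1 ∉ I := hI.1.2 i hI.2.1
    rw [Finset.prod_insert (by simp [hi1]), ← Finset.mul_prod_erase I c hI.2.1]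
    ring

/-- The sum of the products over the sparse sets. -/
def sumSparse (k : ℕ) (c : ZMod n → R) : R := ∑ I ∈ sparseSets n k, ∏ i ∈ I, c i

-- Half of the recursion. The right-hand side is symmetric under the reflection about i, so
-- subtracting the mirror image of the identity eliminates it.
open Classical in
theorem lenard_half (hn : 3 ≤ n) (k : ℕ) (c : ZMod n → R) (i : ZMod n) :
    c (i + 1) * (sumWith k c (i + 1) + sumWith k c (i + 2) - sumSparse k c) +
      c i * sumWith k c (i + 1) + sumWith (k + 1) c (i + 1) =
    c i * ∑ I ∈ sparseSets n k, if i + 1 ∈ I ∧ i - 1 ∈ I then ∏ l ∈ I, c l else 0 := by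
  have hs := sum_sparse_swap hn k c i
  have key : c i * (∑ I ∈ sparseSets n k, if i + 1 ∈ I ∧ i - 1 ∈ I then ∏ l ∈ I, c l else 0) +
      c i * (∑ I ∈ sparseSets n k, if i + 1 ∈ I ∧ i - 1 ∉ I then ∏ l ∈ I, c l else 0) =
      c i * sumWith k c (i + 1) := by
    rw [← mul_add, ← Finset.sum_add_distrib, sumWith]
    congr 1
    refine Finset.sum_congr rfl fun I _ => ?_
    by_cases a : i + 1 ∈ I <;> by_cases b : i - 1 ∈ I <;> simp [a, b]
  have key2 : c (i + 1) * (sumWith k c (i + 1) + sumWith k c (i + 2) - sumSparse k c) +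
      sumWith (k + 1) c (i + 1) = - (c (i + 1) *
        ∑ I ∈ sparseSets n k, if i ∈ I ∧ i + 2 ∉ I then ∏ l ∈ I, c l else 0) := by
    rw [sumWith_succ (by omega), sumWith, sumWith, sumSparse, ← mul_add, ← mul_neg]
    congr 1
    rw [← Finset.sum_add_distrib, ← Finset.sum_sub_distrib, ← Finset.sum_add_distrib,
      ← Finset.sum_neg_distrib]
    refine Finset.sum_congr rfl fun I hI => ?_
    rw [mem_sparseSets] at hI
    rw [show i + 1 - 1 = i by ring, show i + 1 + 1 = i + 2 by ring]
    have h1 : i ∈ I → i + 1 ∉ I := hI.2 i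
    have h2 : i + 1 ∈ I → i + 2 ∉ I := fun h => by
      have := hI.2 _ h
      rwa [show i + 1 + 1 = i + 2 by ring] at this
    by_cases a : i ∈ I <;> by_cases b : i + 1 ∈ I <;> by_cases d : i + 2 ∈ I <;>
      simp [a, b, d] <;> tauto
  linear_combination key2 - hs - key

/-- Up to a scalar factor, the logarithmic gradient of `F_k ^ 2 / c_{[n]}`. -/
def lenardVec (k : ℕ) (c : ZMod n → R) (j : ZMod n) : R := 2 * sumWith k c j - sumSparse k c

/-- The part of the bracket that does not depend on the parameter, in logarithmic coordinates. -/
def quadPart (c v : ZMod n → R) (i : ZMod n) : R :=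
  (c i + c (i + 1)) * v (i + 1) + c (i + 1) * v (i + 2) - (c (i - 1) + c i) * v (i - 1)
    - c (i - 1) * v (i - 2)

/-- The coefficient of the parameter of the bracket, in logarithmic coordinates. -/
def shiftDiff (v : ZMod n → R) (i : ZMod n) : R := v (i + 1) - v (i - 1)

theorem add_one_eq_sub_one (hn : n ≤ 2) (i : ZMod n) : i + 1 = i - 1 := by
  have : n = 1 ∨ n = 2 := by have := NeZero.pos n; omega
  rcases this with rfl | rfl
  · exact Subsingleton.elim _ _
  · revert i; decide

theorem add_two_eq_sub_two (hn : n ≤ 2) (i : ZMod n) : i + 2 = i - 2 := by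
  have h := add_one_eq_sub_one hn (i - 1)
  have h' := add_one_eq_sub_one hn (i + 1)
  calc i + 2 = i + 1 + 1 := by ring
    _ = i - 1 + 1 := by rw [h']; ring
    _ = i - 2 := by rw [h]; ring

/-- The Lenard recursion. -/
theorem quadPart_lenardVec (k : ℕ) (c : ZMod n → R) (i : ZMod n) :
    quadPart c (lenardVec k c) i = -shiftDiff (lenardVec (k + 1) c) i := by
  rcases le_or_gt 3 n with hn | hn
  · have h1 := lenard_half hn k c i
    classical
    have hs := sum_sparse_swap hn k c (i - 1)
    -- The mirror image of `h1` under reflection of the indices about i.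
    have h2 : c (i - 1) * (sumWith k c (i - 1) + sumWith k c (i - 2) - sumSparse k c) +
        c i * sumWith k c (i - 1) + sumWith (k + 1) c (i - 1) =
        c i * ∑ I ∈ sparseSets n k, if i + 1 ∈ I ∧ i - 1 ∈ I then ∏ l ∈ I, c l else 0 := by
      rw [show i - 1 + 1 = i by ring, show i - 1 + 2 = i + 1 by ring,
        show i - 1 - 1 = i - 2 by ring] at hs
      have key : c i * (∑ I ∈ sparseSets n k, if i + 1 ∈ I ∧ i - 1 ∈ I then ∏ l ∈ I, c l else 0) +
          c i * (∑ I ∈ sparseSets n k, if i - 1 ∈ I ∧ i + 1 ∉ I then ∏ l ∈ I, c l else 0) =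
          c i * sumWith k c (i - 1) := by
        rw [← mul_add, ← Finset.sum_add_distrib, sumWith]
        congr 1
        refine Finset.sum_congr rfl fun I _ => ?_
        by_cases a : i + 1 ∈ I <;> by_cases b : i - 1 ∈ I <;> simp [a, b]
      have key2 : c (i - 1) * (sumWith k c (i - 1) + sumWith k c (i - 2) - sumSparse k c) +
          sumWith (k + 1) c (i - 1) = - (c (i - 1) *
            ∑ I ∈ sparseSets n k, if i ∈ I ∧ i - 2 ∉ I then ∏ l ∈ I, c l else 0) := by
        rw [sumWith_succ (by omega), sumWith, sumWith, sumSparse, ← mul_add, ← mul_neg]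
        congr 1
        rw [← Finset.sum_add_distrib, ← Finset.sum_sub_distrib, ← Finset.sum_add_distrib,
          ← Finset.sum_neg_distrib]
        refine Finset.sum_congr rfl fun I hI => ?_
        rw [mem_sparseSets] at hI
        rw [show i - 1 - 1 = i - 2 by ring, show i - 1 + 1 = i by ring]
        have h1 : i - 1 ∈ I → i ∉ I := fun h => by
          have := hI.2 _ h
          rwa [show i - 1 + 1 = i by ring] at this
        have h2 : i - 2 ∈ I → i - 1 ∉ I := fun h => by
          have := hI.2 _ h
          rwa [show i - 2 + 1 = i - 1 by ring] at this
        by_cases a : i ∈ I <;> by_cases b : i - 1 ∈ I <;> by_cases d : i - 2 ∈ I <;>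
          simp [a, b, d] <;> tauto
      linear_combination key2 + hs - key
    simp only [quadPart, shiftDiff, lenardVec]
    linear_combination 2 * h1 - 2 * h2
  -- For n ≤ 2 the indices i + 1 and i - 1 coincide, and both operators vanish.
  · have e := add_one_eq_sub_one (show n ≤ 2 by omega) i
    have e2 := add_two_eq_sub_two (show n ≤ 2 by omega) i
    have e3 : c (i + 1) = c (i - 1) := by rw [e]
    simp only [quadPart, shiftDiff, e, e2]
    ring

end Sparse

/-! ### Transfer matrices for sparse sets -/

section Transfer

variable {R : Type*} [CommRing R]

/-- The product `W 0 * ⋯ * W (k - 1)`. -/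
def matProd (W : ℕ → Matrix (Fin 2) (Fin 2) R) : ℕ → Matrix (Fin 2) (Fin 2) R
  | 0 => 1
  | k + 1 => matProd W k * W k

theorem matProd_gauge {W W' g : ℕ → Matrix (Fin 2) (Fin 2) R}
    (h : ∀ k, W k * g (k + 1) = g k * W' k) (k : ℕ) : matProd W k * g k = g 0 * matProd W' k := by
  induction k with
  | zero => simp [matProd]
  | succ k ih => rw [matProd, mul_assoc, h, ← mul_assoc, ih, mul_assoc, matProd]

/-- The intermediate gauge factors cancel, and since the gauge closes up after n steps the two
products are conjugate. -/
theorem trace_matProd_gauge {W W' g : ℕ → Matrix (Fin 2) (Fin 2) R}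
    (h : ∀ k, W k * g (k + 1) = g k * W' k) {n : ℕ} (hn : g n = g 0) (hg : IsUnit (g 0).det) :
    (matProd W n).trace = (matProd W' n).trace := by
  have h1 := matProd_gauge h n
  rw [hn] at h1
  have h2 : matProd W n = g 0 * matProd W' n * (g 0)⁻¹ := by
    rw [← h1, Matrix.mul_nonsing_inv_cancel_right _ _ hg]
  rw [h2, Matrix.trace_mul_comm, ← mul_assoc, Matrix.nonsing_inv_mul _ hg, one_mul]

/-- The expansion as a sum over paths of states; closing up the paths gives the cyclic formula
`trace_matProd`. -/
theorem matProd_apply (W : ℕ → Matrix (Fin 2) (Fin 2) R) (k : ℕ) (a b : Fin 2) :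
    matProd W k a b = ∑ t : Fin (k + 1) → Fin 2, if t 0 = a ∧ t (Fin.last k) = b then
      ∏ j : Fin k, W j (t j.castSucc) (t j.succ) else 0 := by
  induction k generalizing b with
  | zero =>
    rw [← (Equiv.funUnique (Fin 1) (Fin 2)).symm.sum_comp]
    simp only [matProd, Matrix.one_apply, Fin.sum_univ_two]
    fin_cases a <;> fin_cases b <;> simp [Equiv.funUnique]
  | succ k ih =>
    rw [matProd, Matrix.mul_apply, ← (Fin.snocEquiv fun _ : Fin (k + 2) => Fin 2).sum_comp,
      Fintype.sum_prod_type]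
    simp only [ih, Finset.sum_mul]
    rw [Finset.sum_comm]
    conv_rhs => rw [Finset.sum_comm]
    refine Finset.sum_congr rfl fun t _ => ?_
    have e0 : ∀ d : Fin 2, (Fin.snoc t d : Fin (k + 2) → Fin 2) 0 = t 0 := fun d => by
      rw [← Fin.castSucc_zero, Fin.snoc_castSucc (α := fun _ => Fin 2)]
    simp only [Fin.snocEquiv, Equiv.coe_fn_mk, Fin.snoc_last, Fin.prod_univ_castSucc,
      Fin.snoc_castSucc, ← Fin.castSucc_succ, e0, Fin.val_castSucc, Fin.val_last]
    by_cases h : t 0 = a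
    · simp [h, ite_mul, Fin.succ_last]
    · simp [h]

theorem prod_range_natCast {M : Type*} [CommMonoid M] {n : ℕ} [NeZero n] (f : ZMod n → M) :
    ∏ k ∈ Finset.range n, f k = ∏ i, f i := by
  obtain ⟨m, rfl⟩ := Nat.exists_eq_succ_of_ne_zero (NeZero.ne n)
  rw [← Fin.prod_univ_eq_prod_range (fun k => f (k : ZMod (m + 1)))]
  refine Finset.prod_congr rfl fun i _ => ?_
  congr 1
  exact Fin.cast_val_eq_self i

theorem trace_matProd {n : ℕ} [NeZero n] (W : ZMod n → Matrix (Fin 2) (Fin 2) R) :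
    (matProd (fun k => W k) n).trace = ∑ s : ZMod n → Fin 2, ∏ i, W i (s i) (s (i + 1)) := by
  obtain ⟨m, rfl⟩ := Nat.exists_eq_succ_of_ne_zero (NeZero.ne n)
  simp only [Matrix.trace, Matrix.diag, matProd_apply]
  rw [Finset.sum_comm]
  have e : ∀ t : Fin (m + 1 + 1) → Fin 2, (∑ a, if t 0 = a ∧ t (Fin.last (m + 1)) = a then
      ∏ j : Fin (m + 1), W ((j : ℕ) : ZMod (m + 1)) (t j.castSucc) (t j.succ) else 0) =
      if t 0 = t (Fin.last (m + 1)) then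
      ∏ j : Fin (m + 1), W ((j : ℕ) : ZMod (m + 1)) (t j.castSucc) (t j.succ) else 0 := by
    intro t
    by_cases h : t 0 = t (Fin.last (m + 1))
    · simp [h]
    · rw [if_neg h]
      refine Finset.sum_eq_zero fun a _ => if_neg fun h' => h (h'.1.trans h'.2.symm)
  simp only [Nat.succ_eq_add_one] at *
  simp only [e]
  rw [← (Fin.snocEquiv fun _ : Fin (m + 2) => Fin 2).sum_comp, Fintype.sum_prod_type,
    Finset.sum_comm]
  change _ = ∑ s : Fin (m + 1) → Fin 2, ∏ i : Fin (m + 1), W i (s i) (s (i + 1))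
  refine Finset.sum_congr rfl fun t _ => ?_
  have e0 : ∀ d : Fin 2, (Fin.snoc t d : Fin (m + 2) → Fin 2) 0 = t 0 := fun d => by
    rw [← Fin.castSucc_zero, Fin.snoc_castSucc (α := fun _ => Fin 2)]
  simp only [Fin.snocEquiv, Equiv.coe_fn_mk, Fin.snoc_last, e0, Fin.snoc_castSucc]
  rw [Finset.sum_ite_eq, if_pos (Finset.mem_univ _)]
  refine Finset.prod_congr rfl fun i _ => ?_
  have e1 : ((i : ℕ) : ZMod (m + 1)) = i := Fin.cast_val_eq_self i
  rw [e1]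
  congr 1
  refine Fin.lastCases ?_ (fun j => ?_) i
  · rw [Fin.succ_last, Fin.snoc_last, Fin.last_add_one]
  · rw [← Fin.castSucc_succ, Fin.snoc_castSucc (α := fun _ => Fin 2), Fin.coeSucc_eq_succ]

/-- The transfer matrix of sparse sets. -/
def transfer (a : R) : Matrix (Fin 2) (Fin 2) R := !![1, 1; a, 0]

-- State 1 at i stands for i ∈ I. The zero entry of the matrix forbids two consecutive ones.
open Classical in
theorem prod_transfer {n : ℕ} [NeZero n] (a : ZMod n → R) (I : Finset (ZMod n)) :
    ∏ i, transfer (a i) (if i ∈ I then 1 else 0) (if i + 1 ∈ I then 1 else 0) =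
      if ∀ i ∈ I, i + 1 ∉ I then ∏ i ∈ I, a i else 0 := by
  split_ifs with h
  · rw [← Finset.prod_filter_mul_prod_filter_not Finset.univ (· ∈ I)]
    have e : Finset.univ.filter (· ∈ I) = I := by ext; simp
    rw [e]
    have h1 : ∏ x ∈ I, transfer (a x) (if x ∈ I then 1 else 0) (if x + 1 ∈ I then 1 else 0) =
        ∏ x ∈ I, a x :=
      Finset.prod_congr rfl fun i hi => by rw [if_pos hi, if_neg (h i hi)]; simp [transfer]
    have h2 : ∏ x with x ∉ I,
        transfer (a x) (if x ∈ I then 1 else 0) (if x + 1 ∈ I then 1 else 0) = 1 := by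
      refine Finset.prod_eq_one fun i hi => ?_
      simp only [Finset.mem_filter, Finset.mem_univ, true_and] at hi
      rw [if_neg hi]
      split_ifs <;> simp [transfer]
    rw [h1, h2, mul_one]
  · push Not at h
    obtain ⟨i, hi, hi'⟩ := h
    refine Finset.prod_eq_zero (Finset.mem_univ i) ?_
    rw [if_pos hi, if_pos hi']
    simp [transfer]

theorem sum_prod_transfer {n : ℕ} [NeZero n] (a : ZMod n → R) :
    ∑ s : ZMod n → Fin 2, ∏ i, transfer (a i) (s i) (s (i + 1)) =
      ∑ k ∈ Finset.range (n + 1), sumSparse k a := by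
  classical
  have h1 : ∑ s : ZMod n → Fin 2, ∏ i, transfer (a i) (s i) (s (i + 1)) =
      ∑ I : Finset (ZMod n), if ∀ i ∈ I, i + 1 ∉ I then ∏ i ∈ I, a i else 0 := by
    symm
    refine Finset.sum_nbij' (fun I i => if i ∈ I then 1 else 0)
      (fun s => Finset.univ.filter (s · = 1)) (by simp) (by simp) ?_ ?_ ?_
    · intro I _
      ext i
      by_cases hi : i ∈ I <;> simp [hi]
    · intro s _
      funext i
      by_cases hi : s i = 1
      · simp [hi]
      · simp [hi]; omega
    · intro I _
      exact (prod_transfer a I).symm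
  rw [h1, ← Finset.sum_fiberwise_of_maps_to (g := Finset.card) (t := Finset.range (n + 1))]
  · refine Finset.sum_congr rfl fun k _ => ?_
    rw [sumSparse, ← Finset.sum_filter, Finset.filter_filter]
    refine Finset.sum_congr ?_ fun _ _ => rfl
    ext I
    simp [mem_sparseSets]
  · intro I _
    have := Finset.card_le_univ I
    rw [ZMod.card] at this
    simp; omega

theorem sumSparse_smul {n : ℕ} [NeZero n] (k : ℕ) (t : R) (c : ZMod n → R) :
    sumSparse k (fun i => t * c i) = t ^ k * sumSparse k c := by
  unfold sumSparse
  rw [Finset.mul_sum]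
  refine Finset.sum_congr rfl fun I hI => ?_
  rw [Finset.prod_mul_distrib, Finset.prod_const, (mem_sparseSets.1 hI).1]

theorem sum_pow_mul_sumSparse {n : ℕ} [NeZero n] (t : R) (c : ZMod n → R) :
    ∑ k ∈ Finset.range (n + 1), t ^ k * sumSparse k c =
      (matProd (fun k => transfer (t * c k)) n).trace := by
  rw [trace_matProd (fun i => transfer (t * c i)), sum_prod_transfer]
  exact Finset.sum_congr rfl fun k _ => (sumSparse_smul k t c).symm

/-- A sparse set is disjoint from its translate by 1. -/
theorem two_mul_card_le {n : ℕ} [NeZero n] {k : ℕ} {I : Finset (ZMod n)}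
    (h : I ∈ sparseSets n k) : 2 * k ≤ n := by
  classical
  rw [mem_sparseSets] at h
  have hd : Disjoint I (I.map (Equiv.addRight (1 : ZMod n)).toEmbedding) := by
    rw [Finset.disjoint_left]
    intro i hi hi'
    simp only [Finset.mem_map_equiv] at hi'
    exact h.2 _ hi' (by simpa using hi)
  have := Finset.card_le_univ (I ∪ I.map (Equiv.addRight (1 : ZMod n)).toEmbedding)
  rw [Finset.card_union_of_disjoint hd, Finset.card_map, h.1, ZMod.card] at this
  omega

theorem sumSparse_eq_zero {n : ℕ} [NeZero n] {k : ℕ} (h : n < 2 * k) (c : ZMod n → R) :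
    sumSparse k c = 0 := by
  refine Finset.sum_eq_zero fun I hI => absurd (two_mul_card_le hI) (by omega)

theorem sumWith_eq_zero {n : ℕ} [NeZero n] {k : ℕ} (h : n < 2 * k) (c : ZMod n → R) (j : ZMod n) :
    sumWith k c j = 0 := by
  refine Finset.sum_eq_zero fun I hI => absurd (two_mul_card_le hI) (by omega)

theorem sumSparse_zero {n : ℕ} [NeZero n] (c : ZMod n → R) : sumSparse 0 c = 1 := by
  have : sparseSets n 0 = {∅} := by
    ext I
    simp only [mem_sparseSets, Finset.card_eq_zero, Finset.mem_singleton]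
    constructor
    · exact fun h => h.1
    · rintro rfl; simp
  simp [sumSparse, this]

theorem sumWith_zero {n : ℕ} [NeZero n] (c : ZMod n → R) (j : ZMod n) : sumWith 0 c j = 0 := by
  refine Finset.sum_eq_zero fun I hI => ?_
  rw [mem_sparseSets, Finset.card_eq_zero] at hI
  simp [hI.1]

theorem sum_half_range {n : ℕ} [NeZero n] {M : Type*} [AddCommMonoid M] {f : ℕ → M}
    (hf : ∀ k, n < 2 * k → f k = 0) :
    ∑ k ∈ Finset.range (n / 2 + 1), f k = ∑ k ∈ Finset.range (n + 1), f k := by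
  refine Finset.sum_subset (fun k => by simp only [Finset.mem_range]; omega) fun k _ hk => ?_
  rw [Finset.mem_range] at hk
  exact hf k (by omega)

end Transfer

/-! ### Invariance of the integrals -/

section Conserved

variable {K : Type*} [Field K] {n : ℕ} [NeZero n]

/-- At the spectral value -1/α a gauge transformation makes the transfer matrices lower triangular,
with diagonal entries x_i and 1 - x_{i+1}. -/
theorem sum_sumSparse_miura {α : K} (hα : α ≠ 0) (x : ZMod n → K) :
    ∑ k ∈ Finset.range (n + 1), (-α⁻¹) ^ k * sumSparse k (miura α x) =
      ∏ i, x i + ∏ i, (1 - x i) := by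
  rw [sum_pow_mul_sumSparse]
  let g : ℕ → Matrix (Fin 2) (Fin 2) K := fun k => !![0, 1; 1, -x k]
  let T : ℕ → Matrix (Fin 2) (Fin 2) K := fun k => !![x k, 0; 1, 1 - x (k + 1)]
  have hg : ∀ k : ℕ, transfer (-α⁻¹ * miura α x k) * g (k + 1) = g k * T k := by
    intro k
    have : -α⁻¹ * miura α x k = -(x k * (1 - x (k + 1))) := by
      unfold miura; field_simp
    rw [this]
    simp only [transfer, g, T, Matrix.mul_fin_two]
    push_cast
    congr 1
    simp only [Matrix.vecCons_inj, and_true]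
    refine ⟨⟨?_, ?_⟩, ?_, ?_⟩ <;> ring
  rw [trace_matProd_gauge hg (by simp [g]) (by simp [g, Matrix.det_fin_two_of])]
  have hT : ∀ k, ∃ b, matProd T k = !![∏ j ∈ Finset.range k, x j, 0; b,
      ∏ j ∈ Finset.range k, (1 - x (j + 1))] := by
    intro k
    induction k with
    | zero =>
      refine ⟨0, ?_⟩
      rw [matProd, Matrix.one_fin_two]
      simp
    | succ k ih =>
      obtain ⟨b, hb⟩ := ih
      refine ⟨b * x k + ∏ j ∈ Finset.range k, (1 - x (j + 1)), ?_⟩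
      rw [matProd, hb, Matrix.mul_fin_two]
      simp [Finset.prod_range_succ]
  obtain ⟨b, hb⟩ := hT n
  rw [hb, Matrix.trace_fin_two_of, prod_range_natCast (fun i => x i),
    prod_range_natCast (fun i => 1 - x (i + 1))]
  congr 1
  exact Equiv.prod_comp (Equiv.addRight (1 : ZMod n)) (fun i => 1 - x i)

/-- An explicit gauge relates the transfer matrices of P and Q. Its determinant contains the factor
1 + tα, hence the excluded value of t. -/
theorem sum_sumSparse_miura_eq_dual {α t : K} (ht : t * α ≠ -1) {x : ZMod n → K}
    (h0 : ∀ i, x i ≠ 0) (h1 : ∀ i, x i ≠ 1) :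
    ∑ k ∈ Finset.range (n + 1), t ^ k * sumSparse k (miura α x) =
      ∑ k ∈ Finset.range (n + 1), t ^ k * sumSparse k (miuraDual α x) := by
  rw [sum_pow_mul_sumSparse, sum_pow_mul_sumSparse]
  have h1' : ∀ i, 1 - x i ≠ 0 := fun i => sub_ne_zero.2 (h1 i).symm
  let g : ℕ → Matrix (Fin 2) (Fin 2) K := fun k =>
    !![1, (1 - x k)⁻¹; t * α * x k, -x k * (1 - x k)⁻¹]
  refine trace_matProd_gauge (g := g) (fun k => ?_) (by simp [g]) ?_
  · simp only [transfer, g, Matrix.mul_fin_two, miura, miuraDual]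
    push_cast
    congr 1
    have := h1' k
    have := h1' (k + 1)
    simp only [Matrix.vecCons_inj, and_true]
    refine ⟨⟨?_, ?_⟩, ?_, ?_⟩
    · field_simp
    · field_simp; ring
    · field_simp; ring
    · field_simp; ring
  · have e : (g 0).det = -x 0 * (1 - x 0)⁻¹ * (1 + t * α) := by
      simp only [g, Matrix.det_fin_two_of, Nat.cast_zero]; ring
    rw [e, isUnit_iff_ne_zero]
    refine mul_ne_zero (mul_ne_zero (neg_ne_zero.2 (h0 0)) (inv_ne_zero (h1' 0))) fun h => ht ?_
    linear_combination h

/-- The generating functions are polynomials in t that agree off one point of an infinite field, so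
their coefficients agree. -/
theorem sumSparse_miura_eq_dual [Infinite K] {α : K} (hα : α ≠ 0) {x : ZMod n → K}
    (h0 : ∀ i, x i ≠ 0) (h1 : ∀ i, x i ≠ 1) (k : ℕ) :
    sumSparse k (miura α x) = sumSparse k (miuraDual α x) := by
  by_cases hk : k < n + 1
  swap
  · rw [sumSparse_eq_zero (by omega), sumSparse_eq_zero (by omega)]
  let p : (ZMod n → K) → Polynomial K := fun c =>
    ∑ k ∈ Finset.range (n + 1), Polynomial.monomial k (sumSparse k c)
  have hp : p (miura α x) = p (miuraDual α x) := by
    refine Polynomial.eq_of_infinite_eval_eq _ _ (Set.Infinite.mono (s := {-α⁻¹}ᶜ) ?_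
      (Set.finite_singleton _).infinite_compl)
    intro t ht
    have ht' : t * α ≠ -1 := fun h => ht (by
      rw [Set.mem_singleton_iff, neg_eq_neg_one_mul, ← h, mul_inv_cancel_right₀ hα])
    have := sum_sumSparse_miura_eq_dual ht' h0 h1
    simpa [p, Polynomial.eval_finsetSum, mul_comm] using this
  have := congrArg (fun q => Polynomial.coeff q k) hp
  simpa [p, Polynomial.finsetSum_coeff, Polynomial.coeff_monomial, hk] using this

theorem prod_miura_eq_dual {α : K} (x : ZMod n → K) :
    ∏ i, miura α x i = ∏ i, miuraDual α x i := by
  simp only [miura, miuraDual, Finset.prod_mul_distrib]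
  have h1 : ∏ i, (1 - x (i + 1)) = ∏ i, (1 - x i) :=
    Equiv.prod_comp (Equiv.addRight (1 : ZMod n)) fun i => 1 - x i
  have h2 : ∏ i, x (i + 1) = ∏ i, x i := Equiv.prod_comp (Equiv.addRight (1 : ZMod n)) x
  rw [h1, h2]

end Conserved

/-! ### Logarithmic gradients, Casimirs and commutation -/

section Calculus

variable {K : Type*} [RCLike K] {n : ℕ} [NeZero n]

/-- The logarithmic partial derivatives `c_j ∂f / ∂c_j`. -/
def euler (f : (ZMod n → K) → K) (c : ZMod n → K) (j : ZMod n) : K := c j * pd j f c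

theorem euler_mul {f g : (ZMod n → K) → K} {c : ZMod n → K} (hf : DifferentiableAt K f c)
    (hg : DifferentiableAt K g c) (j : ZMod n) :
    euler (fun x => f x * g x) c j = euler f c j * g c + f c * euler g c j := by
  unfold euler pd
  rw [fderiv_fun_mul hf hg]
  simp only [add_apply, smul_apply, smul_eq_mul]
  ring

theorem euler_congr {f g : (ZMod n → K) → K} {c : ZMod n → K} (h : f =ᶠ[nhds c] g) :
    euler f c = euler g c := by
  funext j
  unfold euler pd
  rw [h.fderiv_eq]

theorem prodAll_ne_zero {c : ZMod n → K} (hc : c ∈ torus K n) : prodAll c ≠ 0 :=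
  Finset.prod_ne_zero_iff.2 fun i _ => hc i

theorem hasFDerivAt_prod (I : Finset (ZMod n)) (c : ZMod n → K) :
    HasFDerivAt (fun c : ZMod n → K => ∏ i ∈ I, c i)
      (∑ i ∈ I, (∏ j ∈ I.erase i, c j) • ContinuousLinearMap.proj (R := K) (φ := fun _ => K) i) c :=
  HasFDerivAt.finsetProd fun i _ => hasFDerivAt_apply i c

open Classical in
theorem euler_prod (I : Finset (ZMod n)) (c : ZMod n → K) (j : ZMod n) :
    euler (fun c => ∏ i ∈ I, c i) c j = if j ∈ I then ∏ i ∈ I, c i else 0 := by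
  unfold euler pd
  rw [(hasFDerivAt_prod I c).fderiv]
  simp only [sum_apply, smul_apply,
    ContinuousLinearMap.proj_apply, smul_eq_mul, Pi.single_apply, mul_ite, mul_one, mul_zero]
  rw [Finset.sum_ite_eq']
  split_ifs with h
  · exact Finset.mul_prod_erase I c h
  · ring

theorem F_eq_sumSparse (k : ℕ) (c : ZMod n → K) : F k c = sumSparse k c := rfl

theorem contDiff_F (k : ℕ) : ContDiff K 1 (F (K := K) (n := n) k) := by
  unfold F
  fun_prop

theorem differentiable_F (k : ℕ) : Differentiable K (F (K := K) (n := n) k) :=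
  (contDiff_F k).differentiable one_ne_zero

theorem differentiable_prodAll : Differentiable K (prodAll (K := K) (n := n)) := by
  unfold prodAll
  fun_prop

theorem euler_F (k : ℕ) (c : ZMod n → K) : euler (F k) c = sumWith k c := by
  classical
  funext j
  unfold sumWith
  have h : euler (F k) c j = ∑ I ∈ sparseSets n k, euler (fun c => ∏ i ∈ I, c i) c j := by
    have e : F (K := K) k = fun c : ZMod n → K => ∑ I ∈ sparseSets n k, ∏ i ∈ I, c i := rfl
    unfold euler pd
    rw [e, fderiv_fun_sum fun I _ => (hasFDerivAt_prod I c).differentiableAt,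
      sum_apply, Finset.mul_sum]
  rw [h]
  refine Finset.sum_congr rfl fun I _ => ?_
  rw [euler_prod]

theorem euler_prodAll (c : ZMod n → K) (j : ZMod n) : euler prodAll c j = prodAll c := by
  classical
  exact (euler_prod Finset.univ c j).trans (if_pos (Finset.mem_univ j))

/-- The product rule applied to (g^2 / c_{[n]}) · c_{[n]} = g^2, with `prodAll` an eigenvector of
every logarithmic derivative. -/
theorem euler_sq_div_prodAll {g : (ZMod n → K) → K} {c : ZMod n → K} (hc : c ∈ torus K n)
    (hg : DifferentiableAt K g c) (j : ZMod n) :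
    euler (fun x => g x ^ 2 / prodAll x) c j = g c / prodAll c * (2 * euler g c j - g c) := by
  have hp := prodAll_ne_zero hc
  have hd : DifferentiableAt K (fun x => g x ^ 2 / prodAll x) c :=
    by
    have := differentiable_prodAll c
    fun_prop (disch := exact hp)
  have h1 := euler_mul hd (differentiable_prodAll c) j
  have h2 := euler_mul hg hg j
  have h3 : euler (fun x => g x ^ 2 / prodAll x * prodAll x) c = euler (fun x => g x * g x) c := by
    refine euler_congr ?_
    filter_upwards [(differentiable_prodAll c).continuousAt.eventually_ne hp] with x hx
    rw [div_mul_cancel₀ _ hx, sq]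
  rw [h3, h2, euler_prodAll] at h1
  field_simp at h1 ⊢
  linear_combination -h1

theorem euler_normF (k : ℕ) {c : ZMod n → K} (hc : c ∈ torus K n) :
    euler (normF k) c = (F k c / prodAll c) • lenardVec k c := by
  funext j
  have := euler_sq_div_prodAll hc (differentiable_F k c) j
  rw [euler_F] at this
  exact this

/-- The square root of the numerator of `casimirE`. -/
def altSum (α : K) (c : ZMod n → K) : K :=
  ∑ k ∈ Finset.range (n / 2 + 1), (-1) ^ k * F k c * (α⁻¹) ^ k

theorem differentiable_altSum (α : K) : Differentiable K (altSum (n := n) α) := by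
  have := differentiable_F (K := K) (n := n)
  unfold altSum
  fun_prop

theorem euler_altSum (α : K) (c : ZMod n → K) (j : ZMod n) :
    euler (altSum α) c j = ∑ k ∈ Finset.range (n / 2 + 1), (-α⁻¹) ^ k * sumWith k c j := by
  have h : ∀ k, DifferentiableAt K (fun c : ZMod n → K => (-1) ^ k * F k c * (α⁻¹) ^ k) c :=
    fun k => by
      have := differentiable_F (K := K) (n := n) k c
      fun_prop
  have e : euler (altSum α) c j = ∑ k ∈ Finset.range (n / 2 + 1),
      euler (fun c => (-1) ^ k * F k c * (α⁻¹) ^ k) c j := by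
    unfold euler pd altSum
    rw [fderiv_fun_sum fun k _ => h k, sum_apply, Finset.mul_sum]
  rw [e]
  refine Finset.sum_congr rfl fun k _ => ?_
  rw [← euler_F]
  unfold euler pd
  rw [fderiv_mul_const (by have := differentiable_F (K := K) (n := n) k c; fun_prop),
    fderiv_const_mul (differentiable_F k c)]
  simp only [smul_apply, smul_eq_mul]
  rw [neg_pow]
  ring

/-- The vector proportional to the logarithmic gradient of `casimirE`. -/
def casimirVec (α : K) (c : ZMod n → K) : ZMod n → K :=
  ∑ k ∈ Finset.range (n / 2 + 1), (-α⁻¹) ^ k • lenardVec k c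

theorem euler_casimirE (α : K) {c : ZMod n → K} (hc : c ∈ torus K n) :
    euler (casimirE α) c = (altSum α c / prodAll c) • casimirVec α c := by
  funext j
  have := euler_sq_div_prodAll hc (differentiable_altSum α c) j
  rw [euler_altSum] at this
  refine this.trans ?_
  rw [Pi.smul_apply, smul_eq_mul]
  congr 1
  simp only [casimirVec, altSum, Finset.sum_apply, Pi.smul_apply, smul_eq_mul, lenardVec,
    Finset.mul_sum, ← Finset.sum_sub_distrib]
  refine Finset.sum_congr rfl fun k _ => ?_
  rw [← F_eq_sumSparse, neg_pow]
  ring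

/-- The bracket with parameter `β` in logarithmic coordinates, as a linear map. -/
def logHam (β : K) (c : ZMod n → K) : (ZMod n → K) →ₗ[K] (ZMod n → K) where
  toFun v i := quadPart c v i - β * shiftDiff v i
  map_add' u v := by
    funext i
    simp only [quadPart, shiftDiff, Pi.add_apply]; ring
  map_smul' t v := by
    funext i
    simp only [quadPart, shiftDiff, Pi.smul_apply, smul_eq_mul, RingHom.id_apply]; ring

theorem logHam_apply (β : K) (c v : ZMod n → K) (i : ZMod n) :
    logHam β c v i = quadPart c v i - β * shiftDiff v i := rfl

/-- The bracket matrix factors as diag(c) · `logHam` · diag(c). Coinciding indices for small n cause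
no trouble, since both sides add the contributions. -/
theorem sum_poisson_mul (β : K) (c w : ZMod n → K) (i : ZMod n) :
    ∑ j, poisson β c i j * w j = c i * logHam β c (fun j => c j * w j) i := by
  have e1 : ∀ j : ZMod n, i = j + 1 ↔ j = i - 1 := fun j =>
    ⟨fun h => by rw [h]; ring, fun h => by rw [h]; ring⟩
  have e2 : ∀ j : ZMod n, i = j + 2 ↔ j = i - 2 := fun j =>
    ⟨fun h => by rw [h]; ring, fun h => by rw [h]; ring⟩
  simp only [poisson, e1, e2, sub_mul, add_mul, ite_mul, zero_mul, Finset.sum_sub_distrib,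
    Finset.sum_add_distrib, Finset.sum_ite_eq', Finset.mem_univ, if_true, logHam_apply, quadPart,
    shiftDiff]
  rw [show i - 2 + 1 = i - 1 by ring]
  ring

theorem hamiltonian_poisson (β : K) (f : (ZMod n → K) → K) (c : ZMod n → K) (i : ZMod n) :
    hamiltonian (poisson β) f c i = c i * logHam β c (euler f c) i :=
  sum_poisson_mul β c (fun j => pd j f c) i

theorem bracket_poisson (β : K) (f g : (ZMod n → K) → K) (c : ZMod n → K) :
    bracket (poisson β) f g c = ∑ i, euler f c i * logHam β c (euler g c) i := by
  unfold bracket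
  refine Finset.sum_congr rfl fun i _ => ?_
  have := hamiltonian_poisson β g c i
  unfold hamiltonian at this
  rw [show euler f c i * logHam β c (euler g c) i =
    pd i f c * (c i * logHam β c (euler g c) i) by unfold euler; ring, ← this, Finset.mul_sum]
  exact Finset.sum_congr rfl fun j _ => by ring

theorem poisson_skew (β : K) (c : ZMod n → K) (i j : ZMod n) :
    poisson β c i j = -poisson β c j i := by
  have h : ∀ i j : ZMod n, (if j = i + 1 then c i * c j * (c i + c j - β) else 0) =
      if j = i + 1 then c j * c i * (c j + c i - β) else 0 := fun i j => by
    split_ifs <;> ring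
  unfold poisson
  rw [h i j, h j i]
  ring

theorem isCasimir_of_logHam {β : K} {f : (ZMod n → K) → K}
    (h : ∀ c ∈ torus K n, logHam β c (euler f c) = 0) : IsCasimir (poisson (n := n) β) f := by
  intro g c hc
  have e : bracket (poisson β) f g c = -bracket (poisson β) g f c := by
    unfold bracket
    rw [Finset.sum_comm, ← Finset.sum_neg_distrib]
    refine Finset.sum_congr rfl fun i _ => ?_
    rw [← Finset.sum_neg_distrib]
    refine Finset.sum_congr rfl fun j _ => ?_
    rw [poisson_skew]
    ring
  rw [e, bracket_poisson, h c hc]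
  simp

theorem lenardVec_zero (c : ZMod n → K) : lenardVec 0 c = fun _ => -1 := by
  funext j
  rw [lenardVec, sumWith_zero, sumSparse_zero]
  ring

theorem lenardVec_eq_zero {k : ℕ} (hk : n < 2 * k) (c : ZMod n → K) : lenardVec k c = 0 := by
  funext j
  rw [lenardVec, sumWith_eq_zero hk, sumSparse_eq_zero hk]
  simp

theorem shiftDiff_lenardVec_zero (c : ZMod n → K) : shiftDiff (lenardVec 0 c) = 0 := by
  funext j
  simp [shiftDiff, lenardVec_zero]

theorem shiftDiff_lenardVec_eq_zero {k : ℕ} (hk : n < 2 * k) (c : ZMod n → K) :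
    shiftDiff (lenardVec k c) = 0 := by
  funext j
  simp [shiftDiff, lenardVec_eq_zero hk]

theorem logHam_lenardVec (β : K) (k : ℕ) (c : ZMod n → K) :
    logHam β c (lenardVec k c) =
      -shiftDiff (lenardVec (k + 1) c) - β • shiftDiff (lenardVec k c) := by
  funext i
  rw [logHam_apply, quadPart_lenardVec]
  simp

/-- By the Lenard recursion the weights (-1/α)^k turn the image into a telescoping sum. It starts at
the constant vector v_0, with zero shift difference, and ends at v_{n/2+1} = 0. -/
theorem logHam_casimirVec {α : K} (hα : α ≠ 0) (c : ZMod n → K) :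
    logHam α c (casimirVec α c) = 0 := by
  have h : ∀ k, logHam α c ((-α⁻¹) ^ k • lenardVec k c) =
      (α * (-α⁻¹) ^ (k + 1)) • shiftDiff (lenardVec (k + 1) c) -
        (α * (-α⁻¹) ^ k) • shiftDiff (lenardVec k c) := by
    intro k
    rw [map_smul, logHam_lenardVec]
    funext i
    simp only [Pi.smul_apply, Pi.sub_apply, Pi.neg_apply, smul_eq_mul, pow_succ]
    field_simp
  rw [casimirVec, map_sum, Finset.sum_congr rfl fun k _ => h k,
    Finset.sum_range_sub (fun k => (α * (-α⁻¹) ^ k) • shiftDiff (lenardVec k c)),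
    shiftDiff_lenardVec_zero, shiftDiff_lenardVec_eq_zero (by omega)]
  simp

theorem isCasimir_casimirE {α : K} (hα : α ≠ 0) :
    IsCasimir (poisson (n := n) α) (casimirE α) := by
  refine isCasimir_of_logHam fun c hc => ?_
  rw [euler_casimirE α hc, map_smul, logHam_casimirVec hα, smul_zero]

theorem sum_shift (f : ZMod n → K) (a : ZMod n) : ∑ i, f (i + a) = ∑ i, f i :=
  Equiv.sum_comp (Equiv.addRight a) f

theorem sum_mul_shiftDiff (u v : ZMod n → K) :
    ∑ i, u i * shiftDiff v i = -∑ i, v i * shiftDiff u i := by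
  have h1 := sum_shift (fun i => u (i - 1) * v i) 1
  have h2 := sum_shift (fun i => v (i - 1) * u i) 1
  simp only [add_sub_cancel_right] at h1 h2
  simp only [shiftDiff, mul_sub, Finset.sum_sub_distrib, h1, h2]
  simp only [mul_comm, neg_sub]

theorem sum_mul_quadPart (c u v : ZMod n → K) :
    ∑ i, u i * quadPart c v i = -∑ i, v i * quadPart c u i := by
  have key : ∀ u v : ZMod n → K, ∑ i, u i * quadPart c v i =
      ∑ i, (u i * ((c i + c (i + 1)) * v (i + 1)) + u i * (c (i + 1) * v (i + 2))) -
      ∑ i, (v i * ((c i + c (i + 1)) * u (i + 1)) + v i * (c (i + 1) * u (i + 2))) := by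
    intro u v
    have h1 := sum_shift (fun i => u i * ((c (i - 1) + c i) * v (i - 1))) 1
    have h2 := sum_shift (fun i => u i * (c (i - 1) * v (i - 2))) 2
    simp only [add_sub_cancel_right] at h1 h2
    have h3 : ∀ i : ZMod n, i + 2 - 1 = i + 1 := fun i => by ring
    simp only [h3] at h2
    have e : ∑ i, (v i * ((c i + c (i + 1)) * u (i + 1)) + v i * (c (i + 1) * u (i + 2))) =
        ∑ i, (u i * ((c (i - 1) + c i) * v (i - 1)) + u i * (c (i - 1) * v (i - 2))) := by
      rw [Finset.sum_add_distrib, Finset.sum_add_distrib, ← h1, ← h2]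
      congr 1 <;> exact Finset.sum_congr rfl fun i _ => by ring
    rw [e, ← Finset.sum_sub_distrib]
    refine Finset.sum_congr rfl fun i _ => ?_
    unfold quadPart
    ring
  rw [key u v, key v u]
  ring

/-- Skew-symmetry of Q and S and the recursion give ⟨v_{k+1}, S v_l⟩ = ⟨v_k, S v_{l+1}⟩. The first
index descends to 0, where S v_0 = 0. -/
theorem sum_lenardVec_mul_shiftDiff (k l : ℕ) (c : ZMod n → K) :
    ∑ i, lenardVec k c i * shiftDiff (lenardVec l c) i = 0 := by
  induction k generalizing l with
  | zero =>
    rw [sum_mul_shiftDiff, shiftDiff_lenardVec_zero]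
    simp
  | succ k ih =>
    have h1 : ∑ i, lenardVec l c i * quadPart c (lenardVec k c) i =
        -∑ i, lenardVec l c i * shiftDiff (lenardVec (k + 1) c) i := by
      simp [quadPart_lenardVec]
    have h2 : ∑ i, lenardVec k c i * quadPart c (lenardVec l c) i =
        -∑ i, lenardVec k c i * shiftDiff (lenardVec (l + 1) c) i := by
      simp [quadPart_lenardVec]
    rw [sum_mul_shiftDiff, ← h1, sum_mul_quadPart, h2, ih]
    simp

theorem bracket_normF (β : K) (k l : ℕ) {c : ZMod n → K} (hc : c ∈ torus K n) :
    bracket (poisson β) (normF k) (normF l) c = 0 := by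
  rw [bracket_poisson, euler_normF k hc, euler_normF l hc, map_smul, logHam_lenardVec]
  have e : ∀ i, ((F k c / prodAll c) • lenardVec k c) i * ((F l c / prodAll c) •
      (-shiftDiff (lenardVec (l + 1) c) - β • shiftDiff (lenardVec l c))) i =
      (F k c / prodAll c) * (F l c / prodAll c) *
        (-(lenardVec k c i * shiftDiff (lenardVec (l + 1) c) i) -
          β * (lenardVec k c i * shiftDiff (lenardVec l c) i)) := by
    intro i
    simp only [Pi.smul_apply, Pi.sub_apply, Pi.neg_apply, smul_eq_mul]
    ring
  simp only [e, ← Finset.mul_sum, Finset.sum_sub_distrib, Finset.sum_neg_distrib,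
    sum_lenardVec_mul_shiftDiff]
  simp

end Calculus

/-! ### Spans of Hamiltonian vector fields -/

section Spans

variable {K : Type*} [RCLike K] {n : ℕ} [NeZero n]

/-- A triangularity argument: f_k serves to recover X_{k+1} from the earlier members of the chain,
while X_0 and the tail vanish. -/
theorem span_range_eq {V : Type*} [AddCommGroup V] [Module K V] {m : ℕ} {f : Fin (m + 1) → V}
    {X : ℕ → V} (h0 : X 0 = 0) (hm : ∀ k, m < k → X k = 0)
    (hf : ∀ k, f k ∈ Submodule.span K (Set.range X))
    (hX : ∀ k : Fin (m + 1), (∀ j ≤ (k : ℕ), X j ∈ Submodule.span K (Set.range f)) →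
      X (k + 1) ∈ Submodule.span K (Set.range f)) :
    Submodule.span K (Set.range f) = Submodule.span K (Set.range X) := by
  apply le_antisymm
  · rw [Submodule.span_le]
    rintro _ ⟨k, rfl⟩
    exact hf k
  · rw [Submodule.span_le]
    rintro _ ⟨k, rfl⟩
    induction k using Nat.strong_induction_on with
    | _ k ih =>
      rcases k with - | k
      · rw [h0]; exact Submodule.zero_mem _
      · by_cases hk : k < m + 1
        · exact hX ⟨k, hk⟩ fun j hj => ih j (by simp at hj; omega)
        · rw [hm _ (by omega)]; exact Submodule.zero_mem _

/-- Multiplication by the coordinates. -/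
def mulCoord (c : ZMod n → K) : (ZMod n → K) →ₗ[K] (ZMod n → K) where
  toFun v i := c i * v i
  map_add' u v := by funext i; simp only [Pi.add_apply]; ring
  map_smul' t v := by
    funext i; simp only [Pi.smul_apply, smul_eq_mul, RingHom.id_apply]; ring

theorem hamiltonian_eq_mulCoord (β : K) (f : (ZMod n → K) → K) (c : ZMod n → K) :
    hamiltonian (poisson β) f c = mulCoord c (logHam β c (euler f c)) :=
  funext fun i => hamiltonian_poisson β f c i

/-- The Hamiltonian vectors of the Lenard chain. -/
def chainVec (k : ℕ) (c : ZMod n → K) : ZMod n → K := mulCoord c (shiftDiff (lenardVec k c))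

theorem chainVec_zero (c : ZMod n → K) : chainVec 0 c = 0 := by
  rw [chainVec, shiftDiff_lenardVec_zero, map_zero]

theorem chainVec_eq_zero {k : ℕ} (hk : n < 2 * k) (c : ZMod n → K) : chainVec k c = 0 := by
  rw [chainVec, shiftDiff_lenardVec_eq_zero hk, map_zero]

theorem mulCoord_logHam_lenardVec (β : K) (k : ℕ) (c : ZMod n → K) :
    mulCoord c (logHam β c (lenardVec k c)) = -chainVec (k + 1) c - β • chainVec k c := by
  rw [logHam_lenardVec, map_sub, map_neg, map_smul]; rfl

theorem hamiltonian_prodAll (β : K) (c : ZMod n → K) :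
    hamiltonian (poisson β) prodAll c = prodAll c • chainVec 1 c := by
  have e : euler prodAll c = -prodAll c • lenardVec 0 c := by
    funext j
    rw [euler_prodAll, lenardVec_zero]
    simp
  rw [hamiltonian_eq_mulCoord, e, map_smul, map_smul, mulCoord_logHam_lenardVec, chainVec_zero]
  simp

/-- Twice the logarithmic gradient of F_k is v_k - F_k v_0. The coefficient F_k(c) depends on the
point, so this gives equality of spans only pointwise. -/
theorem hamiltonian_F (β : K) (k : ℕ) (c : ZMod n → K) :
    (2 : K) • hamiltonian (poisson β) (F k) c =
      F k c • chainVec 1 c - chainVec (k + 1) c - β • chainVec k c := by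
  have e : (2 : K) • euler (F k) c = lenardVec k c - F k c • lenardVec 0 c := by
    funext j
    simp only [euler_F, lenardVec_zero, Pi.smul_apply, Pi.sub_apply, smul_eq_mul, lenardVec,
      F_eq_sumSparse]
    ring
  rw [hamiltonian_eq_mulCoord, ← map_smul, ← map_smul, e, map_sub, map_sub, map_smul, map_smul,
    mulCoord_logHam_lenardVec, mulCoord_logHam_lenardVec, chainVec_zero]
  simp only [zero_add, smul_zero, sub_zero, smul_neg]
  abel

theorem span_hamiltonian_integrals (β : K) {c : ZMod n → K} (hc : c ∈ torus K n) :
    Submodule.span K (Set.range fun k => hamiltonian (poisson β) (integrals K n k) c) =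
      Submodule.span K (Set.range fun k => chainVec k c) := by
  have hX : ∀ k, chainVec k c ∈ Submodule.span K (Set.range fun k => chainVec k c) := fun k =>
    Submodule.subset_span ⟨k, rfl⟩
  have h2 : (2 : K) ≠ 0 := two_ne_zero
  refine span_range_eq (chainVec_zero c) (fun k hk => chainVec_eq_zero (by omega) c) ?_ ?_
  · intro k
    refine Fin.cases ?_ (fun k => ?_) k
    · simp only [integrals, Fin.cons_zero, hamiltonian_prodAll]
      exact Submodule.smul_mem _ _ (hX 1)
    · simp only [integrals, Fin.cons_succ]
      rw [← Submodule.smul_mem_iff _ h2, hamiltonian_F]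
      exact Submodule.sub_mem _ (Submodule.sub_mem _ (Submodule.smul_mem _ _ (hX _)) (hX _))
        (Submodule.smul_mem _ _ (hX _))
  · intro k
    have hf : ∀ k, hamiltonian (poisson β) (integrals K n k) c ∈ Submodule.span K
      (Set.range fun k => hamiltonian (poisson β) (integrals K n k) c) := fun k =>
      Submodule.subset_span ⟨k, rfl⟩
    have h1 : chainVec 1 c ∈ Submodule.span K
        (Set.range fun k => hamiltonian (poisson β) (integrals K n k) c) := by
      have := hf 0
      simp only [integrals, Fin.cons_zero, hamiltonian_prodAll] at this
      rwa [Submodule.smul_mem_iff _ (prodAll_ne_zero hc)] at this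
    refine Fin.cases ?_ (fun k => ?_) k
    · exact fun _ => by simpa using h1
    · intro hj
      have h3 := Submodule.smul_mem _ (2 : K) (hf k.succ)
      have h4 := hj (k + 1) (by simp)
      simp only [integrals, Fin.cons_succ] at h3
      rw [hamiltonian_F] at h3
      have h5 := Submodule.sub_mem _ (Submodule.sub_mem _ (Submodule.smul_mem _
        (F (k + 1) c) h1) h3) (Submodule.smul_mem _ β h4)
      simp only [Fin.val_succ]
      convert h5 using 1
      abel

/-- Differentiating s^2 = ε c_{[n]} shows that every logarithmic derivative of s is s / 2. -/
theorem euler_div_sqrt {U : Set (ZMod n → K)} (hU : IsOpen U) (hUt : U ⊆ torus K n)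
    {s : (ZMod n → K) → K} (hs : DifferentiableOn K s U) {ε : K} (hε : ε ≠ 0)
    (h : ∀ c ∈ U, s c ^ 2 = ε * prodAll c) (k : ℕ) {c : ZMod n → K} (hc : c ∈ U) :
    euler (fun x => F k x / s x) c = (1 / (2 * s c)) • lenardVec k c := by
  have hp := prodAll_ne_zero (hUt hc)
  have hsc : s c ≠ 0 := fun h0 => by
    have := h c hc
    rw [h0] at this
    exact mul_ne_zero hε hp (by rw [← this]; ring)
  have hd : DifferentiableAt K s c := (hs c hc).differentiableAt (hU.mem_nhds hc)
  have hE : ∀ j, euler s c j = s c / 2 := by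
    intro j
    have h1 := euler_mul hd hd j
    have h2 : euler (fun x => s x * s x) c = euler (fun x => ε * prodAll x) c := by
      refine euler_congr ?_
      filter_upwards [hU.mem_nhds hc] with x hx
      rw [← h x hx, sq]
    have h3 := euler_mul (differentiableAt_const (𝕜 := K) (x := c) ε) (differentiable_prodAll c) j
    have h4 : euler (fun _ : ZMod n → K => ε) c j = 0 := by simp [euler, pd]
    rw [h2, h3, h4, euler_prodAll, zero_mul, zero_add, ← h c hc] at h1
    have : s c * (s c - 2 * euler s c j) = 0 := by linear_combination h1
    have := (mul_eq_zero.1 this).resolve_left hsc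
    linear_combination -this / 2
  funext j
  have hq : DifferentiableAt K (fun x => F k x / s x) c := by
    have := differentiable_F k c
    fun_prop (disch := exact hsc)
  have h1 := euler_mul hq hd j
  have h2 : euler (fun x => F k x / s x * s x) c = euler (F k) c := by
    refine euler_congr ?_
    filter_upwards [hd.continuousAt.eventually_ne hsc] with x hx
    rw [div_mul_cancel₀ _ hx]
  rw [h2, euler_F, hE] at h1
  simp only [Pi.smul_apply, smul_eq_mul, lenardVec, ← F_eq_sumSparse]
  field_simp at h1 ⊢
  linear_combination -h1

/-- After division by s the Hamiltonian fields are -X_{k+1} - βX_k with constant coefficients, so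
the triangular argument works over the constants. The spanning fields on the right do not involve β.
-/
theorem span_hamiltonian_div_sqrt {U : Set (ZMod n → K)} (hU : IsOpen U) (hUt : U ⊆ torus K n)
    {s : (ZMod n → K) → K} (hs : DifferentiableOn K s U) {ε : K} (hε : ε ≠ 0)
    (h : ∀ c ∈ U, s c ^ 2 = ε * prodAll c) (β : K) :
    Submodule.span K (Set.range fun (k : Fin (n / 2 + 1)) (c : U) =>
        hamiltonian (poisson β) (fun x => F k x / s x) c) =
      Submodule.span K (Set.range fun (k : ℕ) (c : U) => (1 / (2 * s c)) • chainVec k c.1) := by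
  set X : ℕ → U → ZMod n → K := fun k c => (1 / (2 * s c)) • chainVec k c.1
  have hX : ∀ k, X k ∈ Submodule.span K (Set.range X) := fun k => Submodule.subset_span ⟨k, rfl⟩
  have e : ∀ k : ℕ, (fun c : U => hamiltonian (poisson β) (fun x => F k x / s x) c.1) =
      -X (k + 1) - β • X k := by
    intro k
    funext c
    rw [hamiltonian_eq_mulCoord, euler_div_sqrt hU hUt hs hε h k c.2, map_smul, map_smul,
      mulCoord_logHam_lenardVec, Pi.sub_apply, Pi.neg_apply, Pi.smul_apply]
    simp only [X, smul_sub, smul_neg]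
    rw [smul_comm]
  refine span_range_eq ?_ (fun k hk => ?_) (fun k => ?_) (fun k hk => ?_)
  · funext c
    simp [X, chainVec_zero]
  · funext c
    simp [X, chainVec_eq_zero (show n < 2 * k by omega)]
  · rw [e]
    exact Submodule.sub_mem _ (Submodule.neg_mem _ (hX _)) (Submodule.smul_mem _ _ (hX _))
  · have h1 : (fun c : U => hamiltonian (poisson β) (fun x => F k x / s x) c.1) ∈
        Submodule.span K (Set.range fun (k : Fin (n / 2 + 1)) (c : U) =>
          hamiltonian (poisson β) (fun x => F k x / s x) c) := Submodule.subset_span ⟨k, rfl⟩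
    have h2 := hk k le_rfl
    rw [e] at h1
    have h3 := Submodule.neg_mem _ (Submodule.add_mem _ h1 (Submodule.smul_mem _ β h2))
    convert h3 using 1
    abel

end Spans

/-! ### The Jacobi identity -/

section Jacobi

variable {K : Type*} [RCLike K] {n : ℕ} [NeZero n]

theorem sum_mul_logHam (β : K) (c u v : ZMod n → K) :
    ∑ i, u i * logHam β c v i = -∑ i, v i * logHam β c u i := by
  have h1 := sum_mul_quadPart c u v
  have h2 := sum_mul_shiftDiff u v
  simp only [logHam_apply, mul_sub, Finset.sum_sub_distrib]
  have e : ∀ u v : ZMod n → K, ∑ i, u i * (β * shiftDiff v i) = β * ∑ i, u i * shiftDiff v i :=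
    fun u v => by rw [Finset.mul_sum]; exact Finset.sum_congr rfl fun i _ => by ring
  rw [e, e, h1, h2]
  ring

theorem sum_single_mul (v : ZMod n → K) (i : ZMod n) :
    ∑ a, (Pi.single i 1 : ZMod n → K) a * v a = v i := by
  simp [Pi.single_apply]

theorem logHam_single_skew (β : K) (c : ZMod n → K) (i j : ZMod n) :
    logHam β c (Pi.single j 1) i = -logHam β c (Pi.single i 1) j := by
  rw [← sum_single_mul (logHam β c (Pi.single j 1)), sum_mul_logHam, sum_single_mul]

theorem poisson_eq_logHam (β : K) (c : ZMod n → K) (i j : ZMod n) :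
    poisson β c i j = c i * c j * logHam β c (Pi.single j 1) i := by
  have h := sum_poisson_mul β c (Pi.single j 1) i
  simp only [Pi.single_apply, mul_ite, mul_one, mul_zero, Finset.sum_ite_eq', Finset.mem_univ,
    if_true] at h
  rw [h]
  have : (fun k => if k = j then c k else 0) = c j • (Pi.single j 1 : ZMod n → K) := by
    funext k
    by_cases hk : k = j <;> simp [hk]
  rw [this, map_smul, Pi.smul_apply, smul_eq_mul, mul_assoc]

/-- The minor of `(v, w)` with the columns `a` and `b`. -/
def minor (v w : ZMod n → K) (a b : ZMod n) : K := v a * w b - v b * w a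

/-- In this form the pairing is visibly skew in v, w and affine in c, so its gradient can be read
off. -/
theorem sum_mul_logHam_eq_sum_minor (β : K) (c v w : ZMod n → K) :
    ∑ a, v a * logHam β c w a =
      ∑ a, ((c a + c (a + 1) - β) * minor v w a (a + 1) + c (a + 1) * minor v w a (a + 2)) := by
  have h1 := sum_shift (fun i => v i * ((c (i - 1) + c i - β) * w (i - 1))) 1
  have h2 := sum_shift (fun i => v i * (c (i - 1) * w (i - 2))) 2
  have h3 : ∀ i : ZMod n, i + 2 - 1 = i + 1 := fun i => by ring
  simp only [add_sub_cancel_right, h3] at h1 h2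
  have e : ∀ a, v a * logHam β c w a = v a * ((c a + c (a + 1) - β) * w (a + 1)) +
      v a * (c (a + 1) * w (a + 2)) - v a * ((c (a - 1) + c a - β) * w (a - 1)) -
      v a * (c (a - 1) * w (a - 2)) := fun a => by
    simp only [logHam_apply, quadPart, shiftDiff]; ring
  simp only [e, Finset.sum_sub_distrib, Finset.sum_add_distrib]
  rw [← h1, ← h2, ← Finset.sum_add_distrib, ← Finset.sum_sub_distrib, ← Finset.sum_sub_distrib,
    ← Finset.sum_add_distrib]
  refine Finset.sum_congr rfl fun a _ => ?_
  simp only [minor]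
  ring

/-- The logarithmic gradient of `c ↦ {v, w}`. -/
def formGrad (c v w : ZMod n → K) (l : ZMod n) : K :=
  c l * (minor v w l (l + 1) + minor v w (l - 1) l + minor v w (l - 1) (l + 1))

theorem hasFDerivAt_form (β : K) (c v w : ZMod n → K) :
    HasFDerivAt (fun x : ZMod n → K => ∑ a, v a * logHam β x w a)
      (∑ a, (minor v w a (a + 1) • (ContinuousLinearMap.proj (R := K) (φ := fun _ => K) a +
        ContinuousLinearMap.proj (R := K) (φ := fun _ => K) (a + 1)) +
        minor v w a (a + 2) • ContinuousLinearMap.proj (R := K) (φ := fun _ => K) (a + 1))) c := by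
  simp only [sum_mul_logHam_eq_sum_minor]
  exact HasFDerivAt.fun_sum fun a _ =>
    ((((hasFDerivAt_apply a c).add (hasFDerivAt_apply (a + 1) c)).sub_const β).mul_const _).add
      ((hasFDerivAt_apply (a + 1) c).mul_const _)

theorem euler_form (β : K) (c v w : ZMod n → K) :
    euler (fun x => ∑ a, v a * logHam β x w a) c = formGrad c v w := by
  funext l
  unfold euler pd
  rw [(hasFDerivAt_form β c v w).fderiv]
  have e : ∀ a : ZMod n, a + 1 = l ↔ a = l - 1 := fun a =>
    ⟨fun h => by rw [← h]; ring, fun h => by rw [h]; ring⟩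
  simp only [sum_apply, add_apply, smul_apply, ContinuousLinearMap.proj_apply, smul_eq_mul,
    Pi.single_apply, e, mul_add, mul_ite, mul_one, mul_zero, Finset.sum_add_distrib,
    Finset.sum_ite_eq', Finset.mem_univ, if_true, formGrad]
  rw [show l - 1 + 1 = l by ring, show l - 1 + 2 = l + 1 by ring]

theorem sum_formGrad_mul_logHam (β : K) (c u v w : ZMod n → K) :
    ∑ a, (formGrad c v w a * logHam β c u a + formGrad c w u a * logHam β c v a +
      formGrad c u v a * logHam β c w a) = 0 := by
  let m : ZMod n → ZMod n → ZMod n → K := fun a b d =>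
    u a * minor v w b d + v a * minor w u b d + w a * minor u v b d
  -- Here m is the determinant with rows u, v, w and columns a, b, d. The cyclic sum at a is S_a -
  -- S_{a-1}, and the terms with β cancel already at each a.
  let S : ZMod n → K := fun a => c a * c (a + 1) *
    (m (a - 1) a (a + 1) + m a (a + 1) (a + 2) + m (a - 1) a (a + 2) + m (a - 1) (a + 1) (a + 2))
  have key : ∀ a, formGrad c v w a * logHam β c u a + formGrad c w u a * logHam β c v a +
      formGrad c u v a * logHam β c w a = S (a - 1 + 1) - S (a - 1) := by
    intro a
    simp only [S, m, formGrad, logHam_apply, quadPart, shiftDiff, minor]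
    rw [show a - 1 + 1 = a by ring, show a - 1 + 2 = a + 1 by ring, show a - 1 - 1 = a - 2 by ring]
    ring
  simp only [key, Finset.sum_sub_distrib]
  have h1 := sum_shift S (-1)
  have h2 := sum_shift (fun a => S (a + 1)) (-1)
  have h3 := sum_shift S 1
  simp only [← sub_eq_add_neg] at h1 h2
  rw [h1, h2, h3, sub_self]

theorem euler_poisson_entry (β : K) (c : ZMod n → K) (j k : ZMod n) :
    euler (fun x => poisson β x j k) c = (c j * c k) •
      (logHam β c (Pi.single k 1) j • (Pi.single j 1 + Pi.single k 1 : ZMod n → K) +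
        formGrad c (Pi.single j 1) (Pi.single k 1)) := by
  have h1 : ∀ x : ZMod n → K, poisson β x j k = x j * x k *
      ∑ a, (Pi.single j 1 : ZMod n → K) a * logHam β x (Pi.single k 1) a := fun x => by
    rw [poisson_eq_logHam, sum_single_mul]
  have hc : ∀ i l, euler (fun x : ZMod n → K => x i) c l =
      c i * (Pi.single i 1 : ZMod n → K) l := by
    intro i l
    unfold euler pd
    rw [(hasFDerivAt_apply i c).fderiv, ContinuousLinearMap.proj_apply]
    by_cases h : i = l
    · simp [h]
    · simp [h, Ne.symm h]
  funext l
  simp only [h1]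
  rw [euler_mul (by fun_prop) (hasFDerivAt_form β c _ _).differentiableAt, euler_form,
    euler_mul (by fun_prop) (by fun_prop), hc, hc, sum_single_mul]
  simp only [Pi.smul_apply, Pi.add_apply, smul_eq_mul]
  ring

theorem isPoisson_poisson (β : K) : IsPoisson (poisson (n := n) β) where
  skew c _ i j := poisson_skew β c i j
  jacobi c _ i j k := by
    -- The products of two `logHam` entries come from differentiating the prefactor c_j c_k and
    -- cancel cyclically by skew-symmetry; the `formGrad` terms are handled by
    -- `sum_formGrad_mul_logHam`.
    have h : ∀ i j k, ∑ l, poisson β c i l * pd l (fun x => poisson β x j k) c =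
        c i * c j * c k * (logHam β c (Pi.single k 1) j * (logHam β c (Pi.single j 1) i +
          logHam β c (Pi.single k 1) i) -
          ∑ a, formGrad c (Pi.single j 1) (Pi.single k 1) a * logHam β c (Pi.single i 1) a) := by
      intro i j k
      rw [sum_poisson_mul β c (fun l => pd l (fun x => poisson β x j k) c) i]
      change c i * logHam β c (euler (fun x => poisson β x j k) c) i = _
      rw [euler_poisson_entry, map_smul, map_add, map_smul, map_add,
        sub_eq_add_neg, ← sum_mul_logHam, sum_single_mul]
      simp only [Pi.smul_apply, Pi.add_apply, smul_eq_mul]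
      ring
    have h0 := sum_formGrad_mul_logHam β c (Pi.single i 1) (Pi.single j 1) (Pi.single k 1)
    simp only [Finset.sum_add_distrib] at h0 ⊢
    rw [h, h, h, logHam_single_skew β c i k, logHam_single_skew β c j i,
      logHam_single_skew β c k j]
    linear_combination (-(c i * c j * c k)) * h0

end Jacobi

/-! ### Generic properties from one point -/

section Generic

variable {K : Type*} [RCLike K] {n : ℕ}

theorem Generically.mono {p q : (ZMod n → K) → Prop} (h : Generically p)
    (hpq : ∀ c ∈ torus K n, p c → q c) : Generically q := by
  obtain ⟨g, hg, h⟩ := h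
  exact ⟨g, hg, fun c hc hgc => hpq c hc (h c hc hgc)⟩

theorem Generically.and {p q : (ZMod n → K) → Prop} (hp : Generically p) (hq : Generically q) :
    Generically fun c => p c ∧ q c := by
  obtain ⟨g, hg, h⟩ := hp
  obtain ⟨g', hg', h'⟩ := hq
  refine ⟨g * g', mul_ne_zero hg hg', fun c hc hgc => ?_⟩
  rw [map_mul] at hgc
  exact ⟨h c hc (left_ne_zero_of_mul hgc), h' c hc (right_ne_zero_of_mul hgc)⟩

theorem Generically.forall {ι : Type*} [Fintype ι] {p : ι → (ZMod n → K) → Prop}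
    (h : ∀ i, Generically (p i)) : Generically fun c => ∀ i, p i c := by
  choose g hg h using h
  refine ⟨∏ i, g i, Finset.prod_ne_zero_iff.2 fun i _ => hg i, fun c hc hgc i => h i c hc ?_⟩
  rw [map_prod] at hgc
  exact Finset.prod_ne_zero_iff.1 hgc i (Finset.mem_univ i)

theorem generically_eval_ne_zero {g : MvPolynomial (ZMod n) K} {c : ZMod n → K}
    (h : MvPolynomial.eval c g ≠ 0) : Generically fun c => MvPolynomial.eval c g ≠ 0 :=
  ⟨g, fun h0 => h (by rw [h0, map_zero]), fun _ _ h => h⟩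

/-- Vectors with polynomial entries that are independent at one point are generically
independent. -/
theorem generically_linearIndependent [NeZero n] {ι : Type*} [Fintype ι] [DecidableEq ι]
    (M : ι → ZMod n → MvPolynomial (ZMod n) K) (c : ZMod n → K)
    (h : LinearIndependent K fun k j => MvPolynomial.eval c (M k j)) :
    Generically fun c => LinearIndependent K fun k j => MvPolynomial.eval c (M k j) := by
  obtain ⟨g, hg⟩ := LinearMap.exists_leftInverse_of_injective
    (Fintype.linearCombination K fun k j => MvPolynomial.eval c (M k j))
    (LinearMap.ker_eq_bot.2 (linearIndependent_iff_injective_fintypeLinearCombination.1 h))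
  -- A left inverse at the given point, frozen and applied at all points, yields a square polynomial
  -- matrix that is the identity at that point. This replaces the choice of a minor.
  let D : Matrix ι ι (MvPolynomial (ZMod n) K) := fun k l =>
    ∑ j, M k j * MvPolynomial.C (g (Pi.single j 1) l)
  have hD : ∀ c : ZMod n → K, MvPolynomial.eval c D.det =
      Matrix.det fun k l => g (fun j => MvPolynomial.eval c (M k j)) l := by
    intro c
    rw [RingHom.map_det]
    congr 1
    ext k l
    change MvPolynomial.eval c (D k l) = _
    simp only [D, map_sum, map_mul, MvPolynomial.eval_C]
    conv_rhs => rw [pi_eq_sum_univ' (fun j => MvPolynomial.eval c (M k j)), map_sum]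
    simp only [Finset.sum_apply]
    refine Finset.sum_congr rfl fun j _ => ?_
    rw [map_smul, Pi.smul_apply, smul_eq_mul]
  have h1 : MvPolynomial.eval c D.det ≠ 0 := by
    rw [hD]
    have : (fun k l => g (fun j => MvPolynomial.eval c (M k j)) l) = (1 : Matrix ι ι K) := by
      ext k l
      have := LinearMap.congr_fun hg (Pi.single k 1)
      simp only [LinearMap.comp_apply, Fintype.linearCombination_apply_single, one_smul,
        LinearMap.id_apply] at this
      rw [this, Matrix.one_apply, Pi.single_apply]
      simp [eq_comm]
    rw [this, Matrix.det_one]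
    exact one_ne_zero
  refine (generically_eval_ne_zero h1).mono fun c _ hc => ?_
  rw [hD] at hc
  exact LinearIndependent.of_comp g (Matrix.linearIndependent_rows_of_det_ne_zero hc)

end Generic

/-! ### Independence of the integrals -/

section Base

variable {K : Type*} [RCLike K] {n : ℕ} [NeZero n]

theorem map_sumSparse {R S : Type*} [CommRing R] [CommRing S] (φ : R →+* S) (k : ℕ)
    (c : ZMod n → R) : φ (sumSparse k c) = sumSparse k fun i => φ (c i) := by
  simp only [sumSparse, map_sum, map_prod]

theorem map_sumWith {R S : Type*} [CommRing R] [CommRing S] (φ : R →+* S) (k : ℕ)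
    (c : ZMod n → R) (j : ZMod n) : φ (sumWith k c j) = sumWith k (fun i => φ (c i)) j := by
  simp only [sumWith, map_sum, apply_ite φ, map_prod, map_zero]

theorem eval_sumSparse_X (k : ℕ) (c : ZMod n → K) :
    MvPolynomial.eval c (sumSparse k MvPolynomial.X) = F k c := by
  rw [map_sumSparse]
  simp only [MvPolynomial.eval_X]
  rfl

theorem eval_sumWith_X (k : ℕ) (c : ZMod n → K) (j : ZMod n) :
    MvPolynomial.eval c (sumWith k MvPolynomial.X j) = sumWith k c j := by
  rw [map_sumWith]
  simp only [MvPolynomial.eval_X]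

theorem sumWith_of_eq_zero {c : ZMod n → K} {j : ZMod n} (h : c j = 0) (k : ℕ) :
    sumWith k c j = 0 := by
  refine Finset.sum_eq_zero fun I _ => ?_
  split_ifs with hj
  · exact Finset.prod_eq_zero hj h
  · rfl

theorem sumWith_smul (k : ℕ) (t : K) (c : ZMod n → K) (j : ZMod n) :
    sumWith k (fun i => t * c i) j = t ^ k * sumWith k c j := by
  unfold sumWith
  rw [Finset.mul_sum]
  refine Finset.sum_congr rfl fun I hI => ?_
  rw [Finset.prod_mul_distrib, Finset.prod_const, (mem_sparseSets.1 hI).1, mul_ite, mul_zero]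

/-- The generating function of `sumWith` for coordinates supported on a set without
consecutive elements. -/
theorem sum_sumWith_of_support {c : ZMod n → K} {S : Finset (ZMod n)} (hS : ∀ i ∈ S, i + 1 ∉ S)
    (hc : ∀ i ∉ S, c i = 0) (j : ZMod n) (hj : j ∈ S) :
    ∑ k ∈ Finset.range (n + 1), sumWith k c j = ∏ i ∈ S, (c i + if i = j then 0 else 1) := by
  classical
  have h1 : ∑ k ∈ Finset.range (n + 1), sumWith k c j =
      ∑ I : Finset (ZMod n), if (∀ i ∈ I, i + 1 ∉ I) ∧ j ∈ I then ∏ i ∈ I, c i else 0 := by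
    rw [← Finset.sum_fiberwise_of_maps_to (g := Finset.card) (t := Finset.range (n + 1))]
    · refine Finset.sum_congr rfl fun k _ => ?_
      rw [sumWith, ← Finset.sum_filter, ← Finset.sum_filter, Finset.filter_filter]
      refine Finset.sum_congr ?_ fun _ _ => rfl
      ext I
      simp [mem_sparseSets]
      tauto
    · intro I _
      have := Finset.card_le_univ I
      rw [ZMod.card] at this
      simp; omega
  rw [h1, Finset.prod_add, ← Finset.sum_subset (Finset.subset_univ S.powerset)]
  · refine Finset.sum_congr rfl fun I hI => ?_
    rw [Finset.mem_powerset] at hI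
    by_cases hjI : j ∈ I
    · rw [if_pos ⟨fun i hi hi' => hS i (hI hi) (hI hi'), hjI⟩]
      have : ∏ i ∈ S \ I, (if i = j then 0 else 1 : K) = 1 := by
        refine Finset.prod_eq_one fun i hi => if_neg ?_
        rintro rfl
        exact (Finset.mem_sdiff.1 hi).2 hjI
      rw [this, mul_one]
    · have : ∏ i ∈ S \ I, (if i = j then 0 else 1 : K) = 0 :=
        Finset.prod_eq_zero (Finset.mem_sdiff.2 ⟨hj, hjI⟩) (if_pos rfl)
      rw [if_neg (fun h => hjI h.2), this, mul_zero]
  · intro I _ hI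
    rw [Finset.mem_powerset] at hI
    obtain ⟨i, hi, hiS⟩ := Finset.not_subset.1 hI
    split_ifs
    · exact Finset.prod_eq_zero hi (hc i hiS)
    · rfl

/-- A point at which the logarithmic gradients of the integrals are independent. -/
def basePoint (K : Type*) [RCLike K] (n : ℕ) (j : ZMod n) : K :=
  if Even j.val ∧ j.val < 2 * (n / 2) then (j.val : K) + 1 else 0

theorem val_add_one {i : ZMod n} (h : i.val + 1 < n) : (i + 1).val = i.val + 1 := by
  have : i + 1 = ((i.val + 1 : ℕ) : ZMod n) := by
    push_cast
    rw [ZMod.natCast_zmod_val]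
  rw [this, ZMod.val_natCast_of_lt h]

theorem val_natCast_two_mul (a : Fin (n / 2)) : ((2 * a : ℕ) : ZMod n).val = 2 * a := by
  apply ZMod.val_natCast_of_lt
  have := a.2
  omega

/-- All subsets of the support are sparse, so the generating function over k factors as a product
over the support. Evaluated at the negative inverse of one of the distinct non-zero values, the
entry for a different support index vanishes, so a suitable product of matrices is diagonal and
invertible. -/
theorem linearIndependent_sumWith_basePoint :
    LinearIndependent K fun k : Fin (n / 2) => sumWith (k + 1) (basePoint K n) := by
  classical
  let S : Finset (ZMod n) := Finset.univ.filter fun j => Even j.val ∧ j.val < 2 * (n / 2)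
  have hmem : ∀ j, j ∈ S ↔ Even j.val ∧ j.val < 2 * (n / 2) := fun j => by simp [S]
  have hS : ∀ i ∈ S, i + 1 ∉ S := by
    intro i hi hi'
    rw [hmem] at hi hi'
    obtain ⟨⟨r, hr⟩, h2⟩ := hi
    have e : (i + 1).val = i.val + 1 := val_add_one (by omega)
    rw [e] at hi'
    obtain ⟨⟨s, hs⟩, -⟩ := hi'
    omega
  let t : ZMod n → K := fun j => (j.val : K) + 1
  have ht : ∀ j, t j ≠ 0 := fun j => Nat.cast_add_one_ne_zero _
  have htinj : Function.Injective t := fun i j h => by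
    have : (i.val : K) = j.val := add_right_cancel h
    exact ZMod.val_injective n (Nat.cast_injective this)
  have hcS : ∀ i ∈ S, basePoint K n i = t i := fun i hi => if_pos ((hmem i).1 hi)
  have hcS' : ∀ i ∉ S, basePoint K n i = 0 := fun i hi => if_neg fun h => hi ((hmem i).2 h)
  let p : Fin (n / 2) → ZMod n := fun a => ((2 * a : ℕ) : ZMod n)
  have hpS : ∀ a, p a ∈ S := fun a => by
    rw [hmem, val_natCast_two_mul]
    exact ⟨even_two_mul _, by omega⟩
  have hpinj : Function.Injective p := fun a b h => by
    have := congrArg ZMod.val h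
    rw [val_natCast_two_mul, val_natCast_two_mul] at this
    exact Fin.ext (by omega)
  let E : Matrix (Fin (n / 2)) (Fin (n / 2)) K := fun k a => sumWith (k + 1) (basePoint K n) (p a)
  -- The row b evaluates the generating function at -1/t_b, which kills the factor of index b unless
  -- the column has the same index.
  let V : Matrix (Fin (n / 2)) (Fin (n / 2)) K := fun b k => (-(t (p b))⁻¹) ^ ((k : ℕ) + 1)
  have hVE : ∀ b a, (V * E) b a = ∏ i ∈ S, (-(t (p b))⁻¹ * t i + if i = p a then 0 else 1) := by
    intro b a
    have h1 := sum_sumWith_of_support (c := fun i => -(t (p b))⁻¹ * basePoint K n i) hS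
      (fun i hi => by rw [hcS' i hi, mul_zero]) (p a) (hpS a)
    rw [Finset.prod_congr rfl fun i hi => by rw [hcS i hi]] at h1
    rw [← h1, ← sum_half_range fun k hk => sumWith_eq_zero hk _ _, Finset.sum_range_succ',
      sumWith_zero, add_zero, Matrix.mul_apply, ← Fin.sum_univ_eq_sum_range
        (fun k => sumWith (k + 1) (fun i => -(t (p b))⁻¹ * basePoint K n i) (p a))]
    refine Finset.sum_congr rfl fun k _ => ?_
    rw [sumWith_smul]
  have hdiag : V * E = Matrix.diagonal fun a => (V * E) a a := by
    ext b a
    by_cases h : b = a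
    · rw [h, Matrix.diagonal_apply_eq]
    · rw [Matrix.diagonal_apply_ne _ h, hVE]
      refine Finset.prod_eq_zero (hpS b) ?_
      rw [if_neg (fun h' => h (hpinj h')), neg_mul, inv_mul_cancel₀ (ht _)]
      ring
  have hdet : (V * E).det ≠ 0 := by
    rw [hdiag, Matrix.det_diagonal]
    refine Finset.prod_ne_zero_iff.2 fun a _ => ?_
    rw [hVE]
    refine Finset.prod_ne_zero_iff.2 fun i _ => ?_
    split_ifs with h
    · rw [add_zero]
      exact mul_ne_zero (neg_ne_zero.2 (inv_ne_zero (ht _))) (ht _)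
    · intro h0
      apply h
      apply htinj
      have := ht (p a)
      field_simp at h0
      linear_combination -h0
  rw [Matrix.det_mul] at hdet
  exact LinearIndependent.of_comp (LinearMap.funLeft K K p)
    (Matrix.linearIndependent_rows_of_det_ne_zero (right_ne_zero_of_mul hdet))

theorem _root_.LinearIndependent.congr_apply {V ι : Type*} [AddCommGroup V] [Module K V]
    {v w : ι → V} (h : LinearIndependent K v) (e : ∀ i, v i = w i) : LinearIndependent K w :=
  funext e ▸ h

theorem cons_linearIndependent {V : Type*} [AddCommGroup V] [Module K V] {m : ℕ} {v : V}
    {w : Fin m → V} (h : LinearIndependent K (Fin.cons v w : Fin (m + 1) → V)) {b : K} (hb : b ≠ 0)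
    {a : Fin m → K} (ha : ∀ k, a k ≠ 0) (t : Fin m → K) :
    LinearIndependent K (Fin.cons (b • v) fun k => a k • w k + t k • v : Fin (m + 1) → V) := by
  rw [Fintype.linearIndependent_iff] at h ⊢
  intro g hg
  have h1 := h (Fin.cons (g 0 * b + ∑ k : Fin m, g k.succ * t k) fun k => g k.succ * a k) (by
    rw [Fin.sum_univ_succ] at hg ⊢
    simp only [Fin.cons_zero, Fin.cons_succ] at hg ⊢
    rw [← hg, add_smul, Finset.sum_smul]
    simp only [smul_add, Finset.sum_add_distrib, smul_smul]
    abel)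
  have h2 : ∀ k : Fin m, g k.succ = 0 := fun k => by
    have := h1 k.succ
    rw [Fin.cons_succ] at this
    exact (mul_eq_zero.1 this).resolve_right (ha k)
  have h3 := h1 0
  rw [Fin.cons_zero] at h3
  simp only [h2, zero_mul, Finset.sum_const_zero, add_zero, mul_eq_zero, hb, or_false] at h3
  exact fun i => Fin.cases h3 h2 i

theorem generically_linearIndependent_sumWith :
    Generically fun c : ZMod n → K => LinearIndependent K
      (Fin.cons (fun _ => 1) fun k : Fin (n / 2) => sumWith (k + 1) c :
        Fin (n / 2 + 1) → ZMod n → K) := by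
  let M : Fin (n / 2 + 1) → ZMod n → MvPolynomial (ZMod n) K :=
    Fin.cons (fun _ => 1) fun k : Fin (n / 2) => sumWith (k + 1) MvPolynomial.X
  have hM : ∀ c : ZMod n → K, (fun k j => MvPolynomial.eval c (M k j)) =
      (Fin.cons (fun _ => 1) fun k : Fin (n / 2) => sumWith (k + 1) c :
        Fin (n / 2 + 1) → ZMod n → K) := by
    intro c
    funext k j
    refine Fin.cases ?_ (fun k => ?_) k
    · simp [M]
    · simp [M, eval_sumWith_X]
  have := generically_linearIndependent M (basePoint K n) (by
    rw [hM, linearIndependent_finCons]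
    refine ⟨linearIndependent_sumWith_basePoint, fun h => ?_⟩
    -- The index n - 1 is odd for even n and equals 2⌊n/2⌋ for odd n, so it lies off the support.
    -- All `sumWith` vectors vanish there, unlike the constant vector.
    have hlast : basePoint K n (((n - 1 : ℕ)) : ZMod n) = 0 := by
      have hn := NeZero.pos n
      rw [basePoint, ZMod.val_natCast_of_lt (by omega), if_neg]
      rintro ⟨⟨r, hr⟩, h2⟩
      omega
    have hle : Submodule.span K (Set.range fun k : Fin (n / 2) =>
        sumWith (k + 1) (basePoint K n)) ≤
        LinearMap.ker (LinearMap.proj (R := K) (φ := fun _ => K) (((n - 1 : ℕ)) : ZMod n)) := by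
      rw [Submodule.span_le]
      rintro _ ⟨k, rfl⟩
      exact sumWith_of_eq_zero hlast _
    have := hle h
    simp at this)
  simpa only [hM] using this

theorem generically_linearIndependent_lenardVec :
    Generically fun c : ZMod n → K => LinearIndependent K
      (Fin.cons (lenardVec 0 c) fun k : Fin (n / 2) => lenardVec (k + 1) c :
        Fin (n / 2 + 1) → ZMod n → K) := by
  refine generically_linearIndependent_sumWith.mono fun c _ h => ?_
  have := cons_linearIndependent h (b := -1) (by simp) (a := fun _ => 2) (fun _ => two_ne_zero)
    (fun k => -sumSparse (k + 1) c)
  refine this.congr_apply fun k => ?_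
  funext j
  refine Fin.cases ?_ (fun k => ?_) k
  · simp [lenardVec_zero]
  · simp only [lenardVec, Fin.cons_succ, Pi.add_apply, Pi.smul_apply, smul_eq_mul]
    ring

/-- The logarithmic components of a covector. -/
def logComp (c : ZMod n → K) : ((ZMod n → K) →L[K] K) →ₗ[K] (ZMod n → K) where
  toFun ℓ j := c j * ℓ (Pi.single j 1)
  map_add' u v := by funext i; simp only [add_apply, Pi.add_apply]; ring
  map_smul' t v := by
    funext i; simp only [smul_apply, Pi.smul_apply, smul_eq_mul, RingHom.id_apply]; ring

theorem independent_of_euler {m : ℕ} {f : Fin m → (ZMod n → K) → K}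
    (h : Generically fun c => LinearIndependent K fun k => euler (f k) c) : Independent f :=
  h.mono fun c _ hc => LinearIndependent.of_comp (logComp c) hc

theorem independent_integrals : Independent (integrals K n) := by
  refine independent_of_euler (generically_linearIndependent_sumWith.mono fun c hc h => ?_)
  have := cons_linearIndependent h (prodAll_ne_zero hc) (a := fun _ => 1) (fun _ => one_ne_zero)
    (fun _ => 0)
  refine this.congr_apply fun k => ?_
  refine Fin.cases ?_ (fun k => ?_) k
  · funext j
    simp [integrals, euler_prodAll]
  · simp [integrals, euler_F]

/-- At the point with all coordinates 1 the value counts sparse sets. There is at least one, for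
otherwise the independent vectors above would include zero. -/
theorem generically_F_ne_zero (k : Fin (n / 2)) :
    Generically fun c : ZMod n → K => F (k + 1) c ≠ 0 := by
  have h1 : (sparseSets n (k + 1)).Nonempty := by
    rw [Finset.nonempty_iff_ne_empty]
    intro h
    refine (linearIndependent_sumWith_basePoint (K := ℝ) (n := n)).ne_zero k ?_
    funext j
    simp [sumWith, h]
  have h2 :
      MvPolynomial.eval (fun _ : ZMod n => (1 : K)) (sumSparse (k + 1) MvPolynomial.X) ≠ 0 := by
    rw [eval_sumSparse_X, F_eq_sumSparse]
    simp only [sumSparse, Finset.prod_const_one, Finset.sum_const, nsmul_eq_mul, mul_one]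
    exact Nat.cast_ne_zero.2 (Finset.card_pos.2 h1).ne'
  exact (generically_eval_ne_zero h2).mono fun c _ h => by rwa [eval_sumSparse_X] at h

/-- `altSum` as a polynomial. -/
def altSumPoly (n : ℕ) [NeZero n] (α : K) : MvPolynomial (ZMod n) K :=
  ∑ k ∈ Finset.range (n / 2 + 1), MvPolynomial.C ((-α⁻¹) ^ k) * sumSparse k MvPolynomial.X

theorem eval_altSumPoly (α : K) (c : ZMod n → K) :
    MvPolynomial.eval c (altSumPoly n α) = altSum α c := by
  simp only [altSumPoly, map_sum, map_mul, MvPolynomial.eval_C, eval_sumSparse_X, altSum]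
  refine Finset.sum_congr rfl fun k _ => ?_
  rw [neg_pow]
  ring

theorem altSum_zero (α : K) : altSum α (0 : ZMod n → K) = 1 := by
  rw [altSum, Finset.sum_range_succ', Finset.sum_eq_zero]
  · simp [F_eq_sumSparse, sumSparse_zero]
  · intro k _
    have := sumSparse_smul (k + 1) (0 : K) (0 : ZMod n → K)
    simp only [zero_mul, pow_succ, mul_zero] at this
    have h : F (k + 1) (0 : ZMod n → K) = 0 := this
    rw [h]
    ring

theorem generically_altSum_ne_zero (α : K) :
    Generically fun c : ZMod n → K => altSum α c ≠ 0 := by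
  have h : MvPolynomial.eval (0 : ZMod n → K) (altSumPoly n α) ≠ 0 := by
    rw [eval_altSumPoly, altSum_zero]; exact one_ne_zero
  exact (generically_eval_ne_zero h).mono fun c _ h => by rwa [eval_altSumPoly] at h

theorem casimirVec_eq (α : K) (c : ZMod n → K) : casimirVec α c =
    lenardVec 0 c + ∑ k : Fin (n / 2), (-α⁻¹) ^ ((k : ℕ) + 1) • lenardVec (k + 1) c := by
  rw [casimirVec, Finset.sum_range_succ', ← Fin.sum_univ_eq_sum_range
    (fun k => (-α⁻¹) ^ (k + 1) • lenardVec (k + 1) c), add_comm]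
  simp

/-- The vector v_0 enters `casimirVec` with coefficient 1. -/
theorem casimirVec_notMem_span {α : K} {c : ZMod n → K}
    (h : LinearIndependent K (Fin.cons (lenardVec 0 c) fun k : Fin (n / 2) => lenardVec (k + 1) c :
      Fin (n / 2 + 1) → ZMod n → K)) :
    casimirVec α c ∉ Submodule.span K (Set.range fun k : Fin (n / 2) => lenardVec (k + 1) c) := by
  intro h'
  rw [linearIndependent_finCons] at h
  refine h.2 ?_
  have : lenardVec 0 c = casimirVec α c -
      ∑ k : Fin (n / 2), (-α⁻¹) ^ ((k : ℕ) + 1) • lenardVec (k + 1) c := by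
    rw [casimirVec_eq]; abel
  rw [this]
  exact Submodule.sub_mem _ h' (Submodule.sum_mem _ fun k _ => Submodule.smul_mem _ _
    (Submodule.subset_span ⟨k, rfl⟩))

theorem independent_of_odd (α : K) :
    Independent (n := n) (Fin.cons (casimirE α) fun k : Fin (n / 2) => normF (k + 1)) := by
  refine independent_of_euler ((generically_linearIndependent_lenardVec.and
    ((generically_altSum_ne_zero α).and (Generically.forall generically_F_ne_zero))).mono ?_)
  rintro c hc ⟨h, ha, hF⟩
  have hp := prodAll_ne_zero hc
  have h1 : LinearIndependent K (Fin.cons (casimirVec α c) fun k : Fin (n / 2) =>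
      lenardVec (k + 1) c : Fin (n / 2 + 1) → ZMod n → K) :=
    linearIndependent_finCons.2 ⟨(linearIndependent_finCons.1 h).1, casimirVec_notMem_span h⟩
  have := cons_linearIndependent h1 (div_ne_zero ha hp)
    (a := fun k : Fin (n / 2) => F (k + 1) c / prodAll c) (fun k => div_ne_zero (hF k) hp)
    (fun _ => 0)
  refine this.congr_apply fun k => ?_
  refine Fin.cases ?_ (fun k => ?_) k
  · simp [euler_casimirE α hc]
  · simp [euler_normF _ hc]

end Base

/-! ### The alternating vector and the Casimir for even n -/

section Parity

variable {K : Type*} [RCLike K] {n : ℕ} [NeZero n]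

variable (K n) in
/-- The alternating function on `ZMod n` if `n` is even, and `0` if `n` is odd. -/
def altSign (j : ZMod n) : K := if Even n then (-1) ^ j.val else 0

theorem altSign_natCast (hn : Even n) (k : ℕ) : altSign K n k = (-1) ^ k := by
  rw [altSign, if_pos hn, ZMod.val_natCast]
  conv_rhs => rw [← Nat.div_add_mod k n, pow_add, pow_mul, hn.neg_one_pow, one_pow, one_mul]

theorem altSign_add_one (j : ZMod n) : altSign K n (j + 1) = -altSign K n j := by
  by_cases hn : Even n
  · obtain ⟨k, rfl⟩ := ZMod.natCast_zmod_surjective j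
    rw [altSign_natCast hn, show (k : ZMod n) + 1 = ((k + 1 : ℕ) : ZMod n) by push_cast; rfl,
      altSign_natCast hn, pow_succ]
    ring
  · simp [altSign, hn]

theorem eq_smul_altSign {v : ZMod n → K} (h : ∀ j, v (j + 1) = -v j) : v = v 0 • altSign K n := by
  have h1 : ∀ k : ℕ, v k = v 0 * (-1) ^ k := by
    intro k
    induction k with
    | zero => simp
    | succ k ih => push_cast; rw [h, ih]; ring
  by_cases hn : Even n
  · funext j
    obtain ⟨k, rfl⟩ := ZMod.natCast_zmod_surjective j
    rw [h1, Pi.smul_apply, altSign_natCast hn, smul_eq_mul]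
  · have h2 := h1 n
    rw [(Nat.not_even_iff_odd.1 hn).neg_one_pow, ZMod.natCast_self] at h2
    have h3 : v 0 = 0 := by linear_combination h2 / 2
    funext j
    obtain ⟨k, rfl⟩ := ZMod.natCast_zmod_surjective j
    rw [h1, h3]
    simp

theorem logHam_altSign (β : K) (c : ZMod n → K) : logHam β c (altSign K n) = 0 := by
  funext i
  have h1 : altSign K n (i + 2) = altSign K n i := by
    rw [show i + 2 = i + 1 + 1 by ring, altSign_add_one, altSign_add_one, neg_neg]
  have h2 : altSign K n (i - 1) = -altSign K n i := by
    have := altSign_add_one (K := K) (i - 1)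
    rw [sub_add_cancel] at this
    rw [this, neg_neg]
  have h3 : altSign K n (i - 2) = altSign K n i := by
    have := altSign_add_one (K := K) (i - 2)
    rw [show i - 2 + 1 = i - 1 by ring, h2] at this
    linear_combination this
  simp only [logHam_apply, quadPart, shiftDiff, altSign_add_one, h1, h2, h3, Pi.zero_apply]
  ring

theorem euler_evenOdd (hn : Even n) {c : ZMod n → K} (hc : c ∈ torus K n) :
    euler evenOdd c = evenOdd c • altSign K n := by
  classical
  funext j
  have hden : ∏ i : ZMod n with Odd i.val, c i ≠ 0 := Finset.prod_ne_zero_iff.2 fun i _ => hc i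
  have hnd :=
    (hasFDerivAt_prod (Finset.univ.filter fun i : ZMod n => Even i.val) c).differentiableAt
  have hdd := (hasFDerivAt_prod (Finset.univ.filter fun i : ZMod n => Odd i.val) c).differentiableAt
  have hd : DifferentiableAt K (evenOdd (K := K) (n := n)) c := by
    unfold evenOdd
    fun_prop (disch := exact hden)
  have h1 := euler_mul hd hdd j
  have h2 : euler (fun x : ZMod n → K => evenOdd x * ∏ i : ZMod n with Odd i.val, x i) c =
      euler (fun x => ∏ i : ZMod n with Even i.val, x i) c := by
    refine euler_congr ?_
    filter_upwards [hdd.continuousAt.eventually_ne hden] with x hx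
    rw [evenOdd, div_mul_cancel₀ _ hx]
  rw [h2, euler_prod, euler_prod] at h1
  have h3 : evenOdd c * ∏ i : ZMod n with Odd i.val, c i = ∏ i : ZMod n with Even i.val, c i := by
    rw [evenOdd, div_mul_cancel₀ _ hden]
  rw [← h3] at h1
  apply mul_right_cancel₀ hden
  simp only [Finset.mem_filter, Finset.mem_univ, true_and] at h1
  rw [Pi.smul_apply, smul_eq_mul, altSign, if_pos hn]
  rcases Nat.even_or_odd j.val with h | h
  · rw [if_pos h, if_neg (Nat.not_odd_iff_even.2 h)] at h1
    rw [h.neg_one_pow]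
    linear_combination -h1
  · rw [if_neg (Nat.not_even_iff_odd.2 h), if_pos h] at h1
    rw [h.neg_one_pow]
    linear_combination -h1

theorem isCasimir_evenOdd (hn : Even n) (β : K) : IsCasimir (poisson (n := n) β) evenOdd :=
  isCasimir_of_logHam fun c hc => by
    rw [euler_evenOdd hn hc, map_smul, logHam_altSign, smul_zero]

/-- A sparse set with n/2 elements and its translate partition the indices, so it contains exactly
one of j, j + 1. Hence the last vector of the chain alternates. -/
theorem lenardVec_half (hn : Even n) (c : ZMod n → K) :
    lenardVec (n / 2) c = lenardVec (n / 2) c 0 • altSign K n := by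
  classical
  refine eq_smul_altSign fun j => ?_
  have h : sumWith (n / 2) c j + sumWith (n / 2) c (j + 1) = sumSparse (n / 2) c := by
    rw [sumWith, sumWith, sumSparse, ← Finset.sum_add_distrib]
    refine Finset.sum_congr rfl fun I hI => ?_
    rw [mem_sparseSets] at hI
    obtain ⟨hcard, hs⟩ := hI
    have hd : Disjoint I (I.map (Equiv.addRight (1 : ZMod n)).toEmbedding) := by
      rw [Finset.disjoint_left]
      intro i hi hi'
      simp only [Finset.mem_map_equiv] at hi'
      exact hs _ hi' (by simpa using hi)
    have hu : I ∪ I.map (Equiv.addRight (1 : ZMod n)).toEmbedding = Finset.univ := by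
      rw [← Finset.card_eq_iff_eq_univ, Finset.card_union_of_disjoint hd, Finset.card_map, hcard,
        ZMod.card]
      obtain ⟨r, hr⟩ := hn
      omega
    have hj : j + 1 ∈ I ∪ I.map (Equiv.addRight (1 : ZMod n)).toEmbedding := by
      rw [hu]; exact Finset.mem_univ _
    rw [Finset.mem_union] at hj
    simp only [Finset.mem_map_equiv, Equiv.addRight_symm, Equiv.coe_addRight,
      add_neg_cancel_right] at hj
    by_cases h1 : j ∈ I
    · rw [if_pos h1, if_neg (hs j h1), add_zero]
    · rw [if_neg h1, if_pos (hj.resolve_right h1), zero_add]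
  simp only [lenardVec]
  linear_combination 2 * h

/-- The alternating vector is a non-zero multiple of v_{n/2} and takes its place in the independent
chain. -/
theorem linearIndependent_even (hn : Even n) {α : K} {c : ZMod n → K}
    (h : LinearIndependent K (Fin.cons (lenardVec 0 c) fun k : Fin (n / 2) => lenardVec (k + 1) c :
      Fin (n / 2 + 1) → ZMod n → K)) :
    LinearIndependent K (Fin.cons (casimirVec α c)
      (Fin.cons (altSign K n) fun k : Fin (n / 2 - 1) => lenardVec (k + 1) c :
        Fin (n / 2 - 1 + 1) → ZMod n → K) : Fin (n / 2 - 1 + 1 + 1) → ZMod n → K) := by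
  have hcas := casimirVec_notMem_span (α := α) h
  have hli := (linearIndependent_finCons.1 h).1
  have hhalf := lenardVec_half hn c
  obtain ⟨m, hm⟩ : ∃ m, n / 2 = m + 1 := by
    have := NeZero.pos n
    obtain ⟨r, hr⟩ := hn
    exact ⟨n / 2 - 1, by omega⟩
  rw [hm] at hhalf
  have hsub : n / 2 - 1 = m := by omega
  rw [hsub]
  have hcas' : casimirVec α c ∉
      Submodule.span K (Set.range fun k : Fin (m + 1) => lenardVec (k + 1) c) := by
    rwa [hm] at hcas
  have hli' : LinearIndependent K fun k : Fin (m + 1) => lenardVec (k + 1) c := by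
    rwa [hm] at hli
  have ha : lenardVec (m + 1) c 0 ≠ 0 := by
    intro h0
    rw [h0, zero_smul] at hhalf
    exact hli'.ne_zero (Fin.last m) hhalf
  have halt : altSign K n = (lenardVec (m + 1) c 0)⁻¹ • lenardVec (m + 1) c := by
    conv_rhs => rw [hhalf]
    rw [smul_smul, Pi.smul_apply, smul_eq_mul]
    have h1 : altSign K n 0 = 1 := by simp [altSign, hn]
    rw [h1, mul_one, inv_mul_cancel₀ ha, one_smul]
  have hsnoc := hli'
  rw [← Fin.snoc_init_self (α := fun _ => ZMod n → K) (fun k : Fin (m + 1) => lenardVec (k + 1) c),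
    linearIndependent_finSnoc] at hsnoc
  rw [linearIndependent_finCons, linearIndependent_finCons]
  refine ⟨⟨hsnoc.1, fun h' => hsnoc.2 ?_⟩, fun h' => hcas' (Submodule.span_le.2 ?_ h')⟩
  · rw [halt, Submodule.smul_mem_iff _ (inv_ne_zero ha)] at h'
    exact h'
  · rintro _ ⟨k, rfl⟩
    refine Fin.cases ?_ (fun k => ?_) k
    · rw [Fin.cons_zero, halt]
      exact Submodule.smul_mem _ _ (Submodule.subset_span ⟨Fin.last m, rfl⟩)
    · rw [Fin.cons_succ]
      exact Submodule.subset_span ⟨k.castSucc, rfl⟩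

theorem evenOdd_ne_zero {c : ZMod n → K} (hc : c ∈ torus K n) : evenOdd c ≠ 0 :=
  div_ne_zero (Finset.prod_ne_zero_iff.2 fun i _ => hc i)
    (Finset.prod_ne_zero_iff.2 fun i _ => hc i)

theorem independent_of_even (hn : Even n) (α : K) :
    Independent (n := n) (Fin.cons (casimirE α)
      (Fin.cons evenOdd fun k : Fin (n / 2 - 1) => normF (k + 1))) := by
  refine independent_of_euler ((generically_linearIndependent_lenardVec.and
    ((generically_altSum_ne_zero α).and (Generically.forall generically_F_ne_zero))).mono ?_)
  rintro c hc ⟨h, ha, hF⟩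
  have hp := prodAll_ne_zero hc
  have := cons_linearIndependent (linearIndependent_even hn (α := α) h) (div_ne_zero ha hp)
    (a := Fin.cons (evenOdd c) fun k : Fin (n / 2 - 1) => F (k + 1) c / prodAll c)
    (fun k => by
      refine Fin.cases ?_ (fun k => ?_) k
      · exact evenOdd_ne_zero hc
      · exact div_ne_zero (hF ⟨k, by omega⟩) hp)
    (fun _ => 0)
  refine this.congr_apply fun k => ?_
  refine Fin.cases ?_ (fun k => ?_) k
  · simp [euler_casimirE α hc]
  · refine Fin.cases ?_ (fun k => ?_) k
    · simp [euler_evenOdd hn hc]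
    · simp [euler_normF _ hc]

end Parity

/-! ### The generic corank -/

section Rank

variable {K : Type*} [RCLike K] {n : ℕ} [NeZero n]

/-- If S v = 0, then v_i + v_{i+1} is constant. The zero sum makes this constant 0, so v is a
multiple of the alternating vector, to which it is also orthogonal. -/
theorem eq_zero_of_shiftDiff_eq_zero {v : ZMod n → K} (h : shiftDiff v = 0) (h1 : ∑ i, v i = 0)
    (h2 : ∑ i, altSign K n i * v i = 0) : v = 0 := by
  have hn : (n : K) ≠ 0 := Nat.cast_ne_zero.2 (NeZero.ne n)
  have hv : ∀ i, v (i + 1) = v (i - 1) := fun i => sub_eq_zero.1 (congrFun h i)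
  have hw : ∀ i, v (i + 1) + v (i + 1 + 1) = v i + v (i + 1) := fun i => by
    rw [hv (i + 1), show i + 1 - 1 = i by ring]; ring
  have hconst : ∀ k : ℕ, v k + v (k + 1) = v 0 + v 1 := by
    intro k
    induction k with
    | zero => simp
    | succ k ih => push_cast; rw [hw, ih]
  have hconst' : ∀ i : ZMod n, v i + v (i + 1) = v 0 + v 1 := fun i => by
    obtain ⟨k, rfl⟩ := ZMod.natCast_zmod_surjective i
    exact hconst k
  have hsum : (n : K) * (v 0 + v 1) = 0 := by
    have h3 := sum_shift v 1
    have h4 : ∑ i, (v i + v (i + 1)) = (n : K) * (v 0 + v 1) := by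
      simp only [hconst', Finset.sum_const, Finset.card_univ, ZMod.card, nsmul_eq_mul]
    rw [← h4, Finset.sum_add_distrib, h3, h1, add_zero]
  have h0 := (mul_eq_zero.1 hsum).resolve_left hn
  have hanti : ∀ i, v (i + 1) = -v i := fun i => by linear_combination hconst' i + h0
  have hs := eq_smul_altSign hanti
  by_cases he : Even n
  · have h5 : ∀ i, altSign K n i * v i = v 0 := by
      intro i
      rw [hs]
      simp only [Pi.smul_apply, smul_eq_mul, altSign, if_pos he, ZMod.val_zero, pow_zero, mul_one]
      rw [mul_left_comm, ← pow_add, Even.neg_one_pow ⟨_, rfl⟩, mul_one]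
    simp only [h5, Finset.sum_const, Finset.card_univ, ZMod.card, nsmul_eq_mul] at h2
    rw [hs, (mul_eq_zero.1 h2).resolve_left hn, zero_smul]
  · rw [hs]
    funext i
    simp [altSign, he]

/-- The bracket completed to a map that is invertible at `c = 0`. -/
def completedHam (α : K) (c v : ZMod n → K) (i : ZMod n) : K :=
  logHam α c v i + ∑ j, v j + (∑ j, altSign K n j * v j) * altSign K n i

theorem sum_altSign : ∑ i, altSign K n i = 0 := by
  have h := sum_shift (altSign K n) 1
  simp only [altSign_add_one, Finset.sum_neg_distrib] at h
  linear_combination -h / 2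

/-- At c = 0 only -αS remains of the bracket. Summing the equations, plainly and with alternating
signs, removes S and isolates the two added terms. -/
theorem completedHam_zero_injective {α : K} (hα : α ≠ 0) {v : ZMod n → K}
    (h : completedHam α 0 v = 0) : v = 0 := by
  have hn : (n : K) ≠ 0 := Nat.cast_ne_zero.2 (NeZero.ne n)
  have hi : ∀ i, -(α * shiftDiff v i) + ∑ j, v j + (∑ j, altSign K n j * v j) * altSign K n i =
      0 := by
    intro i
    have := congrFun h i
    simpa [completedHam, logHam_apply, quadPart] using this
  have hsd : ∑ i, shiftDiff v i = 0 := by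
    have := sum_mul_shiftDiff (fun _ : ZMod n => (1 : K)) v
    simpa [shiftDiff] using this
  have h1 : ∑ j, v j = 0 := by
    have := Finset.sum_congr rfl fun i (_ : i ∈ Finset.univ) => hi i
    simp only [Finset.sum_add_distrib, Finset.sum_neg_distrib, ← Finset.mul_sum, hsd, sum_altSign,
      Finset.sum_const, Finset.card_univ, ZMod.card, nsmul_eq_mul, mul_zero, neg_zero, zero_add,
      add_zero] at this
    exact (mul_eq_zero.1 this).resolve_left hn
  have hsd2 : ∑ i, altSign K n i * shiftDiff v i = 0 := by
    rw [sum_mul_shiftDiff]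
    have : ∀ i, shiftDiff (altSign K n) i = 0 := fun i => by
      have := altSign_add_one (K := K) (i - 1)
      rw [sub_add_cancel] at this
      rw [shiftDiff, altSign_add_one, this]
      ring
    simp [this]
  have h2 : (∑ j, altSign K n j * v j) * ∑ i, altSign K n i * altSign K n i = 0 := by
    have : ∑ i, altSign K n i * (-(α * shiftDiff v i) + ∑ j, v j +
        (∑ j, altSign K n j * v j) * altSign K n i) = 0 :=
      Finset.sum_eq_zero fun i _ => by rw [hi, mul_zero]
    have e : ∀ i, altSign K n i * (-(α * shiftDiff v i) + ∑ j, v j +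
        (∑ j, altSign K n j * v j) * altSign K n i) = -α * (altSign K n i * shiftDiff v i) +
        (∑ j, altSign K n j * v j) * (altSign K n i * altSign K n i) := fun i => by
      rw [h1]; ring
    simp only [e, Finset.sum_add_distrib, ← Finset.mul_sum, hsd2, mul_zero, zero_add] at this
    exact this
  have h3 : ∑ j, altSign K n j * v j = 0 := by
    by_cases he : Even n
    · have : ∀ i, altSign K n i * altSign K n i = 1 := fun i => by
        rw [altSign, if_pos he, ← pow_add, Even.neg_one_pow ⟨_, rfl⟩]
      simp only [this, Finset.sum_const, Finset.card_univ, ZMod.card, nsmul_eq_mul, mul_one] at h2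
      exact (mul_eq_zero.1 h2).resolve_right hn
    · simp [altSign, he]
  refine eq_zero_of_shiftDiff_eq_zero (funext fun i => ?_) h1 h3
  have := hi i
  rw [h1, h3, zero_mul, add_zero, add_zero, neg_eq_zero] at this
  exact (mul_eq_zero.1 this).resolve_left hα

theorem completedHam_eq_sum (α : K) (c v : ZMod n → K) :
    completedHam α c v = ∑ k, v k • completedHam α c (Pi.single k 1) := by
  let L : (ZMod n → K) →ₗ[K] (ZMod n → K) :=
    { toFun := completedHam α c
      map_add' u v := by
        funext i
        simp only [completedHam, map_add, Pi.add_apply, mul_add, Finset.sum_add_distrib]; ring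
      map_smul' t v := by
        funext i
        simp only [completedHam, map_smul, Pi.smul_apply, smul_eq_mul, RingHom.id_apply,
          mul_left_comm _ t, ← Finset.mul_sum]
        ring }
  change L v = ∑ k, v k • L (Pi.single k 1)
  conv_lhs => rw [← Finset.univ_sum_single v, map_sum]
  refine Finset.sum_congr rfl fun k _ => ?_
  rw [← map_smul]
  congr 1
  funext i
  by_cases h : i = k
  · subst h; simp
  · simp [h]

theorem linearIndependent_completedHam_iff (α : K) (c : ZMod n → K) :
    (LinearIndependent K fun k => completedHam α c (Pi.single k 1)) ↔
      ∀ v, completedHam α c v = 0 → v = 0 := by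
  rw [Fintype.linearIndependent_iff]
  refine forall_congr' fun v => ?_
  rw [← completedHam_eq_sum, funext_iff (f := v)]
  rfl

theorem generically_completedHam_injective {α : K} (hα : α ≠ 0) :
    Generically fun c : ZMod n → K => ∀ v, completedHam α c v = 0 → v = 0 := by
  let C : K →+* MvPolynomial (ZMod n) K := MvPolynomial.C
  let M : ZMod n → ZMod n → MvPolynomial (ZMod n) K := fun k i =>
    quadPart MvPolynomial.X (fun j => C ((Pi.single k 1 : ZMod n → K) j)) i +
      C (-(α * shiftDiff (Pi.single k 1 : ZMod n → K) i) +
        ∑ j, (Pi.single k 1 : ZMod n → K) j +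
        (∑ j, altSign K n j * (Pi.single k 1 : ZMod n → K) j) * altSign K n i)
  have hM : ∀ c : ZMod n → K, (fun k i => MvPolynomial.eval c (M k i)) =
      fun k => completedHam α c (Pi.single k 1) := by
    intro c
    funext k i
    simp only [M, C, quadPart, map_add, map_sub, map_mul, MvPolynomial.eval_X, MvPolynomial.eval_C,
      completedHam, logHam_apply, map_neg]
    ring
  have := generically_linearIndependent M 0 (by
    rw [hM, linearIndependent_completedHam_iff]
    exact fun v => completedHam_zero_injective hα)
  simpa only [hM, linearIndependent_completedHam_iff] using this

theorem rank_poisson_add {α : K} {c : ZMod n → K} (hc : c ∈ torus K n) :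
    (poisson α c).rank + Module.finrank K (LinearMap.ker (logHam α c)) = n := by
  let e : (ZMod n → K) ≃ₗ[K] (ZMod n → K) := LinearEquiv.piCongrRight fun i =>
    LinearEquiv.smulOfUnit (Units.mk0 (c i) (hc i))
  have he : ∀ v i, e v i = c i * v i := fun v i => rfl
  have hker : LinearMap.ker (poisson α c).mulVecLin = (LinearMap.ker (logHam α c)).comap
      (e : (ZMod n → K) →ₗ[K] (ZMod n → K)) := by
    ext v
    rw [LinearMap.mem_ker, Submodule.mem_comap, LinearMap.mem_ker, Matrix.mulVecLin_apply,
      funext_iff, funext_iff]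
    refine forall_congr' fun i => ?_
    have := sum_poisson_mul α c v i
    rw [Matrix.mulVec, dotProduct, this, Pi.zero_apply, mul_eq_zero]
    simp only [hc i, false_or]
    rfl
  have h1 := LinearMap.finrank_range_add_finrank_ker (poisson α c).mulVecLin
  have h2 : Module.finrank K (LinearMap.ker (poisson α c).mulVecLin) =
      Module.finrank K (LinearMap.ker (logHam α c)) := by
    rw [hker]
    exact (e.ofSubmodule' _).finrank_eq
  rw [h2, Module.finrank_fintype_fun_eq_card, ZMod.card] at h1
  exact h1

/-- On the kernel of `logHam` the completed map sees v only through its sum, since the alternating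
vector is 0; injectivity bounds the kernel by one dimension. The Casimir vector attains the bound.
-/
theorem generically_rank_of_odd (hn : Odd n) {α : K} (hα : α ≠ 0) :
    Generically fun c : ZMod n → K => (poisson α c).rank + 1 = n := by
  refine ((generically_completedHam_injective hα).and
    generically_linearIndependent_lenardVec).mono ?_
  rintro c hc ⟨h, hli⟩
  have h1 : Module.finrank K (LinearMap.ker (logHam α c)) ≤ 1 := by
    let f : LinearMap.ker (logHam α c) →ₗ[K] K :=
      (Fintype.linearCombination K fun _ : ZMod n => (1 : K)).comp (Submodule.subtype _)
    have hf : Function.Injective f := by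
      rw [← LinearMap.ker_eq_bot, LinearMap.ker_eq_bot']
      rintro ⟨v, hv⟩ hfv
      have hs : ∑ i, v i = 0 := by
        simpa [f, Fintype.linearCombination_apply] using hfv
      ext1
      refine h v (funext fun i => ?_)
      rw [LinearMap.mem_ker] at hv
      simp [completedHam, hv, hs, altSign, Nat.not_even_iff_odd.2 hn]
    simpa using LinearMap.finrank_le_finrank_of_injective hf
  have h2 : 1 ≤ Module.finrank K (LinearMap.ker (logHam α c)) := by
    rw [Nat.one_le_iff_ne_zero, ← Nat.pos_iff_ne_zero, Module.finrank_pos_iff_exists_ne_zero]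
    refine ⟨⟨casimirVec α c, logHam_casimirVec hα c⟩, fun h0 => ?_⟩
    refine casimirVec_notMem_span (α := α) hli ?_
    rw [show casimirVec α c = 0 from congrArg Subtype.val h0]
    exact Submodule.zero_mem _
  have := rank_poisson_add (α := α) hc
  omega

/-- As in the odd case, but with two functionals, the plain and the alternating sum, and two
independent kernel vectors. -/
theorem generically_rank_of_even (hn : Even n) {α : K} (hα : α ≠ 0) :
    Generically fun c : ZMod n → K => (poisson α c).rank + 2 = n := by
  refine ((generically_completedHam_injective hα).and
    generically_linearIndependent_lenardVec).mono ?_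
  rintro c hc ⟨h, hli⟩
  have h1 : Module.finrank K (LinearMap.ker (logHam α c)) ≤ 2 := by
    let f : LinearMap.ker (logHam α c) →ₗ[K] K × K :=
      ((Fintype.linearCombination K fun _ : ZMod n => (1 : K)).prod
        (Fintype.linearCombination K (altSign K n))).comp (Submodule.subtype _)
    have hf : Function.Injective f := by
      rw [← LinearMap.ker_eq_bot, LinearMap.ker_eq_bot']
      rintro ⟨v, hv⟩ hfv
      have hs : ∑ i, v i = 0 ∧ ∑ i, v i * altSign K n i = 0 := by
        simpa [f, Fintype.linearCombination_apply] using hfv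
      ext1
      refine h v (funext fun i => ?_)
      rw [LinearMap.mem_ker] at hv
      have hs2 : ∑ i, altSign K n i * v i = 0 := by simpa only [mul_comm] using hs.2
      simp [completedHam, hv, hs.1, hs2]
    simpa using LinearMap.finrank_le_finrank_of_injective hf
  have h2 : 2 ≤ Module.finrank K (LinearMap.ker (logHam α c)) := by
    have hpair : LinearIndependent K ![casimirVec α c, altSign K n] := by
      have h3 := linearIndependent_even hn (α := α) hli
      have h4 := h3.comp ![0, 1] (by
        intro a b
        fin_cases a <;> fin_cases b <;> simp)
      refine h4.congr_apply fun i => ?_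
      fin_cases i
      · rfl
      · rfl
    let w : Fin 2 → LinearMap.ker (logHam α c) :=
      ![⟨casimirVec α c, logHam_casimirVec hα c⟩, ⟨altSign K n, logHam_altSign α c⟩]
    have hw : LinearIndependent K w := by
      refine LinearIndependent.of_comp (Submodule.subtype _) (hpair.congr_apply fun i => ?_)
      fin_cases i
      · rfl
      · rfl
    simpa using hw.fintype_card_le_finrank
  have := rank_poisson_add (α := α) hc
  omega

end Rank

/-! ### Fibres and local inverses of the Miura map -/

section Fibre

variable {K : Type*} [RCLike K] {n : ℕ} [NeZero n]

/-- A non-zero entry of δ propagates around the cycle, so the product of all δ_i can be cancelled.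
-/
theorem prod_eq_prod_of_recursion {δ a b : ZMod n → K} (h : ∀ i, δ i * a i = b i * δ (i + 1))
    (ha : ∀ i, a i ≠ 0) (hδ : δ ≠ 0) : ∏ i, a i = ∏ i, b i := by
  obtain ⟨j, hj⟩ := Function.ne_iff.1 hδ
  have h1 : ∀ k : ℕ, δ (j + k) ≠ 0 := by
    intro k
    induction k with
    | zero => simpa using hj
    | succ k ih =>
      intro h0
      have := h (j + k)
      rw [show j + (k : ZMod n) + 1 = j + ((k + 1 : ℕ) : ZMod n) by push_cast; ring, h0,
        mul_zero] at this
      exact mul_ne_zero ih (ha _) this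
  have h2 : ∀ i, δ i ≠ 0 := fun i => by
    have := h1 (i - j).val
    rwa [ZMod.natCast_zmod_val, add_sub_cancel] at this
  have h3 : ∏ i, δ (i + 1) = ∏ i, δ i := Equiv.prod_comp (Equiv.addRight (1 : ZMod n)) δ
  have h4 : (∏ i, δ i) * ∏ i, a i = (∏ i, δ i) * ∏ i, b i := by
    rw [← Finset.prod_mul_distrib, Finset.prod_congr rfl fun i _ => h i, Finset.prod_mul_distrib,
      h3, mul_comm]
  exact mul_left_cancel₀ (Finset.prod_ne_zero_iff.2 fun i _ => h2 i) h4

variable (K n) in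
/-- The parameters for which the polygons are non-degenerate. -/
def regularParams : Set (ZMod n → K) := {x | (∀ i, x i ≠ 0) ∧ ∀ i, x i ≠ 1}

theorem isOpen_regularParams : IsOpen (regularParams K n) := by
  have : regularParams K n = ⋂ i, {x | x i ≠ 0} ∩ {x | x i ≠ 1} := by
    ext x
    simp [regularParams, forall_and]
  rw [this]
  exact isOpen_iInter_of_finite fun i =>
    (isOpen_ne_fun (continuous_apply i) continuous_const).inter
      (isOpen_ne_fun (continuous_apply i) continuous_const)

/-- The difference δ = x - y satisfies δ_i (1 - x_{i+1}) = y_i δ_{i+1}. -/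
theorem prod_one_sub_eq_of_miura_eq {α : K} (hα : α ≠ 0) {x y : ZMod n → K}
    (hx : x ∈ regularParams K n) (h : miura α x = miura α y) (hxy : x ≠ y) :
    ∏ i, (1 - x i) = ∏ i, y i := by
  have h1 : ∏ i, (1 - x (i + 1)) = ∏ i, (1 - x i) :=
    Equiv.prod_comp (Equiv.addRight (1 : ZMod n)) fun i => 1 - x i
  rw [← h1]
  refine prod_eq_prod_of_recursion (δ := fun i => x i - y i) (fun i => ?_)
    (fun i => sub_ne_zero.2 (hx.2 _).symm) fun h0 => hxy (funext fun i => ?_)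
  · have h2 := congrFun h i
    simp only [miura, mul_assoc] at h2
    have := mul_left_cancel₀ hα h2
    linear_combination this
  · exact sub_eq_zero.1 (congrFun h0 i)

/-- A fibre of the Miura map at a regular value has at most two points. -/
theorem eq_or_eq_of_miura_eq {α : K} (hα : α ≠ 0) {x y z : ZMod n → K}
    (hx : x ∈ regularParams K n) (hz : z ∈ regularParams K n)
    (hxy : miura α x = miura α y) (hxz : miura α x = miura α z) (hne : x ≠ y)
    (hd : ∏ i, x i ≠ ∏ i, (1 - x i)) : z = x ∨ z = y := by
  by_contra hcon
  push Not at hcon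
  have h1 := prod_one_sub_eq_of_miura_eq hα hx hxy hne
  have h2 := prod_one_sub_eq_of_miura_eq hα hz hxz.symm hcon.1
  have h3 := prod_one_sub_eq_of_miura_eq hα hz (hxz.symm.trans hxy) hcon.2
  exact hd (h2.symm.trans (h3.trans h1.symm))

/-- The discriminant of the fibres of the Miura map. -/
def discr (n : ℕ) [NeZero n] (α : K) : MvPolynomial (ZMod n) K :=
  altSumPoly n α ^ 2 - MvPolynomial.C (4 * (α⁻¹) ^ n) * ∏ i, MvPolynomial.X i

theorem eval_discr (α : K) (c : ZMod n → K) : MvPolynomial.eval c (discr n α) =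
    altSum α c ^ 2 - 4 * (α⁻¹) ^ n * ∏ i, c i := by
  simp [discr, eval_altSumPoly]

theorem discr_ne_zero (α : K) : discr n α ≠ 0 := by
  intro h
  have h1 := eval_discr α (0 : ZMod n → K)
  rw [h, altSum_zero] at h1
  simp [NeZero.ne n] at h1

theorem altSum_miura {α : K} (hα : α ≠ 0) (x : ZMod n → K) :
    altSum α (miura α x) = ∏ i, x i + ∏ i, (1 - x i) := by
  rw [← sum_sumSparse_miura hα, altSum]
  have : ∀ k, n < 2 * k → (-1) ^ k * F k (miura α x) * (α⁻¹) ^ k = 0 := fun k hk => by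
    rw [F_eq_sumSparse, sumSparse_eq_zero hk]; ring
  rw [sum_half_range this]
  refine Finset.sum_congr rfl fun k _ => ?_
  rw [neg_pow, F_eq_sumSparse]
  ring

theorem eval_discr_miura {α : K} (hα : α ≠ 0) (x : ZMod n → K) :
    MvPolynomial.eval (miura α x) (discr n α) = (∏ i, x i - ∏ i, (1 - x i)) ^ 2 := by
  have h1 : ∏ i, (1 - x (i + 1)) = ∏ i, (1 - x i) :=
    Equiv.prod_comp (Equiv.addRight (1 : ZMod n)) fun i => 1 - x i
  rw [eval_discr, altSum_miura hα]
  simp only [miura, Finset.prod_mul_distrib, h1, Finset.prod_const, Finset.card_univ, ZMod.card,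
    inv_pow]
  field_simp
  ring

/-- The derivative of the Miura map. -/
def miuraDeriv (α : K) (x : ZMod n → K) : (ZMod n → K) →L[K] (ZMod n → K) :=
  ContinuousLinearMap.pi fun i =>
    (α * (1 - x (i + 1))) • ContinuousLinearMap.proj (R := K) (φ := fun _ => K) i -
      (α * x i) • ContinuousLinearMap.proj (R := K) (φ := fun _ => K) (i + 1)

theorem miuraDeriv_apply (α : K) (x z : ZMod n → K) (i : ZMod n) :
    miuraDeriv α x z i = α * (1 - x (i + 1)) * z i - α * x i * z (i + 1) := by
  simp [miuraDeriv]

theorem hasFDerivAt_miura (α : K) (x : ZMod n → K) :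
    HasFDerivAt (miura α) (miuraDeriv α x) x := by
  refine hasFDerivAt_pi.2 fun i => ?_
  have h1 := ((hasFDerivAt_apply (𝕜 := K) (F' := fun _ : ZMod n => K) i x).const_mul α).mul
    ((hasFDerivAt_apply (𝕜 := K) (F' := fun _ : ZMod n => K) (i + 1) x).const_sub 1)
  refine h1.congr_fderiv (ContinuousLinearMap.ext fun z => ?_)
  simp
  ring

/-- The derivative of the dual Miura map. -/
def miuraDualDeriv (α : K) (x : ZMod n → K) : (ZMod n → K) →L[K] (ZMod n → K) :=
  ContinuousLinearMap.pi fun i =>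
    (α * (1 - x i)) • ContinuousLinearMap.proj (R := K) (φ := fun _ => K) (i + 1) -
      (α * x (i + 1)) • ContinuousLinearMap.proj (R := K) (φ := fun _ => K) i

theorem miuraDualDeriv_apply (α : K) (x z : ZMod n → K) (i : ZMod n) :
    miuraDualDeriv α x z i = α * (1 - x i) * z (i + 1) - α * x (i + 1) * z i := by
  simp [miuraDualDeriv]

theorem hasFDerivAt_miuraDual (α : K) (x : ZMod n → K) :
    HasFDerivAt (miuraDual α) (miuraDualDeriv α x) x := by
  refine hasFDerivAt_pi.2 fun i => ?_
  have h1 := ((hasFDerivAt_apply (𝕜 := K) (F' := fun _ : ZMod n => K) (i + 1) x).const_mul α).mul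
    ((hasFDerivAt_apply (𝕜 := K) (F' := fun _ : ZMod n => K) i x).const_sub 1)
  refine h1.congr_fderiv (ContinuousLinearMap.ext fun z => ?_)
  simp
  ring

theorem contDiff_miura (α : K) : ContDiff K 1 (miura (n := n) α) := by
  unfold miura
  fun_prop

theorem contDiff_miuraDual (α : K) : ContDiff K 1 (miuraDual (n := n) α) := by
  unfold miuraDual
  fun_prop

/-- A kernel vector z satisfies z_i (1 - x_{i+1}) = x_i z_{i+1}, the infinitesimal form of the fibre
recursion, and the same product argument applies. -/
theorem miuraDeriv_injective {α : K} (hα : α ≠ 0) {x : ZMod n → K} (hx : x ∈ regularParams K n)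
    (hd : ∏ i, x i ≠ ∏ i, (1 - x i)) : Function.Injective (miuraDeriv α x) := by
  rw [injective_iff_map_eq_zero]
  intro z hz
  by_contra h0
  have h1 : ∏ i, (1 - x (i + 1)) = ∏ i, (1 - x i) :=
    Equiv.prod_comp (Equiv.addRight (1 : ZMod n)) fun i => 1 - x i
  refine hd ?_
  rw [← h1]
  refine (prod_eq_prod_of_recursion (δ := z) (fun i => ?_)
    (fun i => sub_ne_zero.2 (hx.2 _).symm) h0).symm
  have h2 := congrFun hz i
  rw [miuraDeriv_apply, Pi.zero_apply] at h2
  apply mul_left_cancel₀ hα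
  linear_combination h2

theorem exists_localInverse_miura {α : K} (hα : α ≠ 0) {x : ZMod n → K}
    (hx : x ∈ regularParams K n) (hd : MvPolynomial.eval (miura α x) (discr n α) ≠ 0) :
    ∃ σ : (ZMod n → K) → ZMod n → K, σ (miura α x) = x ∧ (∀ᶠ y in nhds x, σ (miura α y) = y) ∧
      ∀ᶠ c in nhds (miura α x), ContDiffAt K 1 σ c ∧ miura α (σ c) = c ∧
        σ c ∈ regularParams K n := by
  have hd' : ∏ i, x i ≠ ∏ i, (1 - x i) := fun h => hd (by
    rw [eval_discr_miura hα, h, sub_self]; ring)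
  let e : (ZMod n → K) ≃L[K] (ZMod n → K) := (LinearEquiv.ofInjectiveEndo
    (miuraDeriv α x : (ZMod n → K) →ₗ[K] (ZMod n → K))
    (miuraDeriv_injective hα hx hd')).toContinuousLinearEquiv
  have he : (e : (ZMod n → K) →L[K] (ZMod n → K)) = miuraDeriv α x :=
    ContinuousLinearMap.ext fun z => rfl
  have hf : ContDiffAt K 1 (miura α) x := (contDiff_miura α).contDiffAt
  have hf' : HasFDerivAt (miura α) (e : (ZMod n → K) →L[K] (ZMod n → K)) x := by
    rw [he]; exact hasFDerivAt_miura α x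
  have hs := hf.hasStrictFDerivAt' hf' one_ne_zero
  have h1 : ContDiffAt K 1 (hf.localInverse hf' one_ne_zero) (miura α x) :=
    hf.to_localInverse hf' one_ne_zero
  have h0 := hf.localInverse_apply_image hf' one_ne_zero
  refine ⟨hf.localInverse hf' one_ne_zero, h0, hs.eventually_left_inverse, ?_⟩
  have h2 : ∀ᶠ c in nhds (miura α x), hf.localInverse hf' one_ne_zero c ∈ regularParams K n := by
    apply h1.continuousAt.eventually_mem
    rw [h0]
    exact isOpen_regularParams.mem_nhds hx
  filter_upwards [h1.eventually (by simp), hs.eventually_right_inverse, h2] with c h3 h4 h5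
  exact ⟨h3, h4, h5⟩

theorem exists_branch_of_discr {α : K} (hα : α ≠ 0) {c d : ZMod n → K}
    (hc : MvPolynomial.eval c (discr n α) ≠ 0) (h : CoordRelated α c d) :
    ∃ U T, IsBranch α U T ∧ c ∈ U ∧ T c = d := by
  obtain ⟨hα1, x, hx0, hx1, rfl, rfl⟩ := h.exists_param hα
  obtain ⟨σ, h0, -, h2⟩ := exists_localInverse_miura hα ⟨hx0, hx1⟩ hc
  obtain ⟨U, hU, hUo, hcU⟩ := eventually_nhds_iff.1 h2
  refine ⟨U, fun c => miuraDual α (σ c), ⟨hUo, fun c hc => ?_, fun c hc => ?_⟩, hcU, ?_⟩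
  · exact ((contDiff_miuraDual α).contDiffAt.comp c (hU c hc).1).contDiffWithinAt
  · obtain ⟨-, h3, h4⟩ := hU c hc
    have := coordRelated_miura hα hα1 h4.1 h4.2
    rwa [h3] at this
  · simp only [h0]

end Fibre

/-! ### Branches of the relation are Poisson maps -/

section PoissonMap

variable {K : Type*} [RCLike K] {n : ℕ} [NeZero n]

/-- The vector obtained from a covector by the bracket. -/
def sharp (α : K) (c : ZMod n → K) (ξ : (ZMod n → K) →L[K] K) : ZMod n → K :=
  fun i => ∑ j, poisson α c i j * ξ (Pi.single j 1)

theorem sharp_apply (α : K) (c : ZMod n → K) (ξ : (ZMod n → K) →L[K] K) (i : ZMod n) :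
    sharp α c ξ i = c i * logHam α c (fun j => c j * ξ (Pi.single j 1)) i :=
  sum_poisson_mul α c (fun j => ξ (Pi.single j 1)) i

theorem continuousLinearMap_apply_eq_sum (ξ : (ZMod n → K) →L[K] K) (v : ZMod n → K) :
    ξ v = ∑ i, v i * ξ (Pi.single i 1) := by
  conv_lhs => rw [← Finset.univ_sum_single v, map_sum]
  refine Finset.sum_congr rfl fun i _ => ?_
  rw [← smul_eq_mul, ← map_smul]
  congr 1
  funext j
  by_cases h : j = i
  · subst h; simp
  · simp [h]

theorem bracket_eq_apply_sharp (α : K) (f g : (ZMod n → K) → K) (c : ZMod n → K) :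
    bracket (poisson α) f g c = fderiv K f c (sharp α c (fderiv K g c)) := by
  rw [continuousLinearMap_apply_eq_sum]
  unfold bracket sharp pd
  refine Finset.sum_congr rfl fun i _ => ?_
  rw [Finset.sum_mul]
  exact Finset.sum_congr rfl fun j _ => by ring

/-- The log-canonical bracket of the parameters that is mapped to the bracket of the
cross-ratios. -/
def paramSharp (α : K) (x : ZMod n → K) (ξ : (ZMod n → K) →L[K] K) : ZMod n → K := fun i =>
  -α * (x i * (1 - x i)) * (x (i + 1) * (1 - x (i + 1)) * ξ (Pi.single (i + 1) 1) -
    x (i - 1) * (1 - x (i - 1)) * ξ (Pi.single (i - 1) 1))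

theorem miuraDeriv_single (α : K) (x : ZMod n → K) (l : ZMod n) :
    miuraDeriv α x (Pi.single l 1) =
      (α * (1 - x (l + 1))) • (Pi.single l 1 : ZMod n → K) -
        (α * x (l - 1)) • (Pi.single (l - 1) 1 : ZMod n → K) := by
  funext i
  rw [miuraDeriv_apply]
  simp only [Pi.sub_apply, Pi.smul_apply, smul_eq_mul, Pi.single_apply]
  have e : i + 1 = l ↔ i = l - 1 := ⟨fun h => by rw [← h]; ring, fun h => by rw [h]; ring⟩
  simp only [e]
  congr 1
  · by_cases h : i = l
    · rw [h]
    · simp [h]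
  · by_cases h : i = l - 1
    · rw [h]
    · simp [h]

theorem miuraDualDeriv_single (α : K) (x : ZMod n → K) (l : ZMod n) :
    miuraDualDeriv α x (Pi.single l 1) =
      (α * (1 - x (l - 1))) • (Pi.single (l - 1) 1 : ZMod n → K) -
        (α * x (l + 1)) • (Pi.single l 1 : ZMod n → K) := by
  funext i
  rw [miuraDualDeriv_apply]
  simp only [Pi.sub_apply, Pi.smul_apply, smul_eq_mul, Pi.single_apply]
  have e : i + 1 = l ↔ i = l - 1 := ⟨fun h => by rw [← h]; ring, fun h => by rw [h]; ring⟩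
  simp only [e]
  congr 1
  · by_cases h : i = l - 1
    · rw [h]
    · simp [h]
  · by_cases h : i = l
    · rw [h]
    · simp [h]

theorem index_identities (i : ZMod n) : i + 1 + 1 = i + 2 ∧ i + 1 - 1 = i ∧ i - 1 + 1 = i ∧
    i - 1 - 1 = i - 2 ∧ i + 2 - 1 = i + 1 ∧ i - 2 + 1 = i - 1 ∧ i + 2 + 1 = i + 3 := by
  refine ⟨?_, ?_, ?_, ?_, ?_, ?_, ?_⟩ <;> ring

theorem miuraDeriv_paramSharp (α : K) (x : ZMod n → K) (ξ : (ZMod n → K) →L[K] K) :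
    miuraDeriv α x (paramSharp α x (ξ.comp (miuraDeriv α x))) = sharp α (miura α x) ξ := by
  funext i
  obtain ⟨e1, e2, e3, e4, e5, e6, e7⟩ := index_identities i
  simp only [miuraDeriv_apply, paramSharp, ContinuousLinearMap.comp_apply, miuraDeriv_single,
    map_sub, map_smul, smul_eq_mul, sharp_apply, logHam_apply, quadPart, shiftDiff, miura, e1, e2,
    e3, e4, e5, e6, e7]
  ring

theorem miuraDualDeriv_paramSharp (α : K) (x : ZMod n → K) (ξ : (ZMod n → K) →L[K] K) :
    miuraDualDeriv α x (paramSharp α x (ξ.comp (miuraDualDeriv α x))) =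
      sharp α (miuraDual α x) ξ := by
  funext i
  obtain ⟨e1, e2, e3, e4, e5, e6, e7⟩ := index_identities i
  simp only [miuraDualDeriv_apply, paramSharp, ContinuousLinearMap.comp_apply,
    miuraDualDeriv_single, map_sub, map_smul, smul_eq_mul, sharp_apply, logHam_apply, quadPart,
    shiftDiff, miuraDual, e1, e2, e3, e4, e5, e6, e7]
  ring

/-- `T` preserves the bracket at `c`. -/
def PoissonAt (α : K) (T : (ZMod n → K) → ZMod n → K) (c : ZMod n → K) : Prop :=
  ∀ ξ : (ZMod n → K) →L[K] K,
    fderiv K T c (sharp α c (ξ.comp (fderiv K T c))) = sharp α (T c) ξ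

/-- By the chain rule T carries the derivative of `miura` to that of `miuraDual`, and both push the
same bracket of parameters forward. -/
theorem poissonAt_of_comp_miura {α : K} {T : (ZMod n → K) → ZMod n → K} {x : ZMod n → K}
    (hT : DifferentiableAt K T (miura α x))
    (h : ∀ᶠ y in nhds x, T (miura α y) = miuraDual α y) : PoissonAt α T (miura α x) := by
  have h1 : (fderiv K T (miura α x)).comp (miuraDeriv α x) = miuraDualDeriv α x :=
    ((hT.hasFDerivAt.comp x (hasFDerivAt_miura α x)).congr_of_eventuallyEq
      (h.mono fun y hy => hy.symm)).unique (hasFDerivAt_miuraDual α x)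
  intro ξ
  rw [← miuraDeriv_paramSharp, h.self_of_nhds, ← miuraDualDeriv_paramSharp,
    ContinuousLinearMap.comp_assoc, h1, ← ContinuousLinearMap.comp_apply, h1]

theorem poissonAt_of_eventuallyEq {α : K} {T σ : (ZMod n → K) → ZMod n → K} {x : ZMod n → K}
    (hT : DifferentiableAt K T (miura α x)) (hσ : ∀ᶠ y in nhds x, σ (miura α y) = y)
    (h : ∀ᶠ c in nhds (miura α x), T c = miuraDual α (σ c)) : PoissonAt α T (miura α x) := by
  refine poissonAt_of_comp_miura hT ?_
  have := ((contDiff_miura α).continuous.continuousAt (x := x)).eventually h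
  filter_upwards [this, hσ] with y h1 h2
  rw [h1, h2]

theorem bracket_comp_of_poissonAt {α : K} {T : (ZMod n → K) → ZMod n → K} {c : ZMod n → K}
    (h : PoissonAt α T c) (hT : DifferentiableAt K T c) {f g : (ZMod n → K) → K}
    (hf : DifferentiableAt K f (T c)) (hg : DifferentiableAt K g (T c)) :
    bracket (poisson α) (f ∘ T) (g ∘ T) c = bracket (poisson α) f g (T c) := by
  rw [bracket_eq_apply_sharp, bracket_eq_apply_sharp, fderiv_comp c hf hT, fderiv_comp c hg hT,
    ContinuousLinearMap.comp_apply, h]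

theorem continuous_poisson_entry (α : K) (i j : ZMod n) :
    Continuous fun c : ZMod n → K => poisson α c i j := by
  simp only [poisson_eq_logHam, logHam_apply, quadPart, shiftDiff]
  fun_prop

theorem exists_mem_eval_ne_zero {g : MvPolynomial (ZMod n) K} (hg : g ≠ 0)
    {V : Set (ZMod n → K)} (hV : IsOpen V) (hne : V.Nonempty) :
    ∃ c ∈ V, MvPolynomial.eval c g ≠ 0 := by
  obtain ⟨c, hc⟩ := hne
  obtain ⟨r, hr, hball⟩ := Metric.isOpen_iff.1 hV c hc
  by_contra hcon
  push Not at hcon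
  refine hg (MvPolynomial.funext_set (fun i => Metric.ball (c i) r)
    (fun i => infinite_of_mem_nhds (c i) (Metric.ball_mem_nhds _ hr)) fun x hx => ?_)
  rw [map_zero]
  refine hcon x (hball ?_)
  rw [ball_pi c hr]
  exact hx

/-- A branch of the relation is a Poisson map on a dense set. -/
theorem exists_poissonAt {α : K} (hα : α ≠ 0) {U : Set (ZMod n → K)}
    {T : (ZMod n → K) → ZMod n → K} (hT : IsBranch α U T) {V : Set (ZMod n → K)} (hV : IsOpen V)
    (hVU : V ⊆ U) (hne : V.Nonempty) : ∃ c ∈ V, PoissonAt α T c := by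
  have hTd : ∀ c ∈ U, DifferentiableAt K T c := fun c hc =>
    (hT.contDiffOn.differentiableOn one_ne_zero c hc).differentiableAt (hT.isOpen.mem_nhds hc)
  have hparam : ∀ c ∈ U, ∃ x ∈ regularParams K n, miura α x = c ∧ miuraDual α x = T c := by
    intro c hc
    obtain ⟨-, x, h0, h1, h2, h3⟩ := (hT.related c hc).exists_param hα
    exact ⟨x, ⟨h0, h1⟩, h2, h3⟩
  obtain ⟨c₁, hc₁, hd₁⟩ := exists_mem_eval_ne_zero (discr_ne_zero (n := n) α) hV hne
  obtain ⟨x₁, hx₁, rfl, hTx₁⟩ := hparam c₁ (hVU hc₁)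
  obtain ⟨σ, hσ0, hσl, hσ⟩ := exists_localInverse_miura hα hx₁ hd₁
  -- If T does not follow σ near the first point, it differs from `miuraDual α ∘ σ` at a nearby
  -- point, hence around it. The parameter of T there starts a second inverse τ distinct from σ, and
  -- as the fibre has at most two regular points, T must follow τ.
  by_cases hcase : ∀ᶠ c in nhds (miura α x₁), T c = miuraDual α (σ c)
  · exact ⟨_, hc₁, poissonAt_of_eventuallyEq (hTd _ (hVU hc₁)) hσl hcase⟩
  have hdcont : Continuous fun c : ZMod n → K => MvPolynomial.eval c (discr n α) :=
    MvPolynomial.continuous_eval _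
  obtain ⟨c₂, hTσ, ⟨hc₂, hd₂⟩, hσ₂⟩ := ((Filter.not_eventually.1 hcase).and_eventually
    (((hV.eventually_mem hc₁).and (hdcont.continuousAt.eventually_ne hd₁)).and
      (eventually_eventually_nhds.2 hσ))).exists
  obtain ⟨hσc, hσφ, hσr⟩ := hσ₂.self_of_nhds
  obtain ⟨x₂, hx₂, rfl, hTx₂⟩ := hparam c₂ (hVU hc₂)
  obtain ⟨τ, hτ0, hτl, hτ⟩ := exists_localInverse_miura hα hx₂ hd₂
  refine ⟨_, hc₂, poissonAt_of_eventuallyEq (hTd _ (hVU hc₂)) hτl ?_⟩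
  have hcontσ : ContinuousAt (fun c => miuraDual α (σ c)) (miura α x₂) :=
    ContinuousAt.comp (contDiff_miuraDual α).continuous.continuousAt hσc.continuousAt
  have hne1 : ∀ᶠ c in nhds (miura α x₂), T c ≠ miuraDual α (σ c) :=
    (hTd _ (hVU hc₂)).continuousAt.ne_iff_eventually_ne hcontσ |>.1 hTσ
  have hne2 : ∀ᶠ c in nhds (miura α x₂), σ c ≠ τ c := by
    refine (hσc.continuousAt.ne_iff_eventually_ne hτ.self_of_nhds.1.continuousAt).1 fun h => ?_
    apply hTσ
    rw [h, hτ0, hTx₂]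
  filter_upwards [hne1, hne2, hσ₂, hτ, hV.eventually_mem hc₂,
    hdcont.continuousAt.eventually_ne hd₂] with c h1 h2 h3 h4 h5 h6
  obtain ⟨x, hx, hxc, hTx⟩ := hparam c (hVU h5)
  have hd : ∏ i, σ c i ≠ ∏ i, (1 - σ c i) := fun h => h6 (by
    rw [← h3.2.1, eval_discr_miura hα, h, sub_self]; ring)
  rcases eq_or_eq_of_miura_eq hα h3.2.2 hx (h3.2.1.trans h4.2.1.symm)
    (h3.2.1.trans hxc.symm) h2 hd with h | h
  · exact absurd (by rw [← h, hTx]) h1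
  · rw [← h, hTx]

/-- Both sides of the Poisson condition are continuous, as T is C^1. If they differed at c, they
would differ on a neighbourhood, against `exists_poissonAt`. -/
theorem poissonAt_of_isBranch {α : K} (hα : α ≠ 0) {U : Set (ZMod n → K)}
    {T : (ZMod n → K) → ZMod n → K} (hT : IsBranch α U T) {c : ZMod n → K} (hc : c ∈ U) :
    PoissonAt α T c := by
  intro ξ
  by_contra hcon
  have hTc : ContinuousOn T U := hT.contDiffOn.continuousOn
  have hD : ContinuousOn (fderiv K T) U :=
    hT.contDiffOn.continuousOn_fderiv_of_isOpen hT.isOpen le_rfl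
  have h1 : ContinuousOn (fun c => sharp α c (ξ.comp (fderiv K T c))) U := by
    refine continuousOn_pi.2 fun i => ?_
    unfold sharp
    refine continuousOn_finsetSum _ fun j _ => ?_
    refine (continuous_poisson_entry α i j).continuousOn.mul ?_
    exact ξ.continuous.comp_continuousOn (hD.clm_apply continuousOn_const)
  have h2 : ContinuousOn (fun c => sharp α (T c) ξ) U := by
    refine continuousOn_pi.2 fun i => ?_
    unfold sharp
    refine continuousOn_finsetSum _ fun j _ => ?_
    exact ((continuous_poisson_entry α i j).comp_continuousOn hTc).mul continuousOn_const
  have h3 := hT.isOpen.mem_nhds hc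
  have h4 := ((hD.clm_apply h1).continuousAt h3).ne_iff_eventually_ne (h2.continuousAt h3) |>.1 hcon
  obtain ⟨V, hV, hVo, hcV⟩ := eventually_nhds_iff.1 (h4.and (hT.isOpen.eventually_mem hc))
  obtain ⟨c', hc', hP⟩ := exists_poissonAt hα hT hVo (fun y hy => (hV y hy).2) ⟨c, hcV⟩
  exact (hV c' hc').1 (hP ξ)

theorem isInvariant_poisson {α : K} (hα : α ≠ 0) : IsInvariant α (poisson (n := n) α) where
  exists_branch := ⟨discr n α, discr_ne_zero α, fun _ _ hc _ h => exists_branch_of_discr hα hc h⟩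
  isPoissonMap _ _ hT c hc _ _ hf hg :=
    bracket_comp_of_poissonAt (poissonAt_of_isBranch hα hT hc)
      ((hT.contDiffOn.differentiableOn one_ne_zero c hc).differentiableAt (hT.isOpen.mem_nhds hc))
      hf hg

theorem integrals_eq_of_related {α : K} (hα : α ≠ 0) {P Q : Moduli K n} (h : P.Related α Q)
    (k : Fin (n / 2 + 1)) : integrals K n k P.coord = integrals K n k Q.coord := by
  obtain ⟨P, Q, rfl, rfl, h⟩ := h
  obtain ⟨x, h0, h1, -, hP, hQ⟩ := h.exists_param hα
  rw [Moduli.coord_mk, Moduli.coord_mk, hP, hQ]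
  refine Fin.cases ?_ (fun k => ?_) k
  · exact prod_miura_eq_dual x
  · exact sumSparse_miura_eq_dual hα h0 h1 (k + 1)

end PoissonMap

end TwistedIdeal

end

open TwistedIdeal in
theorem theorem1 {K : Type*} [RCLike K] (n : ℕ) [NeZero n] (α : K) (hα : α ≠ 0) :
    -- the cross-ratios are coordinates on the moduli space
    (Function.Injective (Moduli.coord : Moduli K n → ZMod n → K) ∧
      Set.range (Moduli.coord : Moduli K n → ZMod n → K) = torus K n) ∧
    -- the brackets are Poisson, and the one with parameter `α` is invariant
    (∀ β : K, IsPoisson (poisson (n := n) β)) ∧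
    IsInvariant α (poisson (n := n) α) ∧
    -- the integrals are invariant and independent
    (∀ P Q : Moduli K n, P.Related α Q →
      ∀ k, integrals K n k P.coord = integrals K n k Q.coord) ∧
    Independent (integrals K n) ∧
    -- the normalized integrals commute
    (∀ k l : ℕ, k ≤ n / 2 → l ≤ n / 2 → ∀ c ∈ torus K n,
      bracket (poisson α) (normF k) (normF l) c = 0) ∧
    -- `n` odd
    (Odd n →
      (Generically fun c : ZMod n → K => (poisson α c).rank + 1 = n) ∧
      IsCasimir (poisson (n := n) α) (casimirE α) ∧
      Independent (n := n) (Fin.cons (casimirE α) fun k : Fin (n / 2) => normF (k + 1))) ∧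
    -- `n` even
    (Even n →
      (Generically fun c : ZMod n → K => (poisson α c).rank + 2 = n) ∧
      IsCasimir (poisson (n := n) α) (casimirE α) ∧
      IsCasimir (poisson (n := n) α) evenOdd ∧
      Independent (n := n) (Fin.cons (casimirE α)
        (Fin.cons evenOdd fun k : Fin (n / 2 - 1) => normF (k + 1)))) ∧
    -- at each point, the span of the Hamiltonian vectors of the integrals is the same for all the
    -- brackets
    (∀ β γ : K, ∀ c ∈ torus K n,
      Submodule.span K (Set.range fun k => hamiltonian (poisson β) (integrals K n k) c) =
        Submodule.span K (Set.range fun k => hamiltonian (poisson γ) (integrals K n k) c)) ∧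
    -- where a branch `s` of the square root of (a constant multiple of) the product of all the
    -- coordinates is chosen, the space of vector fields spanned over the constants by the
    -- Hamiltonian vector fields of `F_k / s` is the same for all the brackets
    (∀ U : Set (ZMod n → K), IsOpen U → U ⊆ torus K n → ∀ s : (ZMod n → K) → K,
      DifferentiableOn K s U → ∀ ε : K, ε ≠ 0 → (∀ c ∈ U, s c ^ 2 = ε * prodAll c) →
      ∀ β γ : K,
        Submodule.span K (Set.range fun (k : Fin (n / 2 + 1)) (c : U) =>
            hamiltonian (poisson β) (fun x => F k x / s x) c) =
          Submodule.span K (Set.range fun (k : Fin (n / 2 + 1)) (c : U) =>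
            hamiltonian (poisson γ) (fun x => F k x / s x) c)) := by
  exact ⟨⟨Moduli.coord_injective, Moduli.range_coord⟩, isPoisson_poisson, isInvariant_poisson hα,
    fun _ _ h k => integrals_eq_of_related hα h k, independent_integrals,
    fun k l _ _ _ hc => bracket_normF α k l hc,
    fun hn => ⟨generically_rank_of_odd hn hα, isCasimir_casimirE hα, independent_of_odd α⟩,
    fun hn => ⟨generically_rank_of_even hn hα, isCasimir_casimirE hα, isCasimir_evenOdd hn α,
      independent_of_even hn α⟩,
    fun β γ _ hc =>
      (span_hamiltonian_integrals β hc).trans (span_hamiltonian_integrals γ hc).symm,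
    fun _ hU hUt _ hs _ hε h β γ =>
      (span_hamiltonian_div_sqrt hU hUt hs hε h β).trans
        (span_hamiltonian_div_sqrt hU hUt hs hε h γ).symm⟩
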